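/- Let $\mathcal C$ be a left cancellative small category (identified with its set of morphisms), with range and source maps $r,s$; the product $\alpha\beta$ is defined iff $s(\alpha)=r(\beta)$. For $\alpha\in\mathcal C$ let $\tau_\alpha\colon s(\alpha)\mathcal C\to\alpha\mathcal C$, $\beta\mapsto\alpha\beta$, and $\sigma_\alpha=\tau_\alpha^{-1}$, regarded as elements of the inverse semigroup of partial bijections of $\mathcal C$. Let $\mathrm{ZM}(\mathcal C)$ be the subsemigroup generated by all $\tau_\alpha,\sigma_\alpha$ and the empty map. A zigzag is a tuple $\zeta=(\alpha_1,\beta_1,\dots,\alpha_n,\beta_n)$, $n\ge 1$, with $r(\alpha_i)=r(\beta_i)$ and $s(\beta_i)=s(\alpha_{i+1})$; its reverse is $\bar\zeta=(\beta_n,\alpha_n,\dots,\beta_1,\alpha_1)$, its zigzag map is $\varphi_\zeta=\sigma_{\alpha_1}\tau_{\beta_1}\cdots\sigma_{\alpha_n}\tau_{\beta_n}\in\mathrm{ZM}(\mathcal C)$, and $A(\zeta)=\beta_n^{-1}\alpha_n\cdots\beta_1^{-1}\alpha_1\mathcal C=\mathrm{dom}(\varphi_\zeta)$, where $\alpha X=\tau_\alpha(s(\alpha)\mathcal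 C\cap X)$ and $\alpha^{-1}X=\sigma_\alpha(\alpha\mathcal C\cap X)$. Let $\mathcal J(\mathcal C)=\{A(\zeta)\}\cup\{\varnothing\}$ and let $\mathcal J^{(\cup)}(\mathcal C)$ be the set of finite unions of members of $\mathcal J(\mathcal C)$. For partial isometries $v_\alpha$ ($\alpha\in\mathcal C$) and projections $p_X$ ($X$ in $\mathcal J(\mathcal C)$, respectively $\mathcal J^{(\cup)}(\mathcal C)$) in a $C^*$-algebra consider the relations: (L1) $v_\alpha^*v_\alpha=p_{s(\alpha)\mathcal C}$; (L2) $v_\alpha v_\beta=v_{\alpha\beta}$ if $s(\alpha)=r(\beta)$, and $v_\alpha v_\beta=0$ otherwise; (L3) $p_\varnothing=0$; (L4) $p_Xp_Y=p_{X\cap Y}$; (L5) $v_\alpha p_Xv_\alpha^*=p_{\alpha X}$; (L6) $p_{X\cup Y}=p_X\vee p_Y=p_X+p_Y-p_Xp_Y$; (L7) $v_{\alpha_1}^*v_{\beta_1}\cdots v_{\alpha_n}^*v_{\beta_n}=p_{A(\zeta)}$ for every zigzag $\zeta=(\alpha_1,\beta_1,\dots,\alpha_n,\beta_n)$ with $\varphi_\zeta=\mathrm{id}_{A(\zeta)}$.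 Let $C^*_{\rm Li}(\mathcal C)$ and $C^*_{{\rm Li},s}(\mathcal C)$ be the universal $C^*$-algebras for (L1)–(L5), respectively (L1)–(L3) and (L7), with $X$ ranging over $\mathcal J(\mathcal C)$; let $C^{*(\cup)}_{\rm Li}(\mathcal C)$ and $C^{*(\cup)}_{{\rm Li},s}(\mathcal C)$ be the universal $C^*$-algebras for (L1)–(L6), respectively (L1)–(L3), (L6) and (L7), with $X$ ranging over $\mathcal J^{(\cup)}(\mathcal C)$. Let $C^*(\mathrm{ZM}(\mathcal C))$ be universal for zero-preserving $*$-representations $\pi$ of the inverse semigroup $\mathrm{ZM}(\mathcal C)$ in $C^*$-algebras, and let the Toeplitz algebra $\mathcal T(\mathcal C)$ be universal for those which are finitely join-preserving: $\pi(\mathrm{id}_{A(\zeta)})=\bigvee_{j=1}^n\pi(\mathrm{id}_{A(\zeta_j)})$ whenever $A(\zeta)=\bigcup_{j=1}^nA(\zeta_j)$. Write $t'_\zeta$ and $t_\zeta$ for the images of $\varphi_\zeta$ in $C^*(\mathrm{ZM}(\mathcal C))$ and $\mathcal T(\mathcal C)$. Consider the canonical $*$-homomorphisms $g\colon C^*_{{\rm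 Li},s}(\mathcal C)\to C^*(\mathrm{ZM}(\mathcal C))$, $v_\alpha\mapsto t'_{(r(\alpha),\alpha)}$, $p_{A(\zeta)}\mapsto t'_{\bar\zeta\zeta}$; $\mu\colon C^{*(\cup)}_{{\rm Li},s}(\mathcal C)\to\mathcal T(\mathcal C)$, $v_\alpha\mapsto t_{(r(\alpha),\alpha)}$, $p_{A(\zeta)}\mapsto t_{\bar\zeta\zeta}$; $q\colon C^*(\mathrm{ZM}(\mathcal C))\to\mathcal T(\mathcal C)$, $t'_\zeta\mapsto t_\zeta$; and the maps carrying generators to the generators of the same name, $\pi_s\colon C^*_{\rm Li}(\mathcal C)\to C^*_{{\rm Li},s}(\mathcal C)$, $\rho_s\colon C^{*(\cup)}_{\rm Li}(\mathcal C)\to C^{*(\cup)}_{{\rm Li},s}(\mathcal C)$, $\pi^{(\cup)}\colon C^*_{\rm Li}(\mathcal C)\to C^{*(\cup)}_{\rm Li}(\mathcal C)$, $\rho^{(\cup)}\colon C^*_{{\rm Li},s}(\mathcal C)\to C^{*(\cup)}_{{\rm Li},s}(\mathcal C)$. Call $\mathcal C$ finitely aligned if every $\alpha\mathcal C\cap\beta\mathcal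 C$ is a finite union of sets $\gamma\mathcal C$. **Theorem.** (i) For every left cancellative small category $\mathcal C$, $g$ exists and is an isomorphism. (ii) For every left cancellative small category $\mathcal C$, $\mu$ exists and is an isomorphism. (iii) If $\mathcal C$ is finitely aligned, then $\rho_s$ exists and is an isomorphism. (iv) There is a finitely aligned left cancellative small category $\mathcal C$, which is in fact a $2$-graph, such that none of $\pi^{(\cup)}$, $\rho^{(\cup)}$ and $q$ is injective. (v) There is a finitely aligned left cancellative small category $\mathcal C$, which is in fact a $2$-graph, such that $\pi_s$ is not injective. -/

import Mathlib

open CategoryTheory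

universe u v

set_option linter.unusedSectionVars false

/-! ## Universal `C*`-algebras -/

theorem norm_le_one_of_partialIsometry {B : Type*} [NonUnitalCStarAlgebra B] {x : B}
    (h : x * star x * x = x) : ‖x‖ ≤ 1 := by
  have h1 : ‖star x * x‖ = ‖x‖ * ‖x‖ := CStarRing.norm_star_mul_self
  have h2 : star (star x * x) * (star x * x) = star x * x := by
    rw [star_mul, star_star, mul_assoc, ← mul_assoc x, h]
  have h3 : ‖star x * x‖ = ‖star x * x‖ * ‖star x * x‖ := by
    conv_lhs => rw [← h2]
    exact CStarRing.norm_star_mul_self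
  rw [h1] at h3
  by_contra! hx
  have h4 : 1 < ‖x‖ * ‖x‖ := by nlinarith
  nlinarith

theorem norm_le_one_of_projection {B : Type*} [NonUnitalCStarAlgebra B] {p : B}
    (h : IsStarProjection p) : ‖p‖ ≤ 1 := by
  refine norm_le_one_of_partialIsometry ?_
  rw [h.isSelfAdjoint.star_eq, h.isIdempotentElem.eq, h.isIdempotentElem.eq]

theorem continuous_starHom {A B : Type*} [NonUnitalCStarAlgebra A] [NonUnitalCStarAlgebra B]
    (φ : A →⋆ₙₐ[ℂ] B) : Continuous φ :=
  AddMonoidHomClass.continuous_of_bound φ 1 fun a => by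
    simpa using NonUnitalStarAlgHom.norm_apply_le φ a

/-- A transport of a `C*`-algebra to an equivalent type in a smaller universe. -/
def SmallCopy (A : Type v) [Small.{u} A] : Type u := Shrink.{u} A

namespace SmallCopy

variable (A : Type v) [Small.{u} A]

noncomputable def equiv : SmallCopy.{u} A ≃ A := (equivShrink A).symm

variable [NonUnitalCStarAlgebra A]

noncomputable instance : NonUnitalRing (SmallCopy.{u} A) := (equiv A).nonUnitalRing
noncomputable instance : Module ℂ (SmallCopy.{u} A) := (equiv A).module ℂ
noncomputable instance : Star (SmallCopy.{u} A) := ⟨fun a => (equiv A).symm (star (equiv A a))⟩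

variable {A}

theorem equiv_add (a b : SmallCopy.{u} A) : equiv A (a + b) = equiv A a + equiv A b :=
  (equiv A).apply_symm_apply _
theorem equiv_mul (a b : SmallCopy.{u} A) : equiv A (a * b) = equiv A a * equiv A b :=
  (equiv A).apply_symm_apply _
theorem equiv_zero : equiv A (0 : SmallCopy.{u} A) = 0 :=
  (equiv A).apply_symm_apply _
theorem equiv_smul (c : ℂ) (a : SmallCopy.{u} A) : equiv A (c • a) = c • equiv A a :=
  (equiv A).apply_symm_apply _
theorem equiv_star (a : SmallCopy.{u} A) : equiv A (star a) = star (equiv A a) :=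
  (equiv A).apply_symm_apply _

noncomputable def toHom : SmallCopy.{u} A →ₙ+* A where
  toFun := equiv A
  map_mul' := equiv_mul
  map_add' := equiv_add
  map_zero' := equiv_zero

noncomputable instance : NonUnitalNormedRing (SmallCopy.{u} A) :=
  NonUnitalNormedRing.induced _ _ (toHom (A := A)) (equiv A).injective

theorem norm_eq (a : SmallCopy.{u} A) : ‖a‖ = ‖equiv A a‖ := rfl

noncomputable instance : StarRing (SmallCopy.{u} A) where
  star_involutive a := (equiv A).injective (by simp [equiv_star])
  star_mul a b := (equiv A).injective (by simp [equiv_star, equiv_mul])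
  star_add a b := (equiv A).injective (by simp [equiv_star, equiv_add])

instance : IsScalarTower ℂ (SmallCopy.{u} A) (SmallCopy.{u} A) where
  smul_assoc c a b := (equiv A).injective (by simp [equiv_smul, equiv_mul, smul_mul_assoc])

instance : SMulCommClass ℂ (SmallCopy.{u} A) (SmallCopy.{u} A) where
  smul_comm c a b := (equiv A).injective (by simp [equiv_smul, equiv_mul, mul_smul_comm])

instance : StarModule ℂ (SmallCopy.{u} A) where
  star_smul c a := (equiv A).injective (by simp [equiv_smul, equiv_star])

instance : CStarRing (SmallCopy.{u} A) where
  norm_mul_self_le a := by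
    simp only [norm_eq, equiv_mul, equiv_star]
    exact CStarRing.norm_mul_self_le _

noncomputable instance : NormedSpace ℂ (SmallCopy.{u} A) where
  norm_smul_le c a := by
    simp only [norm_eq, equiv_smul]
    exact norm_smul_le _ _

instance : CompleteSpace (SmallCopy.{u} A) := by
  have h : Isometry (equiv.{u} A) := AddMonoidHomClass.isometry_of_norm (toHom (A := A)) fun a => rfl
  exact (h.isUniformInducing.completeSpace_congr (equiv A).surjective).2 inferInstance

noncomputable instance : NonUnitalCStarAlgebra (SmallCopy.{u} A) where

/-- The transport, as a `*`-homomorphism. -/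
noncomputable def starHom : SmallCopy.{u} A →⋆ₙₐ[ℂ] A where
  toFun := equiv A
  map_smul' := equiv_smul
  map_zero' := equiv_zero
  map_add' := equiv_add
  map_mul' := equiv_mul
  map_star' := equiv_star

end SmallCopy

/-- Relations on a family of elements, indexed by `X`, of a variable `C*`-algebra; they are
required to bound the norm of each member of the family by `1` (as is the case as soon as they say
that each member is a partial isometry). -/
structure CStarRelations (X : Type u) where
  Holds : ∀ {B : Type u} [NonUnitalCStarAlgebra B], (X → B) → Prop
  norm_le_one : ∀ {B : Type u} [NonUnitalCStarAlgebra B] {f : X → B}, Holds f → ∀ x, ‖f x‖ ≤ 1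

/-- A family in some `C*`-algebra satisfying the relations `R`. -/
structure CStarFamily {X : Type u} (R : CStarRelations X) : Type (u + 1) where
  alg : Type u
  [inst : NonUnitalCStarAlgebra alg]
  fam : X → alg
  holds : R.Holds fam

attribute [instance] CStarFamily.inst

/-- `*`-polynomial expressions in indeterminates indexed by `X`. -/
inductive StarExpr (X : Type u) : Type u
  | zero : StarExpr X
  | var (x : X) : StarExpr X
  | add (a b : StarExpr X) : StarExpr X
  | mul (a b : StarExpr X) : StarExpr X
  | smul (c : ℂ) (a : StarExpr X) : StarExpr X
  | star (a : StarExpr X) : StarExpr X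

def StarExpr.eval {X : Type u} {B : Type v} [NonUnitalCStarAlgebra B] (f : X → B) :
    StarExpr X → B
  | .zero => 0
  | .var x => f x
  | .add a b => a.eval f + b.eval f
  | .mul a b => a.eval f * b.eval f
  | .smul c a => c • a.eval f
  | .star a => Star.star (a.eval f)

theorem StarExpr.map_eval {X : Type u} {B B' : Type*} [NonUnitalCStarAlgebra B]
    [NonUnitalCStarAlgebra B'] (φ : B →⋆ₙₐ[ℂ] B') (f : X → B) (e : StarExpr X) :
    φ (e.eval f) = e.eval fun x => φ (f x) := by
  induction e with
  | zero => exact map_zero φ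
  | var x => rfl
  | add a b ha hb => simp [eval, ha, hb]
  | mul a b ha hb => simp [eval, ha, hb]
  | smul c a ha => simp [eval, ha]
  | star a ha => simp [eval, ha, map_star]

/-- The `C*`-subalgebra generated by a family. -/
def generatedCStar {X : Type u} {B : Type v} [NonUnitalCStarAlgebra B] (f : X → B) :
    NonUnitalStarSubalgebra ℂ B :=
  (NonUnitalStarAlgebra.adjoin ℂ (Set.range f)).topologicalClosure

instance {X : Type u} {B : Type v} [NonUnitalCStarAlgebra B] (f : X → B) :
    IsClosed (generatedCStar f : Set B) :=
  NonUnitalStarSubalgebra.isClosed_topologicalClosure _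

theorem exists_eval_of_mem_adjoin {X : Type u} {B : Type v} [NonUnitalCStarAlgebra B] (f : X → B)
    {b : B} (hb : b ∈ NonUnitalStarAlgebra.adjoin ℂ (Set.range f)) :
    ∃ e : StarExpr X, e.eval f = b := by
  induction hb using NonUnitalStarAlgebra.adjoin_induction with
  | mem x hx => obtain ⟨x, rfl⟩ := hx; exact ⟨.var x, rfl⟩
  | add x y _ _ hx hy =>
    obtain ⟨a, rfl⟩ := hx; obtain ⟨b, rfl⟩ := hy; exact ⟨.add a b, rfl⟩
  | zero => exact ⟨.zero, rfl⟩
  | mul x y _ _ hx hy =>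
    obtain ⟨a, rfl⟩ := hx; obtain ⟨b, rfl⟩ := hy; exact ⟨.mul a b, rfl⟩
  | smul r x _ hx => obtain ⟨a, rfl⟩ := hx; exact ⟨.smul r a, rfl⟩
  | star x _ hx => obtain ⟨a, rfl⟩ := hx; exact ⟨.star a, rfl⟩

instance small_generatedCStar {X : Type u} {B : Type v} [NonUnitalCStarAlgebra B] (f : X → B) :
    Small.{u} (generatedCStar f) := by
  classical
  have key : ∀ b : generatedCStar f, ∃ e : ℕ → StarExpr X,
      Filter.Tendsto (fun n => (e n).eval f) Filter.atTop (nhds (b : B)) := by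
    rintro ⟨b, hb⟩
    obtain ⟨s, hs, hlim⟩ := mem_closure_iff_seq_limit.1 hb
    choose e he using fun n => exists_eval_of_mem_adjoin f (hs n)
    exact ⟨e, by simpa only [he] using hlim⟩
  choose e he using key
  refine small_of_injective (f := e) fun a b hab => Subtype.ext ?_
  exact tendsto_nhds_unique (he a) (hab ▸ he b)

namespace UnivCStar

variable {X : Type u} (R : CStarRelations X)

/-- The direct sum of all families satisfying `R`, as a bounded family in the `ℓ^∞`-product. -/
noncomputable def bigGen (x : X) : lp (fun i : CStarFamily R => i.alg) ⊤ :=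
  ⟨fun i => i.fam x, memℓp_infty ⟨1, by rintro _ ⟨i, rfl⟩; exact R.norm_le_one i.holds x⟩⟩

end UnivCStar

/-- The universal `C*`-algebra generated by a family satisfying the relations `R`: the
`C*`-algebra generated by the direct sum of all families that satisfy `R`.
(It is transported to the universe of `X` so that its universal property applies to algebras of the
same kind.) -/
def UnivCStar {X : Type u} (R : CStarRelations X) : Type u :=
  SmallCopy.{u} (generatedCStar (UnivCStar.bigGen R))

namespace UnivCStar

variable {X : Type u} {R : CStarRelations X}

noncomputable instance : NonUnitalCStarAlgebra (UnivCStar R) :=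
  inferInstanceAs (NonUnitalCStarAlgebra (SmallCopy.{u} (generatedCStar (bigGen R))))

variable (R) in
/-- The generators of the universal `C*`-algebra. -/
noncomputable def gen (x : X) : UnivCStar R :=
  (SmallCopy.equiv (generatedCStar (bigGen R))).symm
    ⟨bigGen R x, NonUnitalStarSubalgebra.le_topologicalClosure _
      (NonUnitalStarAlgebra.subset_adjoin ℂ _ ⟨x, rfl⟩)⟩

variable (R) in
noncomputable def toBig : UnivCStar R →⋆ₙₐ[ℂ] lp (fun i : CStarFamily R => i.alg) ⊤ :=
  (NonUnitalStarSubalgebraClass.subtype (generatedCStar (bigGen R))).comp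
    (SmallCopy.starHom (A := generatedCStar (bigGen R)))

theorem toBig_injective : Function.Injective (toBig R) := fun _ _ h =>
  (SmallCopy.equiv (generatedCStar (bigGen R))).injective (Subtype.ext h)

theorem toBig_gen (x : X) : toBig R (gen R x) = bigGen R x :=
  congrArg Subtype.val ((SmallCopy.equiv (generatedCStar (bigGen R))).apply_symm_apply _)

/-- Universal property, existence: every family satisfying the relations is the image of the
universal one under a `*`-homomorphism. -/
noncomputable def lift {B : Type u} [NonUnitalCStarAlgebra B] {f : X → B} (hf : R.Holds f) :
    UnivCStar R →⋆ₙₐ[ℂ] B where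
  toFun a := toBig R a ⟨B, f, hf⟩
  map_smul' c a := by rw [map_smul]; rfl
  map_zero' := by rw [map_zero]; rfl
  map_add' a b := by rw [map_add]; rfl
  map_mul' a b := by rw [map_mul]; rfl
  map_star' a := by rw [map_star]; rfl

@[simp]
theorem lift_gen {B : Type u} [NonUnitalCStarAlgebra B] {f : X → B} (hf : R.Holds f) (x : X) :
    lift hf (gen R x) = f x := by
  change toBig R (gen R x) ⟨B, f, hf⟩ = f x
  rw [toBig_gen]; rfl

/-- An identity between elements of the universal algebra holds as soon as it holds in each
family satisfying the relations. -/
theorem ext_of_lift {a b : UnivCStar R}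
    (h : ∀ {B : Type u} [NonUnitalCStarAlgebra B] {f : X → B} (hf : R.Holds f),
      lift hf a = lift hf b) : a = b :=
  toBig_injective (lp.ext (funext fun i => h i.holds))

/-- Universal property, uniqueness: `*`-homomorphisms are determined by the generators. -/
theorem hom_ext {B : Type v} [NonUnitalCStarAlgebra B] {φ ψ : UnivCStar R →⋆ₙₐ[ℂ] B}
    (h : ∀ x, φ (gen R x) = ψ (gen R x)) : φ = ψ := by
  ext a
  have hmem : toBig R a ∈ generatedCStar (bigGen R) :=
    (SmallCopy.equiv (generatedCStar (bigGen R)) a).2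
  obtain ⟨s, hs, hlim⟩ := mem_closure_iff_seq_limit.1 hmem
  choose e he using fun n => exists_eval_of_mem_adjoin (bigGen R) (hs n)
  have hgen : (bigGen R) = fun x => toBig R (gen R x) := funext fun x => (toBig_gen x).symm
  have hlim' : Filter.Tendsto (fun n => (e n).eval (gen R)) Filter.atTop (nhds a) := by
    have hiso : Isometry (toBig R) :=
      NonUnitalStarAlgHom.isometry (toBig R) toBig_injective
    rw [hiso.isEmbedding.tendsto_nhds_iff]
    refine hlim.congr fun n => ?_
    rw [← he n, Function.comp_apply, StarExpr.map_eval, hgen]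
  have hφ := ((continuous_starHom φ).tendsto a).comp hlim'
  have hψ := ((continuous_starHom ψ).tendsto a).comp hlim'
  refine tendsto_nhds_unique hφ (hψ.congr fun n => ?_)
  simp only [Function.comp_apply, StarExpr.map_eval, h]

end UnivCStar

/-! ## Inverse semigroups with zero -/

/-- Inverse semigroups with a zero element: every `s` has exactly one generalized inverse. -/
class InverseSemigroupWithZero (S : Type u) extends SemigroupWithZero S, Inv S where
  mul_inv_mul : ∀ s : S, s * s⁻¹ * s = s
  inv_mul_inv : ∀ s : S, s⁻¹ * s * s⁻¹ = s⁻¹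
  inv_unique : ∀ s t : S, s * t * s = s → t * s * t = t → t = s⁻¹

/-- A (zero-preserving) representation of an inverse semigroup in a `C*`-algebra. -/
structure IsInvSemigroupRep {S : Type u} [InverseSemigroupWithZero S] {B : Type v}
    [NonUnitalCStarAlgebra B] (π : S → B) : Prop where
  map_mul : ∀ s t, π (s * t) = π s * π t
  map_inv : ∀ s, π s⁻¹ = star (π s)
  map_zero : π 0 = 0

theorem IsInvSemigroupRep.norm_le_one {S : Type u} [InverseSemigroupWithZero S] {B : Type v}
    [NonUnitalCStarAlgebra B] {π : S → B} (h : IsInvSemigroupRep π) (s : S) : ‖π s‖ ≤ 1 :=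
  norm_le_one_of_partialIsometry <| by
    rw [← h.map_inv, ← h.map_mul, ← h.map_mul, InverseSemigroupWithZero.mul_inv_mul]

/-- The full `C*`-algebra `C*(S)` of an inverse semigroup with zero: it is universal for
representations of `S` in `C*`-algebras. -/
abbrev InvSemigroupCStar (S : Type u) [InverseSemigroupWithZero S] : Type u :=
  UnivCStar (X := S) ⟨fun π => IsInvSemigroupRep π, fun h => h.norm_le_one⟩

/-! ### The symmetric inverse semigroup -/

/-- The symmetric inverse semigroup `I(X)` of all partial bijections of `X`. -/
def SymInv (X : Type u) : Type u := X ≃. X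

namespace SymInv

variable {X : Type u}

/-- The value of a partial bijection at a point, if any. -/
def app (φ : SymInv X) : X → Option X := (show X ≃. X from φ)

/-- The domain of a partial bijection. -/
def dom (φ : SymInv X) : Set X := {x | ∃ y, φ.app x = some y}

/-- The image `φ(dom φ ∩ Y)`. -/
def image (φ : SymInv X) (Y : Set X) : Set X := {z | ∃ y ∈ Y, φ.app y = some z}

/-- The identity map of the set `Y`. -/
noncomputable def idOn (Y : Set X) : SymInv X := by
  classical exact PEquiv.ofSet Y

/-- The partial bijection given by an injective partial function. -/
noncomputable def ofInj (f : X → Option X)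
    (hf : ∀ a a' b, f a = some b → f a' = some b → a = a') : SymInv X := by
  classical exact
  { toFun := f
    invFun := fun b => if h : ∃ a, f a = some b then some h.choose else none
    inv := fun a b => by
      constructor
      · intro h
        split_ifs at h with hb
        rw [← Option.some.inj h]
        exact hb.choose_spec
      · intro h
        have hb : ∃ a, f a = some b := ⟨a, h⟩
        rw [dif_pos hb, hf _ _ _ hb.choose_spec h] }

theorem ext {φ ψ : SymInv X} (h : ∀ x y, φ.app x = some y ↔ ψ.app x = some y) : φ = ψ :=
  PEquiv.ext fun x => Option.ext fun y => h x y

/-- `φ * ψ` is "first `ψ`, then `φ`", on the largest possible domain; `0` is the empty map. -/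
noncomputable instance : Mul (SymInv X) := ⟨fun φ ψ => PEquiv.trans ψ φ⟩
noncomputable instance : Inv (SymInv X) := ⟨fun φ => PEquiv.symm φ⟩
noncomputable instance : Zero (SymInv X) := ⟨(⊥ : X ≃. X)⟩

theorem mul_app {φ ψ : SymInv X} {x z : X} :
    (φ * ψ).app x = some z ↔ ∃ y, ψ.app x = some y ∧ φ.app y = some z :=
  PEquiv.trans_eq_some ψ φ x z

theorem inv_app {φ : SymInv X} {x y : X} : φ⁻¹.app x = some y ↔ φ.app y = some x :=
  PEquiv.eq_some_iff φ

theorem zero_app {x y : X} : ¬ (0 : SymInv X).app x = some y := fun h => by cases h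

theorem idOn_app {Y : Set X} {x y : X} : (idOn Y).app x = some y ↔ x = y ∧ x ∈ Y := by
  classical exact PEquiv.ofSet_eq_some_iff.trans (by constructor <;> (rintro ⟨rfl, h⟩; simp_all))

theorem app_inj {φ : SymInv X} {x x' y : X} (h : φ.app x = some y) (h' : φ.app x' = some y) :
    x = x' := PEquiv.inj φ h h'

noncomputable instance : InverseSemigroupWithZero (SymInv X) where
  mul_assoc φ ψ χ := (PEquiv.trans_assoc χ ψ φ).symm
  zero_mul φ := PEquiv.trans_bot φ
  mul_zero φ := PEquiv.bot_trans φ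
  mul_inv_mul φ := ext fun x y => by
    simp only [mul_app, inv_app]
    constructor
    · rintro ⟨y', h1, x', h2, h3⟩
      rwa [app_inj h1 h2]
    · exact fun h => ⟨y, h, x, h, h⟩
  inv_mul_inv φ := ext fun x y => by
    simp only [mul_app, inv_app]
    constructor
    · rintro ⟨y', h1, x', h2, h3⟩
      rw [h1] at h2
      rwa [Option.some.inj h2]
    · exact fun h => ⟨y, h, x, h, h⟩
  inv_unique φ ψ h1 h2 := ext fun x y => by
    rw [inv_app]
    constructor
    · intro h
      obtain ⟨y', h3, x', h4, h5⟩ : ∃ y', ψ.app x = some y' ∧ ∃ x', φ.app y' = some x' ∧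
          ψ.app x' = some y := by
        have := h
        rw [← h2, mul_app] at this
        obtain ⟨a, ha, hb⟩ := this
        obtain ⟨b, hb, hc⟩ := mul_app.1 hb
        exact ⟨a, ha, b, hb, hc⟩
      rw [h] at h3
      obtain rfl := Option.some.inj h3
      rwa [app_inj h h5]
    · intro h
      have := h
      rw [← h1, mul_app] at this
      obtain ⟨a, ha, hb⟩ := this
      obtain ⟨b, hb, hc⟩ := mul_app.1 hb
      rw [h] at ha
      obtain rfl := Option.some.inj ha
      rw [hb, app_inj h hc]

theorem image_mul (φ ψ : SymInv X) (Y : Set X) : (φ * ψ).image Y = φ.image (ψ.image Y) := by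
  ext z
  simp only [image, mul_app, Set.mem_ofPred_eq]
  constructor
  · rintro ⟨x, hx, y, h1, h2⟩; exact ⟨y, ⟨x, hx, h1⟩, h2⟩
  · rintro ⟨y, ⟨x, hx, h1⟩, h2⟩; exact ⟨x, hx, y, h1, h2⟩

theorem image_inv_univ (φ : SymInv X) : φ⁻¹.image Set.univ = φ.dom := by
  ext z
  simp [image, dom, inv_app]

end SymInv

/-! ## Left cancellative small categories -/

/-- Left cancellation. The product `αβ` of morphisms with `s(α) = r(β)` is Mathlib's `β ≫ α`. -/
class LeftCancellative (C : Type u) [SmallCategory C] : Prop where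
  left_cancel : ∀ {x y z : C} (α : y ⟶ x) (β γ : z ⟶ y), β ≫ α = γ ≫ α → β = γ

/-- The set of all morphisms of `C`: a morphism `α` has source `s(α) = α.left` and
range `r(α) = α.right`. -/
abbrev Mor (C : Type u) [SmallCategory C] : Type u := Quiver.Total C

/-- A morphism as an element of the set of all morphisms. -/
abbrev mor {C : Type u} [SmallCategory C] {x y : C} (α : x ⟶ y) : Mor C := ⟨x, y, α⟩

section Category

variable {C : Type u} [SmallCategory C]

/-- The product `αβ` if `s(α) = r(β)`, undefined otherwise. -/
noncomputable def Mor.comp? (α β : Mor C) : Option (Mor C) := by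
  classical exact
  if h : β.right = α.left then some (mor ((β.hom ≫ eqToHom h) ≫ α.hom)) else none

theorem Mor.comp?_mor {x y z : C} (α : y ⟶ x) (β : z ⟶ y) :
    (mor α).comp? (mor β) = some (mor (β ≫ α)) := by
  simp [Mor.comp?]

theorem Mor.right_of_comp? {α β γ : Mor C} (h : α.comp? β = some γ) :
    γ.right = α.right ∧ β.right = α.left := by
  unfold Mor.comp? at h
  split_ifs at h with h1
  rw [← Option.some.inj h]
  exact ⟨rfl, h1⟩

theorem Mor.comp?_inj [LeftCancellative C] (α β β' γ : Mor C) (h : α.comp? β = some γ)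
    (h' : α.comp? β' = some γ) : β = β' := by
  obtain ⟨y, x, α⟩ := α
  obtain ⟨z, y₁, β⟩ := β
  obtain ⟨z', y₂, β'⟩ := β'
  unfold Mor.comp? at h h'
  split_ifs at h with h1
  split_ifs at h' with h2
  dsimp only at h1 h2
  subst h1 h2
  rw [← h] at h'
  simp only [eqToHom_refl, Category.comp_id, Option.some.injEq, Quiver.Total.mk.injEq] at h'
  obtain ⟨rfl, -, h3⟩ := h'
  rw [LeftCancellative.left_cancel α _ _ (eq_of_heq h3)]

/-- The set `vC` of all morphisms with range `v`. -/
def vertexIdeal (v : C) : Set (Mor C) := {γ | γ.right = v}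

/-- The set `αC`. -/
def principalIdeal (α : Mor C) : Set (Mor C) := {γ | ∃ β, α.comp? β = some γ}

variable (C) in
/-- `C` is finitely aligned: `αC ∩ βC` is always a finite union of sets `γC`. -/
def FinitelyAligned : Prop :=
  ∀ α β : Mor C, ∃ F : Set (Mor C), F.Finite ∧
    principalIdeal α ∩ principalIdeal β = ⋃ γ ∈ F, principalIdeal γ

variable (C) in
/-- `C` is a `k`-graph: it has countably many morphisms and carries a degree functor `d` to `ℕ^k`
with the unique factorization property. -/
def IsKGraph (k : ℕ) : Prop :=
  Countable (Mor C) ∧ ∃ d : Mor C → (Fin k → ℕ),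
    (∀ x : C, d (mor (𝟙 x)) = 0) ∧
    (∀ {x y z : C} (α : y ⟶ x) (β : z ⟶ y), d (mor (β ≫ α)) = d (mor α) + d (mor β)) ∧
    (∀ {x z : C} (γ : z ⟶ x) (m n : Fin k → ℕ), d (mor γ) = m + n →
      ∃! αβ : (y : C) × ((y ⟶ x) × (z ⟶ y)),
        αβ.2.2 ≫ αβ.2.1 = γ ∧ d (mor αβ.2.1) = m ∧ d (mor αβ.2.2) = n)

variable [LeftCancellative C]

/-- The shift `τ_α : s(α)C → αC`, `β ↦ αβ`. -/
noncomputable def tau (α : Mor C) : SymInv (Mor C) :=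
  SymInv.ofInj α.comp? (Mor.comp?_inj α)

/-- `σ_α : αC → s(α)C`, the inverse of `τ_α`. -/
noncomputable def sigma (α : Mor C) : SymInv (Mor C) := (tau α)⁻¹

variable (C) in
/-- The zigzag inverse semigroup `ZM(C)`, the subsemigroup of `I(C)` generated by all `τ_α`, all
`σ_α`, and the empty map. -/
noncomputable def ZM : Subsemigroup (SymInv (Mor C)) :=
  Subsemigroup.closure (Set.range tau ∪ Set.range sigma ∪ {0})

theorem tau_mem_ZM (α : Mor C) : tau α ∈ ZM C :=
  Subsemigroup.subset_closure (Or.inl (Or.inl ⟨α, rfl⟩))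

theorem sigma_mem_ZM (α : Mor C) : sigma α ∈ ZM C :=
  Subsemigroup.subset_closure (Or.inl (Or.inr ⟨α, rfl⟩))

theorem zero_mem_ZM : (0 : SymInv (Mor C)) ∈ ZM C :=
  Subsemigroup.subset_closure (Or.inr rfl)

theorem SymInv.inv_inv {X : Type u} (φ : SymInv X) : φ⁻¹⁻¹ = φ := rfl

theorem SymInv.mul_inv_rev {X : Type u} (φ ψ : SymInv X) : (φ * ψ)⁻¹ = ψ⁻¹ * φ⁻¹ := rfl

theorem inv_mem_ZM {φ : SymInv (Mor C)} (h : φ ∈ ZM C) : φ⁻¹ ∈ ZM C := by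
  induction h using Subsemigroup.closure_induction with
  | mem φ hφ =>
    rcases hφ with (⟨α, rfl⟩ | ⟨α, rfl⟩) | rfl
    · exact sigma_mem_ZM α
    · exact tau_mem_ZM α
    · exact zero_mem_ZM
  | mul φ ψ _ _ h1 h2 => exact (ZM C).mul_mem h2 h1

noncomputable instance : InverseSemigroupWithZero (ZM C) where
  zero := ⟨0, zero_mem_ZM⟩
  inv φ := ⟨(φ : SymInv (Mor C))⁻¹, inv_mem_ZM φ.2⟩
  zero_mul φ := Subtype.ext (zero_mul (φ : SymInv (Mor C)))
  mul_zero φ := Subtype.ext (mul_zero (φ : SymInv (Mor C)))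
  mul_inv_mul φ := Subtype.ext (InverseSemigroupWithZero.mul_inv_mul (φ : SymInv (Mor C)))
  inv_mul_inv φ := Subtype.ext (InverseSemigroupWithZero.inv_mul_inv (φ : SymInv (Mor C)))
  inv_unique φ ψ h1 h2 := Subtype.ext
    (InverseSemigroupWithZero.inv_unique (φ : SymInv (Mor C)) ψ
      (congrArg Subtype.val h1) (congrArg Subtype.val h2))

/-! ### Zigzags -/

end Category

/-- `ZigzagTuple C w v` is the set of zigzags `ζ = (α₁, β₁, …, αₙ, βₙ)`, `n ≥ 1`, with `r(αᵢ) = r(βᵢ)`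
and `s(βᵢ) = s(αᵢ₊₁)`, and with range `r(ζ) = s(α₁) = w` and source `s(ζ) = s(βₙ) = v`. -/
inductive ZigzagTuple (C : Type u) [SmallCategory C] : C → C → Type u
  | single {w v x : C} (α : w ⟶ x) (β : v ⟶ x) : ZigzagTuple C w v
  | cons {w y v x : C} (α : w ⟶ x) (β : y ⟶ x) (ζ : ZigzagTuple C y v) : ZigzagTuple C w v

namespace ZigzagTuple

variable {C : Type u} [SmallCategory C]

/-- Concatenation `ζζ'` of zigzags with `s(ζ) = r(ζ')`. -/
def append {w y v : C} : ZigzagTuple C w y → ZigzagTuple C y v → ZigzagTuple C w v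
  | single α β, ξ => cons α β ξ
  | cons α β ζ, ξ => cons α β (ζ.append ξ)

/-- The reverse `(βₙ, αₙ, …, β₁, α₁)`. -/
def reverse {w v : C} : ZigzagTuple C w v → ZigzagTuple C v w
  | single α β => single β α
  | cons α β ζ => ζ.reverse.append (single β α)

/-- The element `v_{α₁}^* v_{β₁} ⋯ v_{αₙ}^* v_{βₙ}` for a family `v` indexed by the morphisms. -/
def word {B : Type v} [Mul B] [Star B] (V : Mor C → B) {w v : C} : ZigzagTuple C w v → B
  | single α β => star (V (mor α)) * V (mor β)
  | cons α β ζ => star (V (mor α)) * V (mor β) * ζ.word V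

variable [LeftCancellative C]

/-- The zigzag map `φ_ζ = σ_{α₁} τ_{β₁} ⋯ σ_{αₙ} τ_{βₙ}`. -/
noncomputable def phi {w v : C} : ZigzagTuple C w v → SymInv (Mor C)
  | single α β => sigma (mor α) * tau (mor β)
  | cons α β ζ => sigma (mor α) * tau (mor β) * ζ.phi

theorem phi_mem_ZM {w v : C} (ζ : ZigzagTuple C w v) : ζ.phi ∈ ZM C := by
  induction ζ with
  | single α β => exact (ZM C).mul_mem (sigma_mem_ZM _) (tau_mem_ZM _)
  | cons α β ζ ih => exact (ZM C).mul_mem ((ZM C).mul_mem (sigma_mem_ZM _) (tau_mem_ZM _)) ih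

/-- The zigzag map as an element of `ZM(C)`. -/
noncomputable def zm {w v : C} (ζ : ZigzagTuple C w v) : ZM C := ⟨ζ.phi, ζ.phi_mem_ZM⟩

theorem phi_append {w y v : C} (ζ : ZigzagTuple C w y) (ξ : ZigzagTuple C y v) :
    (ζ.append ξ).phi = ζ.phi * ξ.phi := by
  induction ζ with
  | single α β => rfl
  | cons α β ζ ih => rw [append, phi, phi, ih, mul_assoc, mul_assoc, mul_assoc]

theorem phi_reverse {w v : C} (ζ : ZigzagTuple C w v) : ζ.reverse.phi = ζ.phi⁻¹ := by
  induction ζ with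
  | single α β => rfl
  | cons α β ζ ih => rw [reverse, phi_append, ih]; rfl

/-- The set `βₙ⁻¹ αₙ ⋯ β₁⁻¹ α₁ Y`, where `αY = τ_α(s(α)C ∩ Y)` and `α⁻¹Y = σ_α(αC ∩ Y)`. -/
noncomputable def pull {w v : C} : ZigzagTuple C w v → Set (Mor C) → Set (Mor C)
  | single α β, Y => (sigma (mor β)).image ((tau (mor α)).image Y)
  | cons α β ζ, Y => ζ.pull ((sigma (mor β)).image ((tau (mor α)).image Y))

/-- The constructible right ideal `A(ζ) = βₙ⁻¹ αₙ ⋯ β₁⁻¹ α₁ C`. -/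
noncomputable def A {w v : C} (ζ : ZigzagTuple C w v) : Set (Mor C) := ζ.pull Set.univ

theorem pull_eq_image {w v : C} (ζ : ZigzagTuple C w v) (Y : Set (Mor C)) :
    ζ.pull Y = ζ.phi⁻¹.image Y := by
  induction ζ generalizing Y with
  | single α β =>
    rw [pull, phi, SymInv.mul_inv_rev, SymInv.image_mul]; rfl
  | cons α β ζ ih =>
    rw [pull, phi, SymInv.mul_inv_rev, SymInv.mul_inv_rev, SymInv.image_mul, SymInv.image_mul, ih]
    rfl

/-- `A(ζ)` is the domain of the zigzag map `φ_ζ`. -/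
theorem A_eq_dom {w v : C} (ζ : ZigzagTuple C w v) : ζ.A = ζ.phi.dom := by
  rw [A, pull_eq_image, SymInv.image_inv_univ]

/-- All elements of `A(ζ)` have range `s(ζ)`. -/
theorem A_subset {w v : C} (ζ : ZigzagTuple C w v) : ζ.A ⊆ vertexIdeal v := by
  rw [A_eq_dom]
  induction ζ with
  | single α β =>
    rintro γ ⟨δ, h⟩
    obtain ⟨ε, h1, -⟩ := SymInv.mul_app.1 h
    exact (Mor.right_of_comp? h1).2
  | cons α β ζ ih =>
    rintro γ ⟨δ, h⟩
    obtain ⟨ε, h1, -⟩ := SymInv.mul_app.1 h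
    exact ih ⟨ε, h1⟩

/-- The identity map of `A(ζ)` as an element of `ZM(C)`, namely `φ_{ζ̄ζ}` with `ζ̄` the reverse
of `ζ`. -/
noncomputable def idem {w v : C} (ζ : ZigzagTuple C w v) : ZM C := (ζ.reverse.append ζ).zm

theorem coe_idem {w v : C} (ζ : ZigzagTuple C w v) : (ζ.idem : SymInv (Mor C)) = SymInv.idOn ζ.A := by
  change (ζ.reverse.append ζ).phi = _
  rw [phi_append, phi_reverse, A_eq_dom]
  refine SymInv.ext fun x y => ?_
  rw [SymInv.mul_app, SymInv.idOn_app]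
  simp only [SymInv.inv_app]
  constructor
  · rintro ⟨z, h1, h2⟩
    exact ⟨SymInv.app_inj h1 h2, z, h1⟩
  · rintro ⟨rfl, z, h⟩
    exact ⟨z, h, h⟩

end ZigzagTuple

section LiAlgebras

variable (C : Type u) [SmallCategory C] [LeftCancellative C]

/-- The family `𝒥(C)` of constructible right ideals. -/
def constructibleIdeals : Set (Set (Mor C)) :=
  {Y | Y = ∅ ∨ ∃ (w v : C) (ζ : ZigzagTuple C w v), Y = ζ.A}

/-- The family `𝒥^(∪)(C)` of all finite unions of constructible right ideals. -/
def constructibleUnions : Set (Set (Mor C)) :=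
  {Y | ∃ F : Set (Set (Mor C)), F.Finite ∧ F ⊆ constructibleIdeals C ∧ Y = ⋃₀ F}

variable {C}

theorem empty_mem_constructibleIdeals : (∅ : Set (Mor C)) ∈ constructibleIdeals C := Or.inl rfl

theorem vertexIdeal_mem (v : C) : vertexIdeal v ∈ constructibleIdeals C := by
  refine Or.inr ⟨v, v, .single (𝟙 v) (𝟙 v), ?_⟩
  rw [ZigzagTuple.A_eq_dom]
  ext ⟨a, b, γ⟩
  simp only [vertexIdeal, SymInv.dom, ZigzagTuple.phi, SymInv.mul_app, sigma, SymInv.inv_app,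
    Set.mem_ofPred_eq]
  constructor
  · rintro rfl
    exact ⟨_, _, Mor.comp?_mor _ _, Mor.comp?_mor _ _⟩
  · rintro ⟨y, z, h, -⟩
    exact (Mor.right_of_comp? h).2

theorem inter_mem_constructibleIdeals {Y Z : Set (Mor C)} (hY : Y ∈ constructibleIdeals C)
    (hZ : Z ∈ constructibleIdeals C) : Y ∩ Z ∈ constructibleIdeals C := by
  rcases hY with rfl | ⟨w, v, ζ, rfl⟩
  · exact Or.inl (Set.empty_inter _)
  rcases hZ with rfl | ⟨w', v', ξ, rfl⟩
  · exact Or.inl (Set.inter_empty _)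
  by_cases hv : v = v'
  · subst hv
    refine Or.inr ⟨_, _, (ζ.reverse.append ζ).append (ξ.reverse.append ξ), ?_⟩
    have h1 : (ζ.reverse.append ζ).phi = SymInv.idOn ζ.A := ζ.coe_idem
    have h2 : (ξ.reverse.append ξ).phi = SymInv.idOn ξ.A := ξ.coe_idem
    rw [((ζ.reverse.append ζ).append (ξ.reverse.append ξ)).A_eq_dom, ZigzagTuple.phi_append, h1, h2]
    ext x
    simp only [SymInv.dom, SymInv.mul_app, SymInv.idOn_app, Set.mem_ofPred_eq, Set.mem_inter_iff]
    constructor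
    · rintro ⟨h3, h4⟩
      exact ⟨x, x, ⟨rfl, h4⟩, rfl, h3⟩
    · rintro ⟨y, z, ⟨rfl, h4⟩, rfl, h3⟩
      exact ⟨h3, h4⟩
  · refine Or.inl (Set.eq_empty_iff_forall_notMem.2 fun x hx => hv ?_)
    exact (ζ.A_subset hx.1).symm.trans (ξ.A_subset hx.2)

theorem image_tau_mem_constructibleIdeals (α : Mor C) {Y : Set (Mor C)}
    (hY : Y ∈ constructibleIdeals C) : (tau α).image Y ∈ constructibleIdeals C := by
  rcases hY with rfl | ⟨w, v, ζ, rfl⟩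
  · exact Or.inl (by simp [SymInv.image])
  obtain ⟨y, x, α⟩ := α
  by_cases hv : v = y
  · subst hv
    refine Or.inr ⟨_, _, ζ.append (.single α (𝟙 x)), ?_⟩
    rw [(ζ.append (.single α (𝟙 x))).A_eq_dom, ZigzagTuple.phi_append, ζ.A_eq_dom]
    ext ⟨a, b, γ⟩
    simp only [SymInv.image, SymInv.dom, ZigzagTuple.phi, SymInv.mul_app, sigma, SymInv.inv_app,
      Set.mem_ofPred_eq]
    constructor
    · rintro ⟨β, ⟨z, hz⟩, h⟩
      have hb : b = x := (Mor.right_of_comp? h).1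
      subst hb
      exact ⟨z, β, ⟨_, Mor.comp?_mor _ _, by simpa using h⟩, hz⟩
    · rintro ⟨z, β, ⟨δ, h1, h2⟩, h3⟩
      have hb : b = x := (Mor.right_of_comp? h1).2
      subst hb
      have h4 := (Mor.comp?_mor (𝟙 b) γ).symm.trans h1
      rw [Category.comp_id] at h4
      obtain rfl := Option.some.inj h4
      exact ⟨β, ⟨z, h3⟩, h2⟩
  · refine Or.inl (Set.eq_empty_iff_forall_notMem.2 ?_)
    rintro γ ⟨β, hβ, h⟩
    exact hv ((ζ.A_subset hβ).symm.trans (Mor.right_of_comp? h).2)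

/-- `A(ζ)` as a member of `𝒥(C)`. -/
noncomputable def ZigzagTuple.ideal {w v : C} (ζ : ZigzagTuple C w v) : constructibleIdeals C :=
  ⟨ζ.A, Or.inr ⟨w, v, ζ, rfl⟩⟩

/-- The inclusion of `𝒥(C)` in `𝒥^(∪)(C)`. -/
def toUnions (Y : constructibleIdeals C) : constructibleUnions C :=
  ⟨Y, {↑Y}, Set.finite_singleton _, Set.singleton_subset_iff.2 Y.2, by simp⟩

/-! ### Li's relations

In all that follows `𝒥` is `𝒥(C)` or `𝒥^(∪)(C)`; these families contain `∅` and all `vC`, and are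
closed under finite intersections and under `Y ↦ αY`, so that each equation below
that is conditioned on an equality of sets does speak about a member of the family. -/

section Relations

variable {𝒥 : Set (Set (Mor C))} {B : Type v} [NonUnitalCStarAlgebra B]

/-- Partial isometries `V_α` and projections `P_Y` with (L1), (L2), (L3). -/
structure LiBase (V : Mor C → B) (P : 𝒥 → B) : Prop where
  partialIsometry : ∀ α, V α * star (V α) * V α = V α
  projection : ∀ Y, IsStarProjection (P Y)
  L1 : ∀ (α : Mor C) (Y : 𝒥), (Y : Set (Mor C)) = vertexIdeal α.left → star (V α) * V α = P Y
  L2_comp : ∀ {x y z : C} (α : y ⟶ x) (β : z ⟶ y), V (mor α) * V (mor β) = V (mor (β ≫ α))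
  L2_zero : ∀ α β : Mor C, α.left ≠ β.right → V α * V β = 0
  L3 : ∀ Y : 𝒥, (Y : Set (Mor C)) = ∅ → P Y = 0

/-- (L4): `P_Y P_Z = P_{Y ∩ Z}`. -/
def L4 (P : 𝒥 → B) : Prop :=
  ∀ Y Z W : 𝒥, (W : Set (Mor C)) = ↑Y ∩ ↑Z → P Y * P Z = P W

/-- (L5): `V_α P_Y V_α^* = P_{αY}`. -/
def L5 (V : Mor C → B) (P : 𝒥 → B) : Prop :=
  ∀ (α : Mor C) (Y W : 𝒥), (W : Set (Mor C)) = (tau α).image ↑Y → V α * P Y * star (V α) = P W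

/-- (L6): `P_{Y ∪ Z} = P_Y ∨ P_Z`, the join being `P_Y + P_Z - P_Y P_Z`. -/
def L6 (P : 𝒥 → B) : Prop :=
  ∀ Y Z W : 𝒥, (W : Set (Mor C)) = ↑Y ∪ ↑Z → P W = P Y + P Z - P Y * P Z

/-- (L7): if `φ_ζ` is the identity map of `A(ζ)`, then
`V_{α₁}^* V_{β₁} ⋯ V_{αₙ}^* V_{βₙ} = P_{A(ζ)}`. -/
def L7 (V : Mor C → B) (P : 𝒥 → B) : Prop :=
  ∀ {w v : C} (ζ : ZigzagTuple C w v) (Y : 𝒥), ζ.phi = SymInv.idOn ζ.A →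
    (Y : Set (Mor C)) = ζ.A → ζ.word V = P Y

theorem LiBase.norm_le_one {V : Mor C → B} {P : 𝒥 → B} (h : LiBase V P) (x : Mor C ⊕ 𝒥) :
    ‖Sum.elim V P x‖ ≤ 1 := by
  rcases x with α | Y
  · exact norm_le_one_of_partialIsometry (h.partialIsometry α)
  · exact norm_le_one_of_projection (h.projection Y)

theorem LiBase.norm_le_one' {f : Mor C ⊕ 𝒥 → B} (h : LiBase (f ∘ Sum.inl) (f ∘ Sum.inr))
    (x : Mor C ⊕ 𝒥) : ‖f x‖ ≤ 1 := by
  have := h.norm_le_one x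
  rwa [Sum.elim_comp_inl_inr] at this

end Relations

/-- Relations (L1) to (L5). -/
def relLi (𝒥 : Set (Set (Mor C))) : CStarRelations (Mor C ⊕ 𝒥) where
  Holds f := LiBase (f ∘ Sum.inl) (f ∘ Sum.inr) ∧ L4 (f ∘ Sum.inr) ∧
    L5 (f ∘ Sum.inl) (f ∘ Sum.inr)
  norm_le_one h := h.1.norm_le_one'

/-- Relations (L1) to (L6). -/
def relLiUnion (𝒥 : Set (Set (Mor C))) : CStarRelations (Mor C ⊕ 𝒥) where
  Holds f := LiBase (f ∘ Sum.inl) (f ∘ Sum.inr) ∧ L4 (f ∘ Sum.inr) ∧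
    L5 (f ∘ Sum.inl) (f ∘ Sum.inr) ∧ L6 (f ∘ Sum.inr)
  norm_le_one h := h.1.norm_le_one'

/-- Relations (L1) to (L3) and (L7). -/
def relLiS (𝒥 : Set (Set (Mor C))) : CStarRelations (Mor C ⊕ 𝒥) where
  Holds f := LiBase (f ∘ Sum.inl) (f ∘ Sum.inr) ∧ L7 (f ∘ Sum.inl) (f ∘ Sum.inr)
  norm_le_one h := h.1.norm_le_one'

/-- Relations (L1) to (L3), (L6) and (L7). -/
def relLiSUnion (𝒥 : Set (Set (Mor C))) : CStarRelations (Mor C ⊕ 𝒥) where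
  Holds f := LiBase (f ∘ Sum.inl) (f ∘ Sum.inr) ∧ L6 (f ∘ Sum.inr) ∧
    L7 (f ∘ Sum.inl) (f ∘ Sum.inr)
  norm_le_one h := h.1.norm_le_one'

variable (C)

/-- `C*_Li(C)`. -/
abbrev CLi : Type u := UnivCStar (relLi (constructibleIdeals C))

/-- `C*^(∪)_Li(C)`. -/
abbrev CLiUnion : Type u := UnivCStar (relLiUnion (constructibleUnions C))

/-- `C*_{Li,s}(C)`. -/
abbrev CLiS : Type u := UnivCStar (relLiS (constructibleIdeals C))

/-- `C*^(∪)_{Li,s}(C)`. -/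
abbrev CLiSUnion : Type u := UnivCStar (relLiSUnion (constructibleUnions C))

/-- `C*(ZM(C))`. -/
abbrev CZM : Type u := InvSemigroupCStar (ZM C)

/-- The join of a list of commuting projections, built up from `p ∨ q = p + q - pq`. -/
def projJoin {B : Type v} [NonUnitalCStarAlgebra B] : List B → B
  | [] => 0
  | p :: l => p + projJoin l - p * projJoin l

variable {C} in
/-- A representation `π` of `ZM(C)` is finitely join-preserving: whenever
`A(ζ) = A(ξ₁) ∪ ⋯ ∪ A(ξₙ)`, the projection `π(id_{A(ζ)})` is the join of the (commuting)
projections `π(id_{A(ξⱼ)})`. -/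
structure IsFinitelyJoinPreservingRep {B : Type v} [NonUnitalCStarAlgebra B]
    (π : ZM C → B) : Prop where
  rep : IsInvSemigroupRep π
  join : ∀ {w v : C} (ζ : ZigzagTuple C w v) (l : List ((a : C) × (b : C) × ZigzagTuple C a b)),
    ζ.A = ⋃ ξ ∈ l, ξ.2.2.A → π ζ.idem = projJoin (l.map fun ξ => π ξ.2.2.idem)

/-- The Toeplitz algebra `T(C)`: it is universal for finitely join-preserving representations of
`ZM(C)`. -/
abbrev Toeplitz : Type u :=
  UnivCStar (X := ZM C) ⟨fun π => IsFinitelyJoinPreservingRep π, fun h => h.rep.norm_le_one⟩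

end LiAlgebras

/-- The generator `v_α` of a universal algebra with generators `v_α` and `p_Y`. -/
noncomputable def genV {C : Type u} [SmallCategory C] {𝒥 : Set (Set (Mor C))}
    (R : CStarRelations (Mor C ⊕ 𝒥)) (α : Mor C) : UnivCStar R := UnivCStar.gen R (Sum.inl α)

/-- The generator `p_Y` of a universal algebra with generators `v_α` and `p_Y`. -/
noncomputable def genP {C : Type u} [SmallCategory C] {𝒥 : Set (Set (Mor C))}
    (R : CStarRelations (Mor C ⊕ 𝒥)) (Y : 𝒥) : UnivCStar R := UnivCStar.gen R (Sum.inr Y)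

section Generators

variable {C : Type u} [SmallCategory C] [LeftCancellative C]

/-- The element `t'_ζ` of `C*(ZM(C))`. -/
noncomputable def tZM {w v : C} (ζ : ZigzagTuple C w v) : CZM C := UnivCStar.gen _ ζ.zm

/-- The element `t_ζ` of `T(C)`. -/
noncomputable def tT {w v : C} (ζ : ZigzagTuple C w v) : Toeplitz C := UnivCStar.gen _ ζ.zm

/-! The generators of each of these algebras satisfy the relations that define it. -/

section

variable {𝒥 : Set (Set (Mor C))} {R : CStarRelations (Mor C ⊕ 𝒥)}

theorem gen_LiBase (hR : ∀ {B : Type u} [NonUnitalCStarAlgebra B] {f : Mor C ⊕ 𝒥 → B},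
    R.Holds f → LiBase (f ∘ Sum.inl) (f ∘ Sum.inr)) : LiBase (genV R) (genP R) where
  partialIsometry α := UnivCStar.ext_of_lift fun hf => by
    simpa [genV, map_star] using (hR hf).partialIsometry α
  projection Y :=
    ⟨UnivCStar.ext_of_lift fun hf => by
      simpa [genP] using ((hR hf).projection Y).isIdempotentElem.eq,
    UnivCStar.ext_of_lift fun hf => by
      simpa [genP, map_star] using ((hR hf).projection Y).isSelfAdjoint.star_eq⟩
  L1 α Y h := UnivCStar.ext_of_lift fun hf => by 
    simpa [genV, genP, map_star] using (hR hf).L1 α Y h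
  L2_comp α β := UnivCStar.ext_of_lift fun hf => by simpa [genV] using (hR hf).L2_comp α β
  L2_zero α β h := UnivCStar.ext_of_lift fun hf => by simpa [genV] using (hR hf).L2_zero α β h
  L3 Y h := UnivCStar.ext_of_lift fun hf => by simpa [genP] using (hR hf).L3 Y h

theorem gen_L4 (hR : ∀ {B : Type u} [NonUnitalCStarAlgebra B] {f : Mor C ⊕ 𝒥 → B},
    R.Holds f → L4 (f ∘ Sum.inr)) : L4 (genP R) := fun Y Z W h =>
  UnivCStar.ext_of_lift fun hf => by simpa [genP] using hR hf Y Z W h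

theorem gen_L5 (hR : ∀ {B : Type u} [NonUnitalCStarAlgebra B] {f : Mor C ⊕ 𝒥 → B},
    R.Holds f → L5 (f ∘ Sum.inl) (f ∘ Sum.inr)) : L5 (genV R) (genP R) := fun α Y W h =>
  UnivCStar.ext_of_lift fun hf => by simpa [genV, genP, map_star] using hR hf α Y W h

theorem gen_L6 (hR : ∀ {B : Type u} [NonUnitalCStarAlgebra B] {f : Mor C ⊕ 𝒥 → B},
    R.Holds f → L6 (f ∘ Sum.inr)) : L6 (genP R) := fun Y Z W h =>
  UnivCStar.ext_of_lift fun hf => by simpa [genP] using hR hf Y Z W h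

theorem map_word {A B : Type*} [NonUnitalCStarAlgebra A] [NonUnitalCStarAlgebra B]
    (φ : A →⋆ₙₐ[ℂ] B) (V : Mor C → A) {w v : C} (ζ : ZigzagTuple C w v) :
    φ (ζ.word V) = ζ.word (φ ∘ V) := by
  induction ζ with
  | single α β => simp [ZigzagTuple.word, map_star]
  | cons α β ζ ih => simp [ZigzagTuple.word, map_star, ih]

theorem gen_L7 (hR : ∀ {B : Type u} [NonUnitalCStarAlgebra B] {f : Mor C ⊕ 𝒥 → B},
    R.Holds f → L7 (f ∘ Sum.inl) (f ∘ Sum.inr)) : L7 (genV R) (genP R) := fun ζ Y h h' =>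
  UnivCStar.ext_of_lift fun {B} _ f hf => by
    have hV : (UnivCStar.lift hf) ∘ genV R = f ∘ Sum.inl := funext fun α => by simp [genV]
    rw [map_word, hV, hR hf ζ Y h h']
    simp [genP]

end

theorem gen_holds_CLi :
    (relLi (constructibleIdeals C)).Holds (fun x => (UnivCStar.gen _ x : CLi C)) :=
  ⟨gen_LiBase fun h => h.1, gen_L4 fun h => h.2.1, gen_L5 fun h => h.2.2⟩

theorem gen_holds_CLiUnion :
    (relLiUnion (constructibleUnions C)).Holds (fun x => (UnivCStar.gen _ x : CLiUnion C)) :=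
  ⟨gen_LiBase fun h => h.1, gen_L4 fun h => h.2.1, gen_L5 fun h => h.2.2.1,
    gen_L6 fun h => h.2.2.2⟩

theorem gen_holds_CLiS :
    (relLiS (constructibleIdeals C)).Holds (fun x => (UnivCStar.gen _ x : CLiS C)) :=
  ⟨gen_LiBase fun h => h.1, gen_L7 (R := relLiS _) fun h => h.2⟩

theorem gen_holds_CLiSUnion :
    (relLiSUnion (constructibleUnions C)).Holds (fun x => (UnivCStar.gen _ x : CLiSUnion C)) :=
  ⟨gen_LiBase fun h => h.1, gen_L6 fun h => h.2.1, gen_L7 (R := relLiSUnion _) fun h => h.2.2⟩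

theorem gen_isInvSemigroupRep {R : CStarRelations (ZM C)}
    (hR : ∀ {B : Type u} [NonUnitalCStarAlgebra B] {π : ZM C → B},
      R.Holds π → IsInvSemigroupRep π) : IsInvSemigroupRep (UnivCStar.gen R) where
  map_mul s t := UnivCStar.ext_of_lift fun hf => by simpa using (hR hf).map_mul s t
  map_inv s := UnivCStar.ext_of_lift fun hf => by simpa [map_star] using (hR hf).map_inv s
  map_zero := UnivCStar.ext_of_lift fun hf => by simpa using (hR hf).map_zero

theorem map_projJoin {A B : Type*} [NonUnitalCStarAlgebra A] [NonUnitalCStarAlgebra B]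
    (φ : A →⋆ₙₐ[ℂ] B) (l : List A) : φ (projJoin l) = projJoin (l.map φ) := by
  induction l with
  | nil => simp [projJoin]
  | cons p l ih => simp [projJoin, ih]

theorem gen_isFinitelyJoinPreservingRep :
    IsFinitelyJoinPreservingRep (fun s : ZM C => (UnivCStar.gen _ s : Toeplitz C)) where
  rep := gen_isInvSemigroupRep fun h => h.rep
  join ζ l h := UnivCStar.ext_of_lift fun hf => by
    simpa [map_projJoin, Function.comp_def] using hf.join ζ l h

end Generators

/-! ## The zigzag inverse semigroup -/

/-! Words in the `v_α` and their adjoints imitate zigzag maps: concatenation becomes multiplication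
and reversal becomes the adjoint. For (i), let x and y be the words of two zigzags with the same
nonempty map φ. Concatenating the reverse of either zigzag with either of them gives a zigzag with
map φ⁻¹φ, an identity map, so (L7) makes x*x, x*y, y*x and y*y one and the same projection. Then (x
- y)*(x - y) = 0, so x = y (`word_eq_of_phi_eq`). Hence φ_ζ ↦ word is a well-defined representation
of `ZM C`. Conversely a representation π yields the family π(τ_α), π(id_Y), and the two passages are
mutually inverse.

For (ii) the dictionary is the same, with (L6) matching finite join-preservation. What has to be
checked is that the join of the π(id_Y) over a finite list of ideals depends only on their union
(`IsFinitelyJoinPreservingRep.projJoin_congr`).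

For (iii), (L6) and (L7) imply (L4) and (L5): on ideals through the representation of `ZM C`, on
unions by induction. Conversely, let φ_ζ be the identity of A = A(ζ) and let x be the word of ζ. By
(L4) and (L5), x*x = p_A, hence x p_A = x. Finite alignment writes A as a finite union of sets γC.
Since φ_ζ fixes γ, x v_γ = v_γ and so x p_{γC} = p_{γC}; by (L6), x p_A = p_A. Thus x = p_A
(`L7_of_finitelyAligned`).

For (iv) and (v) one finite 2-graph serves, represented on matrices indexed by its vertices: p_Y
projects onto the vertices o ≠ `src` for which both paths from `src` to o lie in Y, and v_α is a
scalar multiple of a matrix unit, zero if α leaves `src`. A path leaving `src` generates a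
singleton, which never contains both of two parallel paths, so killing such paths is compatible with
(L5). With all nonzero scalars equal to 1, (L7) holds but (L6) fails: the two paths from `src` to
`top₁` form an ideal with nonzero projection that is the union of two ideals with zero projection.
The four edges from the middle to the top form a cycle. A sign on one of them preserves (L1)–(L5),
but the zigzag around the cycle has an identity as its map and minus a projection as its word, so
(L7) fails. -/

section ZigzagSemigroup

variable {C : Type u} [SmallCategory C] [LeftCancellative C]

/-! ### Calculus of partial bijections. -/

namespace SymInv

variable {X : Type u}

theorem inv_image_univ_inter (φ : SymInv X) (Y : Set X) : φ.image (φ⁻¹.image Y) = φ.image Set.univ ∩ Y := by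
  ext z
  simp only [image, inv_app, Set.mem_inter_iff, Set.mem_ofPred_eq, Set.mem_univ, true_and]
  constructor
  · rintro ⟨x, ⟨y, hy, h1⟩, h2⟩
    rw [h1] at h2
    obtain rfl := Option.some.inj h2
    exact ⟨⟨x, h1⟩, hy⟩
  · rintro ⟨⟨x, hx⟩, hz⟩
    exact ⟨x, ⟨z, hz, hx⟩, hx⟩

theorem image_union (φ : SymInv X) (Y Z : Set X) : φ.image (Y ∪ Z) = φ.image Y ∪ φ.image Z := by
  ext z
  simp only [image, Set.mem_union, Set.mem_ofPred_eq]
  constructor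
  · rintro ⟨y, h | h, h'⟩
    exacts [Or.inl ⟨y, h, h'⟩, Or.inr ⟨y, h, h'⟩]
  · rintro (⟨y, h, h'⟩ | ⟨y, h, h'⟩)
    exacts [⟨y, Or.inl h, h'⟩, ⟨y, Or.inr h, h'⟩]

theorem idOn_mul_idOn (Y Z : Set X) : idOn Y * idOn Z = idOn (Y ∩ Z) := ext fun x y => by
  simp only [mul_app, idOn_app, Set.mem_inter_iff]
  constructor
  · rintro ⟨z, ⟨rfl, h⟩, rfl, h'⟩; exact ⟨rfl, h', h⟩
  · rintro ⟨rfl, h, h'⟩; exact ⟨x, ⟨rfl, h'⟩, rfl, h⟩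

theorem idOn_inv (Y : Set X) : (idOn Y)⁻¹ = idOn Y := ext fun x y => by
  simp only [inv_app, idOn_app]
  constructor <;> (rintro ⟨rfl, h⟩; exact ⟨rfl, h⟩)

theorem idOn_empty : idOn (∅ : Set X) = 0 := ext fun x y => by
  simp [idOn_app, zero_app]

theorem inv_mul_self (φ : SymInv X) : φ⁻¹ * φ = idOn φ.dom := ext fun x y => by
  simp only [mul_app, idOn_app, inv_app]
  constructor
  · rintro ⟨z, h1, h2⟩
    exact ⟨app_inj h1 h2, z, h1⟩
  · rintro ⟨rfl, z, h⟩
    exact ⟨z, h, h⟩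

theorem mul_idOn_mul_inv (φ : SymInv X) (Y : Set X) : φ * idOn Y * φ⁻¹ = idOn (φ.image Y) :=
  ext fun x y => by
    simp only [mul_app, idOn_app, inv_app, image, Set.mem_ofPred_eq]
    constructor
    · rintro ⟨z, h1, z', ⟨rfl, h2⟩, h3⟩
      rw [h1] at h3
      exact ⟨Option.some.inj h3, z, h2, h1⟩
    · rintro ⟨rfl, z, h2, h1⟩
      exact ⟨z, h1, z, ⟨rfl, h2⟩, h1⟩

theorem dom_idOn (Y : Set X) : (idOn Y).dom = Y := by
  ext x
  simp [dom, idOn_app]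

end SymInv

/-! ### Products, domains and images of the shifts. -/

theorem tau_app_left {α β γ : Mor C} (h : (tau α).app β = some γ) :
    β.right = α.left ∧ γ.right = α.right :=
  (Mor.right_of_comp? h).symm

theorem tau_app_mor {x y z : C} (α : y ⟶ x) (β : z ⟶ y) :
    (tau (mor α)).app (mor β) = some (mor (β ≫ α)) := Mor.comp?_mor α β

theorem tau_app_iff {x y : C} {α : y ⟶ x} {β γ : Mor C} :
    (tau (mor α)).app β = some γ ↔ ∃ (z : C) (δ : z ⟶ y), β = mor δ ∧ γ = mor (δ ≫ α) := by
  constructor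
  · intro h
    obtain ⟨z, y', β⟩ := β
    have hy : y' = y := (tau_app_left h).1
    subst hy
    rw [tau_app_mor] at h
    exact ⟨z, β, rfl, (Option.some.inj h).symm⟩
  · rintro ⟨z, δ, rfl, rfl⟩
    exact tau_app_mor α δ

theorem tau_mul_tau {x y z : C} (α : y ⟶ x) (β : z ⟶ y) :
    tau (mor α) * tau (mor β) = tau (mor (β ≫ α)) := SymInv.ext fun γ δ => by
  rw [SymInv.mul_app]
  simp only [tau_app_iff]
  constructor
  · rintro ⟨_, ⟨a, ε, rfl, rfl⟩, b, η, h, rfl⟩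
    cases h
    exact ⟨a, ε, rfl, by simp⟩
  · rintro ⟨a, ε, rfl, rfl⟩
    exact ⟨_, ⟨a, ε, rfl, rfl⟩, a, _, rfl, by simp⟩

theorem tau_mul_tau_of_ne {α β : Mor C} (h : α.left ≠ β.right) : tau α * tau β = 0 :=
  SymInv.ext fun γ δ => by
    simp only [SymInv.mul_app, SymInv.zero_app, iff_false]
    rintro ⟨ε, h1, h2⟩
    exact h ((tau_app_left h2).1.symm.trans (tau_app_left h1).2)

theorem dom_tau (α : Mor C) : (tau α).dom = vertexIdeal α.left := by
  obtain ⟨y, x, α⟩ := α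
  ext ⟨z, y', β⟩
  constructor
  · rintro ⟨γ, h⟩; exact (tau_app_left h).1
  · rintro (rfl : y' = y)
    exact ⟨_, tau_app_mor α β⟩

theorem image_tau_vertexIdeal (α : Mor C) :
    (tau α).image (vertexIdeal α.left) = principalIdeal α := by
  ext γ
  constructor
  · rintro ⟨β, -, h⟩; exact ⟨β, h⟩
  · rintro ⟨β, h⟩; exact ⟨β, (tau_app_left h).1, h⟩

theorem tau_id (v : C) : tau (mor (𝟙 v)) = SymInv.idOn (vertexIdeal v) :=
  SymInv.ext fun β γ => by
    rw [tau_app_iff, SymInv.idOn_app]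
    constructor
    · rintro ⟨z, δ, rfl, rfl⟩
      simp [vertexIdeal]
    · rintro ⟨rfl, h⟩
      obtain ⟨z, y, β⟩ := β
      obtain rfl : y = v := h
      exact ⟨z, β, rfl, by simp⟩

theorem tau_id_mul {x y : C} (α : y ⟶ x) : tau (mor (𝟙 x)) * tau (mor α) = tau (mor α) := by
  rw [tau_mul_tau, Category.comp_id]

theorem sigma_id (v : C) : sigma (mor (𝟙 v)) = tau (mor (𝟙 v)) := by
  rw [sigma, tau_id, SymInv.idOn_inv]

/-! ### Zigzag maps and the elements of `ZM C`. -/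

namespace ZigzagTuple

theorem phi_single_id {x y : C} (α : y ⟶ x) : (single (𝟙 x) α).phi = tau (mor α) := by
  rw [phi, sigma_id, tau_id_mul]

theorem phi_single_id_right {x y : C} (α : y ⟶ x) : (single α (𝟙 x)).phi = sigma (mor α) := by
  rw [phi, ← sigma_id, sigma, sigma, ← SymInv.mul_inv_rev, tau_id_mul]

theorem phi_app_right {w v : C} (ζ : ZigzagTuple C w v) {β γ : Mor C}
    (h : ζ.phi.app β = some γ) : β.right = v ∧ γ.right = w := by
  constructor
  · apply ζ.A_subset
    rw [A_eq_dom]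
    exact ⟨γ, h⟩
  · apply ζ.reverse.A_subset
    rw [A_eq_dom, phi_reverse]
    exact ⟨β, SymInv.inv_app.2 h⟩

theorem phi_mul_phi_of_ne {w v w' v' : C} (ζ : ZigzagTuple C w v) (ξ : ZigzagTuple C w' v')
    (h : v ≠ w') : ζ.phi * ξ.phi = 0 := SymInv.ext fun β γ => by
  simp only [SymInv.mul_app, SymInv.zero_app, iff_false]
  rintro ⟨δ, h1, h2⟩
  exact h ((ζ.phi_app_right h2).1.symm.trans (ξ.phi_app_right h1).2)

theorem idOn_A {w v : C} (ζ : ZigzagTuple C w v) : SymInv.idOn ζ.A = (ζ.reverse.append ζ).phi :=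
  ζ.coe_idem.symm

theorem A_reverse_append {w v : C} (ζ : ZigzagTuple C w v) : (ζ.reverse.append ζ).A = ζ.A := by
  rw [A_eq_dom, ← idOn_A, SymInv.dom_idOn]

theorem A_eq_empty {w v : C} {ζ : ZigzagTuple C w v} (h : ζ.phi = 0) : ζ.A = ∅ := by
  rw [A_eq_dom, h]
  ext x
  simp [SymInv.dom, SymInv.zero_app]

end ZigzagTuple

/-- The zigzags (r(α), α) and (α, r(α)) give τ_α and σ_α. A product of two zigzag maps is that of
the concatenation if the end vertices match, and is empty otherwise. -/
theorem eq_zero_or_exists_phi {φ : SymInv (Mor C)} (h : φ ∈ ZM C) :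
    φ = 0 ∨ ∃ (w v : C) (ζ : ZigzagTuple C w v), ζ.phi = φ := by
  induction h using Subsemigroup.closure_induction with
  | mem φ hφ =>
    rcases hφ with (⟨⟨y, x, α⟩, rfl⟩ | ⟨⟨y, x, α⟩, rfl⟩) | rfl
    · exact Or.inr ⟨_, _, _, ZigzagTuple.phi_single_id α⟩
    · exact Or.inr ⟨_, _, _, ZigzagTuple.phi_single_id_right α⟩
    · exact Or.inl rfl
  | mul φ ψ _ _ h1 h2 =>
    rcases h1 with rfl | ⟨w, v, ζ, rfl⟩
    · exact Or.inl (zero_mul ψ)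
    rcases h2 with rfl | ⟨w', v', ξ, rfl⟩
    · exact Or.inl (mul_zero ζ.phi)
    by_cases hv : v = w'
    · subst hv
      exact Or.inr ⟨_, _, _, ζ.phi_append ξ⟩
    · exact Or.inl (ζ.phi_mul_phi_of_ne ξ hv)

theorem dom_mem_constructibleIdeals {φ : SymInv (Mor C)} (h : φ ∈ ZM C) :
    φ.dom ∈ constructibleIdeals C := by
  rcases eq_zero_or_exists_phi h with rfl | ⟨w, v, ζ, rfl⟩
  · left
    ext x
    simp [SymInv.dom, SymInv.zero_app]
  · exact Or.inr ⟨w, v, ζ, ζ.A_eq_dom.symm⟩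

theorem idOn_mem_ZM {Y : Set (Mor C)} (h : Y ∈ constructibleIdeals C) :
    SymInv.idOn Y ∈ ZM C := by
  rcases h with rfl | ⟨w, v, ζ, rfl⟩
  · rw [SymInv.idOn_empty]; exact zero_mem_ZM
  · rw [ζ.idOn_A]; exact ZigzagTuple.phi_mem_ZM _

/-- The image of Y is the domain of φ id_Y φ⁻¹, which lies in `ZM C`. -/
theorem image_mem_constructibleIdeals {φ : SymInv (Mor C)} (h : φ ∈ ZM C) {Y : Set (Mor C)}
    (hY : Y ∈ constructibleIdeals C) : φ.image Y ∈ constructibleIdeals C := by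
  rw [← SymInv.dom_idOn (φ.image Y), ← SymInv.mul_idOn_mul_inv]
  exact dom_mem_constructibleIdeals
    ((ZM C).mul_mem ((ZM C).mul_mem h (idOn_mem_ZM hY)) (inv_mem_ZM h))

theorem principalIdeal_mem (α : Mor C) : principalIdeal α ∈ constructibleIdeals C := by
  rw [← image_tau_vertexIdeal]
  exact image_mem_constructibleIdeals (tau_mem_ZM α) (vertexIdeal_mem _)

theorem mem_constructibleUnions {Y : Set (Mor C)} (h : Y ∈ constructibleIdeals C) :
    Y ∈ constructibleUnions C := (toUnions ⟨Y, h⟩).2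

end ZigzagSemigroup

/-! ## Representations of the zigzag inverse semigroup from Li's relations -/

section Representations

variable {C : Type u} [SmallCategory C]
variable {B : Type v} [NonUnitalCStarAlgebra B]

/-! ### Words of zigzags. -/

namespace ZigzagTuple

theorem word_append (V : Mor C → B) {w y v : C} (ζ : ZigzagTuple C w y) (ξ : ZigzagTuple C y v) :
    (ζ.append ξ).word V = ζ.word V * ξ.word V := by
  induction ζ with
  | single α β => rfl
  | cons α β ζ ih => simp [append, word, ih, mul_assoc]

theorem word_reverse (V : Mor C → B) {w v : C} (ζ : ZigzagTuple C w v) :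
    ζ.reverse.word V = star (ζ.word V) := by
  induction ζ with
  | single α β => simp [reverse, word]
  | cons α β ζ ih => simp [reverse, word_append, word, ih]

end ZigzagTuple

variable [LeftCancellative C]
variable {𝒥 : Set (Set (Mor C))} {V : Mor C → B} {P : 𝒥 → B}

/-! ### Consequences of (L1)–(L3). -/

namespace LiBase

/-- By (L2) the element e at an identity morphism is an idempotent; being also a partial isometry,
it satisfies (e - e*e)*(e - e*e) = 0. So e = e*e is self-adjoint. -/
theorem star_id (h : LiBase V P) (x : C) : star (V (mor (𝟙 x))) = V (mor (𝟙 x)) := by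
  set e := V (mor (𝟙 x)) with he
  have h1 : e * e = e := by simpa using h.L2_comp (𝟙 x) (𝟙 x)
  have h2 : e * star e * e = e := h.partialIsometry _
  have h3 : star e * star e = star e := by rw [← star_mul, h1]
  have h4 : star e * e * (star e * e) = star e * e := by
    rw [mul_assoc, ← mul_assoc e, h2]
  have h5 : star (e - star e * e) * (e - star e * e) = 0 := by
    have h6 : star e * (star e * e) = star e * e := by rw [← mul_assoc, h3]
    have h7 : star e * e * e = star e * e := by rw [mul_assoc, h1]
    rw [star_sub, star_mul, star_star, sub_mul, mul_sub, mul_sub, h6, h7, h4]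
    abel
  have h8 : e = star e * e := sub_eq_zero.1 (CStarRing.star_mul_self_eq_zero_iff _ |>.1 h5)
  rw [h8, star_mul, star_star]

theorem star_mul_self_id (h : LiBase V P) (x : C) :
    star (V (mor (𝟙 x))) * V (mor (𝟙 x)) = V (mor (𝟙 x)) := by
  rw [h.star_id]
  simpa using h.L2_comp (𝟙 x) (𝟙 x)

theorem id_eq (h : LiBase V P) {v : C} (Y : 𝒥) (hY : (Y : Set (Mor C)) = vertexIdeal v) :
    V (mor (𝟙 v)) = P Y := by
  rw [← h.star_mul_self_id, h.L1 _ Y hY]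

theorem mul_id (h : LiBase V P) (α : Mor C) : V α * V (mor (𝟙 α.left)) = V α := by
  simpa using h.L2_comp α.hom (𝟙 α.left)

theorem id_mul (h : LiBase V P) (α : Mor C) : V (mor (𝟙 α.right)) * V α = V α := by
  simpa using h.L2_comp (𝟙 α.right) α.hom

theorem star_mul_self (h : LiBase V P) (h𝒥 : constructibleIdeals C ⊆ 𝒥) (α : Mor C) :
    star (V α) * V α = V (mor (𝟙 α.left)) := by
  rw [h.L1 α ⟨_, h𝒥 (vertexIdeal_mem _)⟩ rfl, h.id_eq ⟨_, h𝒥 (vertexIdeal_mem _)⟩ rfl]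

theorem mul_star_of_ne (h : LiBase V P) {α β : Mor C} (hne : α.left ≠ β.left) :
    V α * star (V β) = 0 := by
  rw [← h.mul_id α, ← h.mul_id β, star_mul, h.star_id, mul_assoc,
    ← mul_assoc (V (mor (𝟙 α.left))), h.L2_zero (mor (𝟙 α.left)) (mor (𝟙 β.left)) hne]
  simp

/-- Counterpart of `phi_mul_phi_of_ne`: orthogonality of the projections at distinct vertices kills
the product of the adjacent letters. -/
theorem word_mul_word_of_ne (h : LiBase V P) {w v w' v' : C} (ζ : ZigzagTuple C w v)
    (ξ : ZigzagTuple C w' v') (hne : v ≠ w') : ζ.word V * ξ.word V = 0 := by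
  induction ζ with
  | @single w v x α β =>
    have h1 : V (mor β) * ξ.word V = 0 := by
      cases ξ with
      | single α' β' =>
        rw [ZigzagTuple.word, ← mul_assoc, h.mul_star_of_ne (α := mor β) (β := mor α') hne, zero_mul]
      | cons α' β' ξ =>
        rw [ZigzagTuple.word, ← mul_assoc, ← mul_assoc,
          h.mul_star_of_ne (α := mor β) (β := mor α') hne, zero_mul, zero_mul]
    rw [ZigzagTuple.word, mul_assoc, h1, mul_zero]
  | cons α β ζ ih => rw [ZigzagTuple.word, mul_assoc, ih hne, mul_zero]

end LiBase

/-- Expanding (x - y)*(x - y) gives p - p - p + p = 0, and the C*-identity does the rest. -/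
theorem eq_of_star_mul_eq {x y p : B} (h1 : star x * x = p) (h2 : star x * y = p)
    (h3 : star y * x = p) (h4 : star y * y = p) : x = y := by
  refine sub_eq_zero.1 ((CStarRing.star_mul_self_eq_zero_iff _).1 ?_)
  rw [star_sub, sub_mul, mul_sub, mul_sub, h1, h2, h3, h4]
  abel

/-- (L7) makes the word of a zigzag depend on the zigzag map only. -/
theorem word_eq_of_phi_eq (h𝒥 : constructibleIdeals C ⊆ 𝒥) (hB : LiBase V P) (h7 : L7 V P)
    {w v w' v' : C} (ζ : ZigzagTuple C w v) (ξ : ZigzagTuple C w' v') (h : ζ.phi = ξ.phi) :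
    ζ.word V = ξ.word V := by
  -- The empty map does not determine the end vertices of a zigzag, so it is treated apart: (L7) for
  -- the empty ideal and (L3) make the word vanish.
  by_cases h0 : ζ.phi = 0
  · have key : ∀ {a b : C} (η : ZigzagTuple C a b), η.phi = 0 → η.word V = 0 := fun η hη => by
      have hA := ZigzagTuple.A_eq_empty hη
      rw [h7 η ⟨∅, h𝒥 empty_mem_constructibleIdeals⟩ (by rw [hη, hA, SymInv.idOn_empty]) hA.symm]
      exact hB.L3 _ rfl
    rw [key ζ h0, key ξ (h ▸ h0)]
  · obtain ⟨β, γ, hβ⟩ : ∃ β γ, ζ.phi.app β = some γ := by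
      by_contra! hn
      exact h0 (SymInv.ext fun β γ => by simp [hn, SymInv.zero_app])
    -- One pair in the graph of the common map shows that the end vertices agree, so that the
    -- reverse of one zigzag can be concatenated with the other.
    obtain ⟨h1, h2⟩ := ζ.phi_app_right hβ
    rw [h] at hβ
    obtain ⟨h3, h4⟩ := ξ.phi_app_right hβ
    obtain rfl := h1.symm.trans h3
    obtain rfl := h2.symm.trans h4
    subst h1 h2
    have hA : ζ.A = ξ.A := by rw [ζ.A_eq_dom, ξ.A_eq_dom, h]
    have key : ∀ η θ : ZigzagTuple C γ.right β.right, η.phi = ζ.phi → θ.phi = ζ.phi →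
        star (η.word V) * θ.word V = P ⟨ζ.A, h𝒥 ζ.ideal.2⟩ := fun η θ h1 h2 => by
      have h3 : (η.reverse.append θ).phi = SymInv.idOn ζ.A := by
        rw [ZigzagTuple.phi_append, ZigzagTuple.phi_reverse, h1, h2, SymInv.inv_mul_self,
          ZigzagTuple.A_eq_dom]
      have h4 : (η.reverse.append θ).A = ζ.A := by
        rw [ZigzagTuple.A_eq_dom, h3, SymInv.dom_idOn]
      rw [← ZigzagTuple.word_reverse, ← ZigzagTuple.word_append]
      exact h7 _ _ (by rw [h3, h4]) h4.symm
    exact eq_of_star_mul_eq (key ζ ζ rfl rfl) (key ζ ξ rfl h.symm) (key ξ ζ h.symm rfl)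
      (key ξ ξ h.symm h.symm)

open Classical in
/-- The map `φ_ζ ↦ V_{α₁}^* V_{β₁} ⋯ V_{αₙ}^* V_{βₙ}` on `ZM(C)`. -/
noncomputable def wordRep (V : Mor C → B) (φ : ZM C) : B :=
  -- Every nonzero element is a zigzag map, so the default value 0 is taken only at the empty map.
  if h : φ ≠ 0 ∧ ∃ ζ : (w : C) × (v : C) × ZigzagTuple C w v, ζ.2.2.phi = φ then
    h.2.choose.2.2.word V else 0

theorem wordRep_zero : wordRep V (0 : ZM C) = 0 := by
  rw [wordRep, dif_neg (by simp)]

theorem wordRep_zm (h𝒥 : constructibleIdeals C ⊆ 𝒥) (hB : LiBase V P) (h7 : L7 V P)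
    {w v : C} (ζ : ZigzagTuple C w v) : wordRep V ζ.zm = ζ.word V := by
  by_cases h0 : ζ.zm = 0
  · have h0' : ζ.phi = 0 := congrArg Subtype.val h0
    have hA := ZigzagTuple.A_eq_empty h0'
    rw [h0, wordRep_zero, h7 ζ ⟨∅, h𝒥 empty_mem_constructibleIdeals⟩
      (by rw [h0', hA, SymInv.idOn_empty]) hA.symm, hB.L3 _ rfl]
  · have h : ζ.zm ≠ 0 ∧ ∃ ξ : (w : C) × (v : C) × ZigzagTuple C w v, ξ.2.2.phi = ζ.zm :=
      ⟨h0, ⟨w, v, ζ⟩, rfl⟩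
    rw [wordRep, dif_pos h]
    exact word_eq_of_phi_eq h𝒥 hB h7 _ _ h.2.choose_spec

theorem eq_zero_or_exists_zm (φ : ZM C) :
    φ = 0 ∨ ∃ (w v : C) (ζ : ZigzagTuple C w v), φ = ζ.zm := by
  rcases eq_zero_or_exists_phi φ.2 with h | ⟨w, v, ζ, h⟩
  · exact Or.inl (Subtype.ext h)
  · exact Or.inr ⟨w, v, ζ, Subtype.ext h.symm⟩

/-- Inverses and products in `ZM C` are reversals and concatenations of zigzags, which words turn
into adjoints and products. If the end vertices do not match, both sides vanish. -/
theorem isInvSemigroupRep_wordRep (h𝒥 : constructibleIdeals C ⊆ 𝒥) (hB : LiBase V P)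
    (h7 : L7 V P) : IsInvSemigroupRep (wordRep V : ZM C → B) where
  map_zero := wordRep_zero
  map_inv φ := by
    rcases eq_zero_or_exists_zm φ with rfl | ⟨w, v, ζ, rfl⟩
    · have : (0 : ZM C)⁻¹ = 0 := rfl
      rw [this, wordRep_zero, star_zero]
    · have : (ζ.zm)⁻¹ = ζ.reverse.zm := Subtype.ext ζ.phi_reverse.symm
      rw [this, wordRep_zm h𝒥 hB h7, wordRep_zm h𝒥 hB h7, ζ.word_reverse]
  map_mul φ ψ := by
    rcases eq_zero_or_exists_zm φ with rfl | ⟨w, v, ζ, rfl⟩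
    · rw [zero_mul, wordRep_zero, zero_mul]
    rcases eq_zero_or_exists_zm ψ with rfl | ⟨w', v', ξ, rfl⟩
    · rw [mul_zero, wordRep_zero, mul_zero]
    by_cases hv : v = w'
    · subst hv
      have : ζ.zm * ξ.zm = (ζ.append ξ).zm := Subtype.ext (ζ.phi_append ξ).symm
      rw [this, wordRep_zm h𝒥 hB h7, wordRep_zm h𝒥 hB h7, wordRep_zm h𝒥 hB h7, ζ.word_append]
    · have : ζ.zm * ξ.zm = 0 := Subtype.ext (ζ.phi_mul_phi_of_ne ξ hv)
      rw [this, wordRep_zero, wordRep_zm h𝒥 hB h7, wordRep_zm h𝒥 hB h7,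
        hB.word_mul_word_of_ne ζ ξ hv]

/-- The element `id_Y` of `ZM(C)`, for a constructible right ideal `Y`. -/
noncomputable def idZM (Y : constructibleIdeals C) : ZM C := ⟨SymInv.idOn Y, idOn_mem_ZM Y.2⟩

/-- The element `τ_α` of `ZM(C)`. -/
noncomputable def tauZM (α : Mor C) : ZM C := ⟨tau α, tau_mem_ZM α⟩

theorem coe_idZM (Y : constructibleIdeals C) : (idZM Y : SymInv (Mor C)) = SymInv.idOn Y := rfl

theorem idZM_ideal {w v : C} (ζ : ZigzagTuple C w v) : idZM ζ.ideal = ζ.idem :=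
  Subtype.ext ζ.coe_idem.symm

theorem tauZM_mor {x y : C} (α : y ⟶ x) : tauZM (mor α) = (ZigzagTuple.single (𝟙 x) α).zm :=
  Subtype.ext (ZigzagTuple.phi_single_id α).symm

theorem idZM_of_eq_empty {Y : constructibleIdeals C} (h : (Y : Set (Mor C)) = ∅) : idZM Y = 0 :=
  Subtype.ext (by rw [coe_idZM, h, SymInv.idOn_empty]; rfl)

theorem inv_tauZM_mul (α : Mor C) (Y : constructibleIdeals C)
    (h : (Y : Set (Mor C)) = vertexIdeal α.left) : (tauZM α)⁻¹ * tauZM α = idZM Y :=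
  Subtype.ext (by rw [coe_idZM, h, ← dom_tau]; exact SymInv.inv_mul_self _)

theorem wordRep_tauZM (h𝒥 : constructibleIdeals C ⊆ 𝒥) (hB : LiBase V P) (h7 : L7 V P)
    (α : Mor C) : wordRep V (tauZM α) = V α := by
  rw [tauZM_mor, wordRep_zm h𝒥 hB h7, ZigzagTuple.word, hB.star_id, hB.id_mul]

theorem wordRep_idZM (h𝒥 : constructibleIdeals C ⊆ 𝒥) (hB : LiBase V P) (h7 : L7 V P)
    (Y : constructibleIdeals C) : wordRep V (idZM Y) = P ⟨Y, h𝒥 Y.2⟩ := by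
  obtain ⟨Y, rfl | ⟨w, v, ζ, rfl⟩⟩ := Y
  · rw [idZM_of_eq_empty rfl, wordRep_zero, hB.L3 _ rfl]
  · have := wordRep_zm h𝒥 hB h7 (ζ.reverse.append ζ)
    rw [h7 _ ⟨ζ.A, h𝒥 ζ.ideal.2⟩ (by rw [ζ.A_reverse_append, ζ.idOn_A]) ζ.A_reverse_append.symm]
      at this
    rw [← this]
    exact congrArg _ (idZM_ideal ζ)

/-! ### From representations of `ZM C` back to Li's relations. -/

namespace IsInvSemigroupRep

variable {π : ZM C → B}

theorem word (h : IsInvSemigroupRep π) {w v : C} (ζ : ZigzagTuple C w v) :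
    ζ.word (fun α => π (tauZM α)) = π ζ.zm := by
  induction ζ with
  | single α β =>
    rw [ZigzagTuple.word, ← h.map_inv, ← h.map_mul]
    rfl
  | cons α β ζ ih =>
    rw [ZigzagTuple.word, ih, ← h.map_inv, ← h.map_mul, ← h.map_mul]
    rfl

theorem idZM_mul (h : IsInvSemigroupRep π) (Y Z W : constructibleIdeals C)
    (hW : (W : Set (Mor C)) = ↑Y ∩ ↑Z) : π (idZM Y) * π (idZM Z) = π (idZM W) := by
  rw [← h.map_mul]
  congr 1
  exact Subtype.ext (by rw [coe_idZM, hW, ← SymInv.idOn_mul_idOn]; rfl)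

theorem isStarProjection_idZM (h : IsInvSemigroupRep π) (Y : constructibleIdeals C) :
    IsStarProjection (π (idZM Y)) :=
  ⟨h.idZM_mul _ _ _ (Set.inter_self _).symm, by
    rw [IsSelfAdjoint, ← h.map_inv]
    exact congrArg π (Subtype.ext (SymInv.idOn_inv _))⟩

theorem tauZM_idZM (h : IsInvSemigroupRep π) (α : Mor C) (Y W : constructibleIdeals C)
    (hW : (W : Set (Mor C)) = (tau α).image ↑Y) :
    π (tauZM α) * π (idZM Y) * star (π (tauZM α)) = π (idZM W) := by
  rw [← h.map_inv, ← h.map_mul, ← h.map_mul]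
  congr 1
  exact Subtype.ext (by rw [coe_idZM, hW]; exact SymInv.mul_idOn_mul_inv _ _)

/-- A representation of `ZM(C)` gives families satisfying (L1), (L2) and (L3), for any choice of
projections that extends `Y ↦ π(id_Y)`. -/
theorem liBase (h : IsInvSemigroupRep π) (hproj : ∀ Y, IsStarProjection (P Y))
    (hP : ∀ (Y : constructibleIdeals C) (Z : 𝒥), (Z : Set (Mor C)) = Y → P Z = π (idZM Y)) :
    LiBase (fun α => π (tauZM α)) P where
  partialIsometry α := by
    rw [← h.map_inv, ← h.map_mul, ← h.map_mul, InverseSemigroupWithZero.mul_inv_mul]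
  projection := hproj
  L1 α Y hY := by
    rw [hP ⟨_, vertexIdeal_mem α.left⟩ Y hY, ← h.map_inv, ← h.map_mul, inv_tauZM_mul _ ⟨_, vertexIdeal_mem α.left⟩ rfl]
  L2_comp α β := by
    rw [← h.map_mul]
    exact congrArg π (Subtype.ext (tau_mul_tau α β))
  L2_zero α β hne := by
    rw [← h.map_mul, ← h.map_zero]
    exact congrArg π (Subtype.ext (tau_mul_tau_of_ne hne))
  L3 Y hY := by
    rw [hP ⟨∅, empty_mem_constructibleIdeals⟩ Y hY, idZM_of_eq_empty rfl, h.map_zero]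

theorem L7 (h : IsInvSemigroupRep π)
    (hP : ∀ (Y : constructibleIdeals C) (Z : 𝒥), (Z : Set (Mor C)) = Y → P Z = π (idZM Y)) :
    L7 (fun α => π (tauZM α)) P := fun {w v} ζ Y h1 h2 => by
  rw [h.word, hP ζ.ideal Y h2]
  exact congrArg π (Subtype.ext h1)

end IsInvSemigroupRep

end Representations

/-! ## `C*_{Li,s}(C)` and `C*(ZM(C))` -/

section

variable {C : Type u} [SmallCategory C] [LeftCancellative C]

theorem gen_isInvSemigroupRep_CZM :
    IsInvSemigroupRep (fun s : ZM C => (UnivCStar.gen _ s : CZM C)) :=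
  gen_isInvSemigroupRep fun h => h

/-- Two `*`-homomorphisms that are mutually inverse give an isomorphism. -/
noncomputable def starEquivOfInverse {A B : Type*} [NonUnitalCStarAlgebra A]
    [NonUnitalCStarAlgebra B] (f : A →⋆ₙₐ[ℂ] B) (g : B →⋆ₙₐ[ℂ] A)
    (h1 : g.comp f = NonUnitalStarAlgHom.id ℂ A) (h2 : f.comp g = NonUnitalStarAlgHom.id ℂ B) :
    A ≃⋆ₐ[ℂ] B where
  toFun := f
  invFun := g
  left_inv a := DFunLike.congr_fun h1 a
  right_inv b := DFunLike.congr_fun h2 b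
  map_mul' := map_mul f
  map_add' := map_add f
  map_star' := map_star f
  map_smul' := map_smul f

theorem relLiS_of_rep {B : Type u} [NonUnitalCStarAlgebra B] {π : ZM C → B}
    (h : IsInvSemigroupRep π) :
    (relLiS (constructibleIdeals C)).Holds
      (Sum.elim (fun α => π (tauZM α)) fun Y => π (idZM Y)) := by
  have hP : ∀ Y Z : constructibleIdeals C, (Z : Set (Mor C)) = Y → π (idZM Z) = π (idZM Y) :=
    fun Y Z hYZ => by rw [Subtype.ext hYZ]
  exact ⟨h.liBase (fun Y => h.isStarProjection_idZM Y) hP, h.L7 hP⟩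

/-- The two universal properties give homomorphisms in both directions. They are mutually inverse on
generators: the word representation returns v_α at τ_α and p_Y at id_Y, and the word of ζ in the
generators τ_α is the generator φ_ζ. -/
theorem exists_equiv_CLiS_CZM : ∃ g : CLiS C ≃⋆ₐ[ℂ] CZM C,
    (∀ α, g (genV _ α) = UnivCStar.gen _ (tauZM α)) ∧
    ∀ Y, g (genP _ Y) = UnivCStar.gen _ (idZM Y) := by
  have hS := gen_holds_CLiS (C := C)
  have hB : LiBase (genV (relLiS (constructibleIdeals C))) (genP _) := hS.1
  have h7 : L7 (genV (relLiS (constructibleIdeals C))) (genP _) := hS.2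
  have hrep := isInvSemigroupRep_wordRep subset_rfl hB h7
  let f : CLiS C →⋆ₙₐ[ℂ] CZM C := UnivCStar.lift (relLiS_of_rep gen_isInvSemigroupRep_CZM)
  let k : CZM C →⋆ₙₐ[ℂ] CLiS C := UnivCStar.lift (f := wordRep (genV _)) hrep
  have hfV : ∀ α, f (genV _ α) = UnivCStar.gen _ (tauZM α) := fun α => UnivCStar.lift_gen _ _
  have hfP : ∀ Y, f (genP _ Y) = UnivCStar.gen _ (idZM Y) := fun Y => UnivCStar.lift_gen _ _
  have hk : ∀ s, k (UnivCStar.gen _ s) = wordRep (genV _) s := fun s => UnivCStar.lift_gen _ _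
  refine ⟨starEquivOfInverse f k (UnivCStar.hom_ext ?_) (UnivCStar.hom_ext ?_), hfV, hfP⟩
  · rintro (α | Y)
    · exact (congrArg k (hfV α)).trans ((hk _).trans (wordRep_tauZM subset_rfl hB h7 α))
    · exact (congrArg k (hfP Y)).trans ((hk _).trans (wordRep_idZM subset_rfl hB h7 Y))
  · intro s
    refine (congrArg f (hk s)).trans ?_
    rcases eq_zero_or_exists_zm s with rfl | ⟨w, v, ζ, rfl⟩
    · rw [wordRep_zero, map_zero]
      exact gen_isInvSemigroupRep_CZM.map_zero.symm
    · rw [wordRep_zm subset_rfl hB h7, map_word]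
      have : (f ∘ genV (relLiS (constructibleIdeals C))) =
        fun α => UnivCStar.gen _ (tauZM α) := funext hfV
      rw [this]
      exact gen_isInvSemigroupRep_CZM.word ζ

end

/-! ## Joins of commuting projections -/

section ProjJoin

variable {B : Type v} [NonUnitalCStarAlgebra B]

theorem projJoin_cons (p : B) (l : List B) :
    projJoin (p :: l) = p + projJoin l - p * projJoin l := rfl

theorem commute_projJoin {a : B} {l : List B} (h : ∀ p ∈ l, Commute a p) :
    Commute a (projJoin l) := by
  induction l with
  | nil => exact Commute.zero_right a
  | cons p l ih =>
    have h1 : Commute a p := h p (by simp)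
    have h2 := ih fun q hq => h q (by simp [hq])
    exact (h1.add_right h2).sub_right (h1.mul_right h2)

/-- Distributivity of meet over join. Since p is an idempotent that commutes with each q, (pq)(pJ) =
p(qJ) for the join J of the remaining members. -/
theorem mul_projJoin {p : B} (hp : p * p = p) {l : List B} (h : ∀ q ∈ l, Commute p q) :
    p * projJoin l = projJoin (l.map (p * ·)) := by
  induction l with
  | nil => simp [projJoin]
  | cons q l ih =>
    have h1 : p * q = q * p := h q (by simp)
    rw [List.map_cons, projJoin_cons, projJoin_cons, ← ih fun q hq => h q (by simp [hq]),
      mul_sub, mul_add]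
    congr 1
    rw [h1, mul_assoc q, ← mul_assoc p p, hp, ← mul_assoc q, ← h1, mul_assoc]

theorem projJoin_mul_eq_self {q : B} {l : List B} (h : ∀ p ∈ l, p * q = p) :
    projJoin l * q = projJoin l := by
  induction l with
  | nil => simp [projJoin]
  | cons p l ih =>
    rw [projJoin_cons, sub_mul, add_mul, mul_assoc, ih fun p hp => h p (by simp [hp]),
      h p (by simp)]

/-- Here q need not be a projection; the lemma is applied with q the word of a zigzag. -/
theorem mul_projJoin_eq_self {q : B} {l : List B} (h : ∀ p ∈ l, q * p = p) :
    q * projJoin l = projJoin l := by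
  induction l with
  | nil => simp [projJoin]
  | cons p l ih =>
    rw [projJoin_cons, mul_sub, mul_add, ← mul_assoc, ih fun p hp => h p (by simp [hp]),
      h p (by simp)]

/-- Formally `1 - projJoin l` is the ordered product of the 1 - p, so no commutation is needed. -/
theorem projJoin_append (l l' : List B) :
    projJoin (l ++ l') = projJoin l + projJoin l' - projJoin l * projJoin l' := by
  induction l with
  | nil => simp [projJoin]
  | cons p l ih =>
    rw [List.cons_append, projJoin_cons, projJoin_cons, ih]
    noncomm_ring

theorem star_projJoin {l : List B} (h : ∀ p ∈ l, star p = p) (hc : ∀ p ∈ l, ∀ q ∈ l, Commute p q) :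
    star (projJoin l) = projJoin l := by
  induction l with
  | nil => simp [projJoin]
  | cons p l ih =>
    have h1 : Commute p (projJoin l) := commute_projJoin fun q hq => hc p (by simp) q (by simp [hq])
    rw [projJoin_cons, star_sub, star_add, star_mul, h p (by simp),
      ih (fun q hq => h q (by simp [hq])) fun q hq q' hq' => hc q (by simp [hq]) q' (by simp [hq']),
      h1.eq]

theorem projJoin_eq_zero {l : List B} (h : ∀ p ∈ l, p = 0) : projJoin l = 0 := by
  have := projJoin_mul_eq_self (q := 0) (l := l) fun p hp => by rw [h p hp, mul_zero]
  rw [← this, mul_zero]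

end ProjJoin

/-! ## Finite unions of constructible right ideals -/

section Unions

variable {C : Type u} [SmallCategory C] [LeftCancellative C]

theorem exists_list_of_mem_constructibleUnions {U : Set (Mor C)} (h : U ∈ constructibleUnions C) :
    ∃ l : List (constructibleIdeals C), U = ⋃ Y ∈ l, (Y : Set (Mor C)) := by
  obtain ⟨F, hF, hFJ, rfl⟩ := h
  refine ⟨hF.toFinset.toList.pmap (fun Y h => ⟨Y, h⟩) fun Y hY => hFJ (by simpa using hY), ?_⟩
  ext x
  simp only [Set.mem_sUnion, Set.mem_iUnion, List.mem_pmap]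
  constructor
  · rintro ⟨Y, hY, hx⟩
    exact ⟨⟨Y, hFJ hY⟩, ⟨Y, by simpa using hY, rfl⟩, hx⟩
  · rintro ⟨_, ⟨Y, hY, rfl⟩, hx⟩
    exact ⟨Y, by simpa using hY, hx⟩

theorem empty_mem_constructibleUnions : (∅ : Set (Mor C)) ∈ constructibleUnions C :=
  mem_constructibleUnions empty_mem_constructibleIdeals

theorem union_mem_constructibleUnions {U W : Set (Mor C)} (hU : U ∈ constructibleUnions C)
    (hW : W ∈ constructibleUnions C) : U ∪ W ∈ constructibleUnions C := by
  obtain ⟨F, hF, hFJ, rfl⟩ := hU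
  obtain ⟨G, hG, hGJ, rfl⟩ := hW
  exact ⟨F ∪ G, hF.union hG, Set.union_subset hFJ hGJ, (Set.sUnion_union F G).symm⟩

theorem biUnion_list_mem_constructibleUnions (l : List (constructibleIdeals C)) :
    (⋃ Y ∈ l, (Y : Set (Mor C))) ∈ constructibleUnions C := by
  induction l with
  | nil => simpa using empty_mem_constructibleUnions
  | cons Y l ih =>
    simpa [Set.iUnion_or, Set.iUnion_union_distrib] using
      union_mem_constructibleUnions (mem_constructibleUnions Y.2) ih

/-- Adjoining one ideal at a time suits (L6), which speaks of two sets. The empty union needs no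
case of its own because ∅ is a constructible ideal. -/
theorem constructibleUnions_induction {p : ∀ U : Set (Mor C), U ∈ constructibleUnions C → Prop}
    (ideal : ∀ Y (hY : Y ∈ constructibleIdeals C), p Y (mem_constructibleUnions hY))
    (union : ∀ Y (hY : Y ∈ constructibleIdeals C) U (hU : U ∈ constructibleUnions C), p U hU →
      p (Y ∪ U) (union_mem_constructibleUnions (mem_constructibleUnions hY) hU))
    {U : Set (Mor C)} (hU : U ∈ constructibleUnions C) : p U hU := by
  obtain ⟨l, hl⟩ := exists_list_of_mem_constructibleUnions hU
  induction l generalizing U with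
  | nil =>
    obtain rfl : U = ∅ := by simpa using hl
    exact ideal ∅ empty_mem_constructibleIdeals
  | cons Y l ih =>
    obtain rfl : U = (Y : Set (Mor C)) ∪ ⋃ Z ∈ l, (Z : Set (Mor C)) := by
      simpa [Set.iUnion_or, Set.iUnion_union_distrib] using hl
    exact union Y Y.2 _ (biUnion_list_mem_constructibleUnions l) (ih _ rfl)

theorem biUnion_list_map {ι κ X : Type*} (l : List ι) (f : ι → κ) (g : κ → Set X) :
    (⋃ k ∈ l.map f, g k) = ⋃ i ∈ l, g (f i) := by
  ext x
  simp only [Set.mem_iUnion, List.mem_map, exists_prop]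
  constructor
  · rintro ⟨_, ⟨i, hi, rfl⟩, hx⟩; exact ⟨i, hi, hx⟩
  · rintro ⟨i, hi, hx⟩; exact ⟨_, ⟨i, hi, rfl⟩, hx⟩

theorem inter_mem_constructibleUnions {U W : Set (Mor C)} (hU : U ∈ constructibleUnions C)
    (hW : W ∈ constructibleUnions C) : U ∩ W ∈ constructibleUnions C := by
  induction hU using constructibleUnions_induction with
  | ideal Y hY =>
    induction hW using constructibleUnions_induction with
    | ideal Z hZ => exact mem_constructibleUnions (inter_mem_constructibleIdeals hY hZ)
    | union Z hZ W hW ih =>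
      rw [Set.inter_union_distrib_left]
      exact union_mem_constructibleUnions
        (mem_constructibleUnions (inter_mem_constructibleIdeals hY hZ)) ih
  | union Y hY U hU ih =>
    rw [Set.union_inter_distrib_right]
    refine union_mem_constructibleUnions ?_ ih
    clear ih
    induction hW using constructibleUnions_induction with
    | ideal Z hZ => exact mem_constructibleUnions (inter_mem_constructibleIdeals hY hZ)
    | union Z hZ W hW ih =>
      rw [Set.inter_union_distrib_left]
      exact union_mem_constructibleUnions
        (mem_constructibleUnions (inter_mem_constructibleIdeals hY hZ)) ih

theorem image_tau_mem_constructibleUnions (α : Mor C) {U : Set (Mor C)}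
    (hU : U ∈ constructibleUnions C) : (tau α).image U ∈ constructibleUnions C := by
  induction hU using constructibleUnions_induction with
  | ideal Y hY => exact mem_constructibleUnions (image_tau_mem_constructibleIdeals α hY)
  | union Y hY U hU ih =>
    rw [SymInv.image_union]
    exact union_mem_constructibleUnions
      (mem_constructibleUnions (image_tau_mem_constructibleIdeals α hY)) ih

end Unions

/-! ## Relations (L4) and (L5) from (L6) and (L7) -/

section

variable {C : Type u} [SmallCategory C] [LeftCancellative C]
variable {B : Type v} [NonUnitalCStarAlgebra B]

theorem L4_of_L7 {𝒥 : Set (Set (Mor C))} (h𝒥 : constructibleIdeals C ⊆ 𝒥) {V : Mor C → B}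
    {P : 𝒥 → B} (hB : LiBase V P) (h7 : L7 V P) {Y Z : Set (Mor C)}
    (hY : Y ∈ constructibleIdeals C) (hZ : Z ∈ constructibleIdeals C) :
    P ⟨Y, h𝒥 hY⟩ * P ⟨Z, h𝒥 hZ⟩ = P ⟨Y ∩ Z, h𝒥 (inter_mem_constructibleIdeals hY hZ)⟩ := by
  have h := (isInvSemigroupRep_wordRep h𝒥 hB h7).idZM_mul ⟨Y, hY⟩ ⟨Z, hZ⟩
    ⟨Y ∩ Z, inter_mem_constructibleIdeals hY hZ⟩ rfl
  rwa [wordRep_idZM h𝒥 hB h7, wordRep_idZM h𝒥 hB h7, wordRep_idZM h𝒥 hB h7] at h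

theorem L5_of_L7 {𝒥 : Set (Set (Mor C))} (h𝒥 : constructibleIdeals C ⊆ 𝒥) {V : Mor C → B}
    {P : 𝒥 → B} (hB : LiBase V P) (h7 : L7 V P) (α : Mor C) {Y : Set (Mor C)}
    (hY : Y ∈ constructibleIdeals C) :
    V α * P ⟨Y, h𝒥 hY⟩ * star (V α) =
      P ⟨(tau α).image Y, h𝒥 (image_tau_mem_constructibleIdeals α hY)⟩ := by
  have h := (isInvSemigroupRep_wordRep h𝒥 hB h7).tauZM_idZM α ⟨Y, hY⟩
    ⟨(tau α).image Y, image_tau_mem_constructibleIdeals α hY⟩ rfl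
  rwa [wordRep_idZM h𝒥 hB h7, wordRep_idZM h𝒥 hB h7, wordRep_tauZM h𝒥 hB h7] at h

variable {V : Mor C → B} {P : constructibleUnions C → B}

/-- Each factor is extended from ideals to unions in turn. `step` extends the left factor for a
fixed right factor; taking adjoints exchanges the factors, and `step` is then used once more. -/
theorem L4_of_L4_ideals (hproj : ∀ Y, IsStarProjection (P Y)) (h6 : L6 P)
    (h4 : ∀ {Y Z : Set (Mor C)} (hY : Y ∈ constructibleIdeals C) (hZ : Z ∈ constructibleIdeals C),
      P ⟨Y, mem_constructibleUnions hY⟩ * P ⟨Z, mem_constructibleUnions hZ⟩ =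
        P ⟨Y ∩ Z, mem_constructibleUnions (inter_mem_constructibleIdeals hY hZ)⟩) : L4 P := by
  have step : ∀ (U : Set (Mor C)) (hU : U ∈ constructibleUnions C),
      (∀ (Y : Set (Mor C)) (hY : Y ∈ constructibleIdeals C),
        P ⟨Y, mem_constructibleUnions hY⟩ * P ⟨U, hU⟩ =
          P ⟨Y ∩ U, inter_mem_constructibleUnions (mem_constructibleUnions hY) hU⟩) →
      ∀ (W : Set (Mor C)) (hW : W ∈ constructibleUnions C), P ⟨W, hW⟩ * P ⟨U, hU⟩ =
        P ⟨W ∩ U, inter_mem_constructibleUnions hW hU⟩ := by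
    intro U hU hbase W hW
    refine constructibleUnions_induction (p := fun W hW =>
      P ⟨W, hW⟩ * P ⟨U, hU⟩ = P ⟨W ∩ U, inter_mem_constructibleUnions hW hU⟩) hbase ?_ hW
    intro Y hY Z hZ h2
    have h1 := hbase Y hY
    have hY' := mem_constructibleUnions hY
    have hYZ := union_mem_constructibleUnions hY' hZ
    rw [h6 ⟨Y, hY'⟩ ⟨Z, hZ⟩ ⟨Y ∪ Z, hYZ⟩ rfl, h6 ⟨Y ∩ U, inter_mem_constructibleUnions hY' hU⟩
      ⟨Z ∩ U, inter_mem_constructibleUnions hZ hU⟩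
      ⟨(Y ∪ Z) ∩ U, inter_mem_constructibleUnions hYZ hU⟩ (Set.union_inter_distrib_right _ _ _)]
    -- P_U absorbs P_{Z ∩ U}, so P_{Y ∩ U} P_{Z ∩ U} = P_Y P_U P_{Z ∩ U} collapses to P_Y P_Z P_U,
    -- as the inclusion-exclusion formula requires.
    have h3 : P ⟨U, hU⟩ * P ⟨Z, hZ⟩ = P ⟨Z ∩ U, inter_mem_constructibleUnions hZ hU⟩ := by
      rw [← (hproj ⟨Z ∩ U, _⟩).isSelfAdjoint.star_eq, ← h2, star_mul,
        (hproj ⟨Z, hZ⟩).isSelfAdjoint.star_eq, (hproj ⟨U, hU⟩).isSelfAdjoint.star_eq]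
    have h4 : P ⟨U, hU⟩ * P ⟨Z ∩ U, inter_mem_constructibleUnions hZ hU⟩ =
        P ⟨Z ∩ U, inter_mem_constructibleUnions hZ hU⟩ := by
      conv_lhs => rw [← h3, ← mul_assoc, (hproj ⟨U, hU⟩).isIdempotentElem.eq]
      exact h3
    rw [← h1, mul_assoc (P ⟨Y, hY'⟩) (P ⟨U, hU⟩), h4, ← h2]
    noncomm_ring
  have h : ∀ (W : Set (Mor C)) (hW : W ∈ constructibleUnions C) (U : Set (Mor C))
      (hU : U ∈ constructibleUnions C), P ⟨W, hW⟩ * P ⟨U, hU⟩ =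
        P ⟨W ∩ U, inter_mem_constructibleUnions hW hU⟩ := by
    intro W hW U hU
    refine step U hU (fun Y hY => ?_) W hW
    have := congrArg star (step Y (mem_constructibleUnions hY) (fun Z hZ => h4 hZ hY) U hU)
    rw [star_mul, (hproj _).isSelfAdjoint.star_eq, (hproj _).isSelfAdjoint.star_eq,
      (hproj _).isSelfAdjoint.star_eq] at this
    rw [this]
    congr 2
    exact Set.inter_comm _ _
  intro Y Z W hW
  rw [h Y Y.2 Z Z.2]
  congr 1
  exact Subtype.ext hW.symm

/-- Conjugation by V_α is multiplicative on the commuting projections P_Y, because V_α* V_α =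
P_{s(α)C} is one of them and is absorbed by V_α. It therefore respects the formula in (L6). -/
theorem L5_of_L5_ideals (hB : LiBase V P) (h4 : L4 P) (h6 : L6 P)
    (h5 : ∀ (α : Mor C) {Y : Set (Mor C)} (hY : Y ∈ constructibleIdeals C),
      V α * P ⟨Y, mem_constructibleUnions hY⟩ * star (V α) =
        P ⟨(tau α).image Y,
          mem_constructibleUnions (image_tau_mem_constructibleIdeals α hY)⟩) : L5 V P := by
  have h : ∀ (α : Mor C) (U : Set (Mor C)) (hU : U ∈ constructibleUnions C),
      V α * P ⟨U, hU⟩ * star (V α) =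
        P ⟨(tau α).image U, image_tau_mem_constructibleUnions α hU⟩ := by
    intro α U hU
    refine constructibleUnions_induction (p := fun U hU => V α * P ⟨U, hU⟩ * star (V α) =
      P ⟨(tau α).image U, image_tau_mem_constructibleUnions α hU⟩) (fun Y hY => h5 α hY) ?_ hU
    intro Y hY Z hZ h2
    have hY' := mem_constructibleUnions hY
    have h1 := h5 α hY
    have hYZ := union_mem_constructibleUnions hY' hZ
    have hs := mem_constructibleUnions (vertexIdeal_mem α.left)
    have h3 : star (V α) * V α = P ⟨_, hs⟩ := hB.L1 α _ rfl
    have h7 : V α * P ⟨_, hs⟩ = V α := by rw [← h3, ← mul_assoc, hB.partialIsometry]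
    have h8 : P ⟨Y, hY'⟩ * P ⟨_, hs⟩ = P ⟨_, hs⟩ * P ⟨Y, hY'⟩ := by
      rw [h4 ⟨Y, hY'⟩ ⟨_, hs⟩ ⟨_, inter_mem_constructibleUnions hY' hs⟩ rfl,
        h4 ⟨_, hs⟩ ⟨Y, hY'⟩ ⟨_, inter_mem_constructibleUnions hY' hs⟩ (Set.inter_comm _ _)]
    rw [h6 ⟨Y, hY'⟩ ⟨Z, hZ⟩ ⟨Y ∪ Z, hYZ⟩ rfl, h6 ⟨_, image_tau_mem_constructibleUnions α hY'⟩
      ⟨_, image_tau_mem_constructibleUnions α hZ⟩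
      ⟨_, image_tau_mem_constructibleUnions α hYZ⟩ (SymInv.image_union _ _ _), ← h1, ← h2,
      mul_sub, mul_add, sub_mul, add_mul]
    congr 1
    calc V α * (P ⟨Y, hY'⟩ * P ⟨Z, hZ⟩) * star (V α)
        = V α * P ⟨_, hs⟩ * (P ⟨Y, hY'⟩ * P ⟨Z, hZ⟩) * star (V α) := by rw [h7]
      _ = V α * (P ⟨_, hs⟩ * P ⟨Y, hY'⟩) * P ⟨Z, hZ⟩ * star (V α) := by simp only [mul_assoc]
      _ = V α * P ⟨Y, hY'⟩ * star (V α) * (V α * P ⟨Z, hZ⟩ * star (V α)) := by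
        rw [← h8, ← h3]; simp only [mul_assoc]
  intro α Y W hW
  rw [h α Y Y.2]
  congr 1
  exact Subtype.ext hW.symm

theorem L4_of_relLiSUnion (hB : LiBase V P) (h6 : L6 P) (h7 : L7 V P) : L4 P :=
  L4_of_L4_ideals hB.projection h6 fun hY hZ =>
    L4_of_L7 (fun _ => mem_constructibleUnions) hB h7 hY hZ

theorem L5_of_relLiSUnion (hB : LiBase V P) (h6 : L6 P) (h7 : L7 V P) : L5 V P :=
  L5_of_L5_ideals hB (L4_of_relLiSUnion hB h6 h7) h6 fun α _ hY =>
    L5_of_L7 (fun _ => mem_constructibleUnions) hB h7 α hY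

/-! ## Join-preserving representations -/

/-- Iterating (L6) identifies the projection of any finite union with the join; (L3) covers the
empty list. -/
theorem projJoin_eq_of_L6 (hB : LiBase V P) (h6 : L6 P) (l : List (constructibleUnions C))
    (U : constructibleUnions C) (hU : (U : Set (Mor C)) = ⋃ Y ∈ l, (Y : Set (Mor C))) :
    projJoin (l.map P) = P U := by
  induction l generalizing U with
  | nil => exact (hB.L3 U (by simpa using hU)).symm
  | cons Y l ih =>
    have hl : (⋃ Z ∈ l, (Z : Set (Mor C))) ∈ constructibleUnions C := by
      clear ih hU
      induction l with
      | nil => simpa using empty_mem_constructibleUnions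
      | cons Y l ih =>
        simpa [Set.iUnion_or, Set.iUnion_union_distrib] using union_mem_constructibleUnions Y.2 ih
    rw [List.map_cons, projJoin_cons, ih ⟨_, hl⟩ rfl]
    exact (h6 Y ⟨_, hl⟩ U (by simpa [Set.iUnion_or, Set.iUnion_union_distrib] using hU)).symm

theorem isFinitelyJoinPreservingRep_wordRep (hB : LiBase V P) (h6 : L6 P) (h7 : L7 V P) :
    IsFinitelyJoinPreservingRep (wordRep V : ZM C → B) where
  rep := isInvSemigroupRep_wordRep (fun _ => mem_constructibleUnions) hB h7
  join ζ l hl := by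
    have key : ∀ {w v : C} (ξ : ZigzagTuple C w v), wordRep V ξ.idem = P (toUnions ξ.ideal) :=
      fun ξ => by
        rw [← idZM_ideal, wordRep_idZM (fun _ => mem_constructibleUnions) hB h7]
        rfl
    simp only [key]
    rw [← projJoin_eq_of_L6 hB h6 (l.map fun ξ => toUnions ξ.2.2.ideal) (toUnions ζ.ideal),
      List.map_map]
    · rfl
    · rw [biUnion_list_map]
      exact hl

namespace IsFinitelyJoinPreservingRep

variable {π : ZM C → B}

/-- The join condition speaks of the sets A(ζ) only. The possibly missing ideal ∅ is harmless since
π(0) = 0. -/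
theorem idZM_eq_projJoin (h : IsFinitelyJoinPreservingRep π) (Y : constructibleIdeals C)
    (l : List (constructibleIdeals C)) (hl : (Y : Set (Mor C)) = ⋃ Z ∈ l, (Z : Set (Mor C))) :
    π (idZM Y) = projJoin (l.map fun Z => π (idZM Z)) := by
  have hzero : ∀ Z : constructibleIdeals C, (Z : Set (Mor C)) = ∅ → π (idZM Z) = 0 := fun Z hZ => by
    rw [idZM_of_eq_empty hZ, h.rep.map_zero]
  -- Deleting the empty ideals from a list, which contribute π(0) = 0, leaves a list of sets A(ξ).
  have key : ∀ l : List (constructibleIdeals C),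
      ∃ l' : List ((a : C) × (b : C) × ZigzagTuple C a b),
        (⋃ Z ∈ l, (Z : Set (Mor C))) = ⋃ ξ ∈ l', ξ.2.2.A ∧
        projJoin (l.map fun Z => π (idZM Z)) = projJoin (l'.map fun ξ => π ξ.2.2.idem) := by
    intro l
    induction l with
    | nil => exact ⟨[], by simp, rfl⟩
    | cons Z l ih =>
      obtain ⟨l', h1, h2⟩ := ih
      obtain ⟨Z, rfl | ⟨w, v, ξ, rfl⟩⟩ := Z
      · refine ⟨l', by simpa using h1, ?_⟩
        rw [List.map_cons, projJoin_cons, hzero _ rfl, h2]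
        simp
      · refine ⟨⟨w, v, ξ⟩ :: l', ?_, ?_⟩
        · simp [Set.iUnion_or, Set.iUnion_union_distrib, h1]
        · rw [List.map_cons, List.map_cons, projJoin_cons, projJoin_cons, h2, ← idZM_ideal]
          rfl
  obtain ⟨l', h1, h2⟩ := key l
  obtain ⟨Y, hY | ⟨w, v, ζ, rfl⟩⟩ := Y
  · rw [hzero _ hY, projJoin_eq_zero]
    intro p hp
    obtain ⟨Z, hZ, rfl⟩ := List.mem_map.1 hp
    refine hzero Z (Set.subset_empty_iff.1 ?_)
    rw [← hY, show Y = _ from hl]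
    exact Set.subset_biUnion_of_mem (u := fun Z : constructibleIdeals C => (Z : Set (Mor C))) hZ
  · rw [h2, ← h.join ζ l' (hl.trans h1), ← idZM_ideal]
    rfl

theorem commute_idZM (h : IsFinitelyJoinPreservingRep π) (Y Z : constructibleIdeals C) :
    Commute (π (idZM Y)) (π (idZM Z)) := by
  have hW := inter_mem_constructibleIdeals Y.2 Z.2
  rw [Commute, SemiconjBy, h.rep.idZM_mul Y Z ⟨_, hW⟩ rfl,
    h.rep.idZM_mul Z Y ⟨_, hW⟩ (Set.inter_comm _ _)]

theorem star_projJoin (h : IsFinitelyJoinPreservingRep π) (l : List (constructibleIdeals C)) :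
    star (projJoin (l.map fun Z => π (idZM Z))) = projJoin (l.map fun Z => π (idZM Z)) := by
  refine _root_.star_projJoin ?_ ?_
  · intro p hp
    obtain ⟨Z, -, rfl⟩ := List.mem_map.1 hp
    exact (h.rep.isStarProjection_idZM Z).isSelfAdjoint.star_eq
  · intro p hp q hq
    obtain ⟨Z, -, rfl⟩ := List.mem_map.1 hp
    obtain ⟨Z', -, rfl⟩ := List.mem_map.1 hq
    exact h.commute_idZM Z Z'

/-- Each Y in `l` is the union of the Y ∩ Z with Z in `l'`. Join-preservation and distributivity
therefore show that π(id_Y) lies below the join over `l'`. -/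
theorem projJoin_mul_projJoin (h : IsFinitelyJoinPreservingRep π)
    (l l' : List (constructibleIdeals C))
    (hl : (⋃ Z ∈ l, (Z : Set (Mor C))) ⊆ ⋃ Z ∈ l', (Z : Set (Mor C))) :
    projJoin (l.map fun Z => π (idZM Z)) * projJoin (l'.map fun Z => π (idZM Z)) =
      projJoin (l.map fun Z => π (idZM Z)) := by
  refine projJoin_mul_eq_self fun p hp => ?_
  obtain ⟨Y, hY, rfl⟩ := List.mem_map.1 hp
  rw [mul_projJoin (h.rep.isStarProjection_idZM Y).isIdempotentElem.eq, List.map_map]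
  · have h1 := h.idZM_eq_projJoin Y (l'.map fun Z : constructibleIdeals C =>
      (⟨Y ∩ Z, inter_mem_constructibleIdeals Y.2 Z.2⟩ : constructibleIdeals C)) ?_
    · refine Eq.trans ?_ h1.symm
      rw [List.map_map]
      congr 1
      refine List.map_congr_left fun Z _ => ?_
      exact h.rep.idZM_mul Y Z ⟨_, inter_mem_constructibleIdeals Y.2 Z.2⟩ rfl
    · have : (Y : Set (Mor C)) ⊆ ⋃ Z ∈ l', (Z : Set (Mor C)) :=
        (Set.subset_biUnion_of_mem (u := fun Z : constructibleIdeals C => (Z : Set (Mor C)))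
          hY).trans hl
      rw [biUnion_list_map]
      change (Y : Set (Mor C)) = ⋃ Z ∈ l', (Y : Set (Mor C)) ∩ Z
      rw [← Set.inter_iUnion₂, Set.inter_eq_left.2 this]
  · intro q hq
    obtain ⟨Z, -, rfl⟩ := List.mem_map.1 hq
    exact h.commute_idZM Y Z

/-- The two joins absorb each other and are self-adjoint, hence equal. This makes the projection of
a finite union independent of how it is written. -/
theorem projJoin_congr (h : IsFinitelyJoinPreservingRep π) (l l' : List (constructibleIdeals C))
    (hl : (⋃ Z ∈ l, (Z : Set (Mor C))) = ⋃ Z ∈ l', (Z : Set (Mor C))) :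
    projJoin (l.map fun Z => π (idZM Z)) = projJoin (l'.map fun Z => π (idZM Z)) := by
  have h1 := h.projJoin_mul_projJoin l l' hl.subset
  have h2 := h.projJoin_mul_projJoin l' l hl.symm.subset
  have h3 := congrArg star h1
  rw [star_mul, h.star_projJoin, h.star_projJoin, h2] at h3
  exact h3.symm

end IsFinitelyJoinPreservingRep

/-- The projection of a finite union of constructible right ideals, for a finitely join-preserving
representation. -/
noncomputable def joinProj (π : ZM C → B) (U : constructibleUnions C) : B :=
  projJoin ((exists_list_of_mem_constructibleUnions U.2).choose.map fun Z => π (idZM Z))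

namespace IsFinitelyJoinPreservingRep

variable {π : ZM C → B}

theorem joinProj_eq (h : IsFinitelyJoinPreservingRep π) (U : constructibleUnions C)
    (l : List (constructibleIdeals C)) (hl : (U : Set (Mor C)) = ⋃ Z ∈ l, (Z : Set (Mor C))) :
    joinProj π U = projJoin (l.map fun Z => π (idZM Z)) :=
  h.projJoin_congr _ _
    ((exists_list_of_mem_constructibleUnions U.2).choose_spec.symm.trans hl)

theorem joinProj_ideal (h : IsFinitelyJoinPreservingRep π) (Y : constructibleIdeals C)
    (U : constructibleUnions C) (hU : (U : Set (Mor C)) = Y) : joinProj π U = π (idZM Y) := by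
  rw [h.joinProj_eq U [Y] (by simpa using hU)]
  simp [projJoin]

theorem isStarProjection_joinProj (h : IsFinitelyJoinPreservingRep π)
    (U : constructibleUnions C) : IsStarProjection (joinProj π U) :=
  ⟨h.projJoin_mul_projJoin _ _ subset_rfl, h.star_projJoin _⟩

theorem L6 (h : IsFinitelyJoinPreservingRep π) : L6 (joinProj π) := fun Y Z W hW => by
  obtain ⟨l, hl⟩ := exists_list_of_mem_constructibleUnions Y.2
  obtain ⟨l', hl'⟩ := exists_list_of_mem_constructibleUnions Z.2
  rw [h.joinProj_eq Y l hl, h.joinProj_eq Z l' hl', h.joinProj_eq W (l ++ l'), List.map_append,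
    projJoin_append]
  rw [hW, hl, hl']
  simp [Set.iUnion_or, Set.iUnion_union_distrib]

end IsFinitelyJoinPreservingRep

end

/-! ## `C*^(∪)_{Li,s}(C)` and the Toeplitz algebra -/

section

variable {C : Type u} [SmallCategory C] [LeftCancellative C]

theorem relLiSUnion_of_rep {B : Type u} [NonUnitalCStarAlgebra B] {π : ZM C → B}
    (h : IsFinitelyJoinPreservingRep π) :
    (relLiSUnion (constructibleUnions C)).Holds
      (Sum.elim (fun α => π (tauZM α)) (joinProj π)) :=
  ⟨h.rep.liBase h.isStarProjection_joinProj h.joinProj_ideal, h.L6, h.rep.L7 h.joinProj_ideal⟩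

/-- The argument for `exists_equiv_CLiS_CZM`, with the projections of unions supplied by joins. -/
theorem exists_equiv_CLiSUnion_Toeplitz : ∃ μ : CLiSUnion C ≃⋆ₐ[ℂ] Toeplitz C,
    (∀ α, μ (genV _ α) = UnivCStar.gen _ (tauZM α)) ∧
    ∀ Y, μ (genP _ (toUnions Y)) = UnivCStar.gen _ (idZM Y) := by
  have hS := gen_holds_CLiSUnion (C := C)
  have hJ : constructibleIdeals C ⊆ constructibleUnions C := fun _ => mem_constructibleUnions
  have hB : LiBase (genV (relLiSUnion (constructibleUnions C))) (genP _) := hS.1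
  have h6 : L6 (genP (relLiSUnion (constructibleUnions C))) := hS.2.1
  have h7 : L7 (genV (relLiSUnion (constructibleUnions C))) (genP _) := hS.2.2
  have hT := gen_isFinitelyJoinPreservingRep (C := C)
  let f : CLiSUnion C →⋆ₙₐ[ℂ] Toeplitz C := UnivCStar.lift (relLiSUnion_of_rep hT)
  let k : Toeplitz C →⋆ₙₐ[ℂ] CLiSUnion C :=
    UnivCStar.lift (f := wordRep (genV _)) (isFinitelyJoinPreservingRep_wordRep hB h6 h7)
  have hfV : ∀ α, f (genV _ α) = UnivCStar.gen _ (tauZM α) := fun α => UnivCStar.lift_gen _ _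
  have hfP : ∀ Y, f (genP _ Y) = joinProj (UnivCStar.gen _) Y := fun Y => UnivCStar.lift_gen _ _
  have hk : ∀ s, k (UnivCStar.gen _ s) = wordRep (genV _) s := fun s => UnivCStar.lift_gen _ _
  refine ⟨starEquivOfInverse f k (UnivCStar.hom_ext ?_) (UnivCStar.hom_ext ?_), hfV,
    fun Y => (hfP _).trans (hT.joinProj_ideal Y _ rfl)⟩
  · rintro (α | U)
    · exact (congrArg k (hfV α)).trans ((hk _).trans (wordRep_tauZM hJ hB h7 α))
    · refine (congrArg k (hfP U)).trans ?_
      -- For a union U there need be no element id_U in `ZM C`, so both sides are compared as joins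
      -- over a list of ideals with union U.
      obtain ⟨l, hl⟩ := exists_list_of_mem_constructibleUnions U.2
      rw [hT.joinProj_eq U l hl, map_projJoin, List.map_map]
      have h1 : (k ∘ fun Z => UnivCStar.gen _ (idZM Z)) = genP _ ∘ (toUnions (C := C)) :=
        funext fun Z => (hk _).trans (wordRep_idZM hJ hB h7 Z)
      rw [h1, ← List.map_map]
      exact projJoin_eq_of_L6 hB h6 _ U (by rw [biUnion_list_map]; exact hl)
  · intro s
    refine (congrArg f (hk s)).trans ?_
    rcases eq_zero_or_exists_zm s with rfl | ⟨w, v, ζ, rfl⟩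
    · rw [wordRep_zero, map_zero]
      exact hT.rep.map_zero.symm
    · rw [wordRep_zm hJ hB h7, map_word]
      have : (f ∘ genV (relLiSUnion (constructibleUnions C))) =
        fun α => UnivCStar.gen _ (tauZM α) := funext hfV
      rw [this]
      exact hT.rep.word ζ

end

/-! ## Finitely aligned categories -/

section FinitelyAligned

variable {C : Type u} [SmallCategory C] [LeftCancellative C]

/-- A finite union of principal right ideals. -/
def IsFiniteUnionOfPrincipal (Y : Set (Mor C)) : Prop :=
  ∃ F : Set (Mor C), F.Finite ∧ Y = ⋃ γ ∈ F, principalIdeal γ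

theorem IsFiniteUnionOfPrincipal.biUnion {ι : Type*} {s : Set ι} (hs : s.Finite)
    {Y : ι → Set (Mor C)} (h : ∀ i ∈ s, IsFiniteUnionOfPrincipal (Y i)) :
    IsFiniteUnionOfPrincipal (⋃ i ∈ s, Y i) := by
  choose! F hF hY using h
  refine ⟨⋃ i ∈ s, F i, hs.biUnion hF, ?_⟩
  rw [Set.biUnion_iUnion]
  simp only [Set.biUnion_iUnion]
  exact Set.iUnion₂_congr fun i hi => hY i hi

theorem image_iUnion₂ {X ι : Type*} (φ : SymInv X) (s : Set ι) (Y : ι → Set X) :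
    φ.image (⋃ i ∈ s, Y i) = ⋃ i ∈ s, φ.image (Y i) := by
  ext z
  simp only [SymInv.image, Set.mem_iUnion, Set.mem_ofPred_eq]
  constructor
  · rintro ⟨y, ⟨i, hi, hy⟩, h⟩; exact ⟨i, hi, y, hy, h⟩
  · rintro ⟨i, hi, y, hy, h⟩; exact ⟨y, ⟨i, hi, hy⟩, h⟩

theorem image_tau_principalIdeal {α β γ : Mor C} (h : (tau α).app β = some γ) :
    (tau α).image (principalIdeal β) = principalIdeal γ := by
  obtain ⟨y, x, α⟩ := α
  obtain ⟨z, δ, rfl, rfl⟩ := tau_app_iff.1 h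
  rw [← image_tau_vertexIdeal, ← image_tau_vertexIdeal, ← SymInv.image_mul, tau_mul_tau]

theorem image_tau_principalIdeal_of_ne {α β : Mor C} (h : α.left ≠ β.right) :
    (tau α).image (principalIdeal β) = ∅ := by
  rw [← image_tau_vertexIdeal, ← SymInv.image_mul, tau_mul_tau_of_ne h]
  ext z
  simp [SymInv.image, SymInv.zero_app]

theorem mem_principalIdeal_self (γ : Mor C) : γ ∈ principalIdeal γ := by
  obtain ⟨y, x, γ⟩ := γ
  exact ⟨mor (𝟙 y), by rw [Mor.comp?_mor, Category.id_comp]⟩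

theorem IsFiniteUnionOfPrincipal.image_tau (α : Mor C) {Y : Set (Mor C)}
    (h : IsFiniteUnionOfPrincipal Y) : IsFiniteUnionOfPrincipal ((tau α).image Y) := by
  obtain ⟨F, hF, rfl⟩ := h
  rw [image_iUnion₂]
  refine .biUnion hF fun γ _ => ?_
  by_cases hγ : γ.right = α.left
  · obtain ⟨δ, hδ⟩ : γ ∈ (tau α).dom := by rwa [dom_tau]
    exact ⟨{δ}, Set.finite_singleton _, by simp [image_tau_principalIdeal hδ]⟩
  · exact ⟨∅, Set.finite_empty, by simp [image_tau_principalIdeal_of_ne (Ne.symm hγ)]⟩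

theorem sigma_image_eq (α : Mor C) (Y : Set (Mor C)) :
    (sigma α).image Y = (sigma α).image (principalIdeal α ∩ Y) := by
  ext z
  simp only [SymInv.image, sigma, SymInv.inv_app, Set.mem_inter_iff, Set.mem_ofPred_eq]
  constructor
  · rintro ⟨y, hy, h⟩; exact ⟨y, ⟨⟨z, h⟩, hy⟩, h⟩
  · rintro ⟨y, ⟨-, hy⟩, h⟩; exact ⟨y, hy, h⟩

theorem sigma_image_tau_image {α : Mor C} {Y : Set (Mor C)} (hY : Y ⊆ vertexIdeal α.left) :
    (sigma α).image ((tau α).image Y) = Y := by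
  rw [← SymInv.image_mul, sigma, SymInv.inv_mul_self, dom_tau]
  ext z
  simp only [SymInv.image, SymInv.idOn_app, Set.mem_ofPred_eq]
  constructor
  · rintro ⟨y, hy, rfl, -⟩; exact hy
  · intro hz; exact ⟨z, hz, rfl, hY hz⟩

theorem principalIdeal_subset (γ : Mor C) : principalIdeal γ ⊆ vertexIdeal γ.right := by
  rintro δ ⟨β, h⟩
  exact (Mor.right_of_comp? h).1

/-- Finite alignment enters here: σ_α(γC) = σ_α(αC ∩ γC), the intersection is a finite union of sets
δC with δ = αε, and σ_α(αεC) = εC. -/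
theorem IsFiniteUnionOfPrincipal.image_sigma (hC : FinitelyAligned C) (α : Mor C)
    {Y : Set (Mor C)} (h : IsFiniteUnionOfPrincipal Y) :
    IsFiniteUnionOfPrincipal ((sigma α).image Y) := by
  obtain ⟨F, hF, rfl⟩ := h
  rw [image_iUnion₂]
  refine .biUnion hF fun γ _ => ?_
  obtain ⟨G, hG, hαγ⟩ := hC α γ
  rw [sigma_image_eq, hαγ, image_iUnion₂]
  refine .biUnion hG fun δ hδ => ?_
  have hmem : δ ∈ principalIdeal α ∩ principalIdeal γ := by
    rw [hαγ]
    exact Set.mem_biUnion hδ (mem_principalIdeal_self δ)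
  obtain ⟨ε, hε⟩ := hmem.1
  have hε : (tau α).app ε = some δ := hε
  refine ⟨{ε}, Set.finite_singleton _, ?_⟩
  rw [← image_tau_principalIdeal hε, sigma_image_tau_image]
  · simp
  · rw [← (tau_app_left hε).1]
    exact principalIdeal_subset ε

theorem isFiniteUnionOfPrincipal_vertexIdeal (v : C) :
    IsFiniteUnionOfPrincipal (vertexIdeal v) := by
  refine ⟨{mor (𝟙 v)}, Set.finite_singleton _, ?_⟩
  have := image_tau_vertexIdeal (mor (𝟙 v))
  rw [tau_id] at this
  simp only [Set.mem_singleton_iff, Set.iUnion_iUnion_eq_left, ← this]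
  ext z
  simp only [SymInv.image, SymInv.idOn_app, Set.mem_ofPred_eq]
  constructor
  · intro hz; exact ⟨z, hz, rfl, hz⟩
  · rintro ⟨y, hy, rfl, -⟩; exact hy

theorem isFiniteUnionOfPrincipal_pull (hC : FinitelyAligned C) {w v : C} (ζ : ZigzagTuple C w v)
    {Y : Set (Mor C)} (h : IsFiniteUnionOfPrincipal Y) : IsFiniteUnionOfPrincipal (ζ.pull Y) := by
  induction ζ generalizing Y with
  | single α β => exact (h.image_tau _).image_sigma hC _
  | cons α β ζ ih => exact ih ((h.image_tau _).image_sigma hC _)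

/-- The set of all morphisms need be neither a constructible ideal nor a finite union of principal
ones. Starting from wC instead repairs both. -/
theorem ZigzagTuple.A_eq_pull_vertexIdeal {w v : C} (ζ : ZigzagTuple C w v) :
    ζ.A = ζ.pull (vertexIdeal w) := by
  rw [A, pull_eq_image, pull_eq_image]
  ext β
  simp only [SymInv.image, SymInv.inv_app, Set.mem_univ, true_and, Set.mem_ofPred_eq]
  constructor
  · rintro ⟨γ, h⟩; exact ⟨γ, (ζ.phi_app_right h).2, h⟩
  · rintro ⟨γ, -, h⟩; exact ⟨γ, h⟩

/-! ### Words under (L4)–(L6). -/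

variable {B : Type v} [NonUnitalCStarAlgebra B] {𝒥 : Set (Set (Mor C))}
  {V : Mor C → B} {P : 𝒥 → B}

theorem tau_image_sigma_image (α : Mor C) (Y : Set (Mor C)) :
    (tau α).image ((sigma α).image Y) = principalIdeal α ∩ Y := by
  rw [sigma, SymInv.inv_image_univ_inter]
  congr 1
  ext z
  simp [SymInv.image, principalIdeal, SymInv.app, tau, SymInv.ofInj]

/-- The companion of (L5) for the shifts `σ_α`. -/
theorem star_mul_mul_of_L5 (h𝒥 : constructibleIdeals C ⊆ 𝒥) (hB : LiBase V P) (h4 : L4 P)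
    (h5 : L5 V P) (α : Mor C) {Y : Set (Mor C)} (hY : Y ∈ constructibleIdeals C) :
    star (V α) * P ⟨Y, h𝒥 hY⟩ * V α =
      P ⟨(sigma α).image Y, h𝒥 (image_mem_constructibleIdeals (sigma_mem_ZM α) hY)⟩ := by
  set Z : 𝒥 := ⟨(sigma α).image Y, h𝒥 (image_mem_constructibleIdeals (sigma_mem_ZM α) hY)⟩ with hZ
  set S : 𝒥 := ⟨vertexIdeal α.left, h𝒥 (vertexIdeal_mem _)⟩ with hS
  set R : 𝒥 := ⟨principalIdeal α, h𝒥 (principalIdeal_mem _)⟩ with hR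
  set W : 𝒥 := ⟨principalIdeal α ∩ Y, h𝒥 (inter_mem_constructibleIdeals (principalIdeal_mem _) hY)⟩
    with hW
  have h1 : star (V α) * V α = P S := hB.L1 α S rfl
  have h2 : V α * P S = V α := by rw [← h1, ← mul_assoc, hB.partialIsometry]
  have h3 : V α * P Z * star (V α) = P W := h5 α Z W (tau_image_sigma_image α Y).symm
  have h6 : V α * star (V α) = P R := by
    have := h5 α S R (image_tau_vertexIdeal α).symm
    rwa [h2] at this
  have h7 : P R * P ⟨Y, h𝒥 hY⟩ = P W := h4 R _ W rfl
  have hsub : (sigma α).image Y ⊆ vertexIdeal α.left := by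
    rintro β ⟨γ, -, h⟩
    exact (tau_app_left (SymInv.inv_app.1 h)).1
  have h8 : P S * P Z = P Z := h4 S Z Z (Set.inter_eq_right.2 hsub).symm
  have h9 : P Z * P S = P Z := h4 Z S Z (Set.inter_eq_left.2 hsub).symm
  -- With Z = σ_α(Y): inserting V_α V_α* = P_{αC} next to P_Y produces P_{αC ∩ Y} = V_α P_Z V_α*,
  -- and the remaining factors V_α* V_α = P_{s(α)C} are absorbed by P_Z.
  calc star (V α) * P ⟨Y, h𝒥 hY⟩ * V α
      = star (V α) * (V α * star (V α)) * P ⟨Y, h𝒥 hY⟩ * V α := by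
        rw [← mul_assoc (star (V α)), h1]
        have := congrArg star h2
        rw [star_mul, (hB.projection S).isSelfAdjoint.star_eq] at this
        rw [this]
    _ = star (V α) * (P R * P ⟨Y, h𝒥 hY⟩) * V α := by rw [h6]; simp only [mul_assoc]
    _ = star (V α) * V α * P Z * (star (V α) * V α) := by rw [h7, ← h3]; simp only [mul_assoc]
    _ = P Z := by rw [h1, h8, h9]

/-- Letter by letter, (L5) handles each τ_α and its companion `star_mul_mul_of_L5` each σ_β. -/
theorem star_word_mul_mul_word (h𝒥 : constructibleIdeals C ⊆ 𝒥) (hB : LiBase V P) (h4 : L4 P)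
    (h5 : L5 V P) {w v : C} (ζ : ZigzagTuple C w v) {Y : Set (Mor C)}
    (hY : Y ∈ constructibleIdeals C) (W : 𝒥) (hW : (W : Set (Mor C)) = ζ.pull Y) :
    star (ζ.word V) * P ⟨Y, h𝒥 hY⟩ * ζ.word V = P W := by
  have key : ∀ {w y x : C} (α : w ⟶ x) (β : y ⟶ x) {Y : Set (Mor C)}
      (hY : Y ∈ constructibleIdeals C),
      ∃ hZ : (sigma (mor β)).image ((tau (mor α)).image Y) ∈ constructibleIdeals C,
      star (star (V (mor α)) * V (mor β)) * P ⟨Y, h𝒥 hY⟩ * (star (V (mor α)) * V (mor β)) =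
        P ⟨_, h𝒥 hZ⟩ := by
    intro w y x α β Y hY
    have hY' := image_tau_mem_constructibleIdeals (mor α) hY
    refine ⟨image_mem_constructibleIdeals (sigma_mem_ZM _) hY', ?_⟩
    rw [← star_mul_mul_of_L5 h𝒥 hB h4 h5 (mor β) hY', ← h5 (mor α) ⟨Y, h𝒥 hY⟩ ⟨_, h𝒥 hY'⟩ rfl,
      star_mul, star_star]
    simp only [mul_assoc]
  induction ζ generalizing Y W with
  | single α β =>
    obtain ⟨hZ, h⟩ := key α β hY
    refine h.trans ?_
    congr 1
    exact Subtype.ext hW.symm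
  | cons α β ζ ih =>
    obtain ⟨hZ, h⟩ := key α β hY
    rw [← ih hZ W hW, ← h, ZigzagTuple.word, star_mul (star (V (mor α)) * V (mor β))]
    simp only [mul_assoc]

theorem star_mul_of_tau_app (hB : LiBase V P) (h𝒥 : constructibleIdeals C ⊆ 𝒥)
    {α γ δ : Mor C} (h : (tau α).app δ = some γ) : star (V α) * V γ = V δ := by
  obtain ⟨y, x, α⟩ := α
  obtain ⟨z, δ, rfl, rfl⟩ := tau_app_iff.1 h
  rw [← hB.L2_comp, ← mul_assoc, hB.star_mul_self h𝒥]
  exact hB.id_mul (mor δ)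

/-- A word acts on the V_γ from the left as the zigzag map acts on γ: V_β V_γ = V_{βγ}, and V_α*
cancels a left factor α. -/
theorem word_mul_of_phi_app (h𝒥 : constructibleIdeals C ⊆ 𝒥) (hB : LiBase V P) {w v : C}
    (ζ : ZigzagTuple C w v) {γ δ : Mor C} (h : ζ.phi.app γ = some δ) :
    ζ.word V * V γ = V δ := by
  have key : ∀ {w y x : C} (α : w ⟶ x) (β : y ⟶ x) {γ δ : Mor C},
      (sigma (mor α) * tau (mor β)).app γ = some δ → star (V (mor α)) * V (mor β) * V γ = V δ := by
    intro w y x α β γ δ h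
    obtain ⟨ε, h1, h2⟩ := SymInv.mul_app.1 h
    obtain ⟨z, η, rfl, rfl⟩ := tau_app_iff.1 h1
    rw [mul_assoc, hB.L2_comp]
    exact star_mul_of_tau_app hB h𝒥 (SymInv.inv_app.1 h2)
  induction ζ generalizing δ with
  | single α β => exact key α β h
  | cons α β ζ ih =>
    obtain ⟨ε, h1, h2⟩ := SymInv.mul_app.1 h
    rw [ZigzagTuple.word, mul_assoc, ih h1, key α β h2]

/-- Two evaluations of word · P_A are compared. It is the word since word* · word = P_A. It is P_A
since the word fixes each V_γ with γ in A, hence each P_{γC} = V_γ V_γ*, and by (L6) P_A is a join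
of finitely many of these. -/
theorem L7_of_finitelyAligned (hC : FinitelyAligned C) {P : constructibleUnions C → B}
    (hB : LiBase V P) (h4 : L4 P) (h5 : L5 V P) (h6 : L6 P) : L7 V P := by
  intro w v ζ Y hζ hY
  have hJ : constructibleIdeals C ⊆ constructibleUnions C := fun _ => mem_constructibleUnions
  obtain ⟨F, hF, hFA⟩ := isFiniteUnionOfPrincipal_pull hC ζ (isFiniteUnionOfPrincipal_vertexIdeal w)
  rw [← ZigzagTuple.A_eq_pull_vertexIdeal] at hFA
  -- V at the identity of w is P_{wC} and is also a left unit for the word, so conjugating P_{wC} by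
  -- the word gives word* · word.
  have hw : star (ζ.word V) * ζ.word V = P Y := by
    have h1 := star_word_mul_mul_word hJ hB h4 h5 ζ (vertexIdeal_mem w) Y
      (hY.trans ζ.A_eq_pull_vertexIdeal)
    rw [← h1, ← hB.id_eq (v := w) ⟨_, hJ (vertexIdeal_mem w)⟩ rfl, mul_assoc]
    congr 1
    cases ζ with
    | single α β =>
      have := congrArg star (hB.mul_id (mor α))
      rw [star_mul, hB.star_id] at this
      rw [ZigzagTuple.word, ← mul_assoc, this]
    | cons α β ζ =>
      have := congrArg star (hB.mul_id (mor α))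
      rw [star_mul, hB.star_id] at this
      rw [ZigzagTuple.word, ← mul_assoc, ← mul_assoc, this]
  have h1 : ζ.word V * P Y = ζ.word V := by
    have hp := (hB.projection Y)
    refine sub_eq_zero.1 ((CStarRing.star_mul_self_eq_zero_iff _).1 ?_)
    rw [star_sub, star_mul, hp.isSelfAdjoint.star_eq, sub_mul, mul_sub, mul_sub,
      mul_assoc (P Y), ← mul_assoc (star (ζ.word V)) (ζ.word V), hw, mul_assoc (P Y), hw,
      hp.isIdempotentElem.eq, hp.isIdempotentElem.eq]
    abel
  have h2 : ∀ γ ∈ F, ζ.word V * P ⟨_, hJ (principalIdeal_mem γ)⟩ =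
      P ⟨_, hJ (principalIdeal_mem γ)⟩ := by
    intro γ hγ
    have hγA : γ ∈ ζ.A := by
      rw [hFA]
      exact Set.mem_biUnion hγ (mem_principalIdeal_self γ)
    have h3 : ζ.phi.app γ = some γ := by
      rw [hζ]
      exact SymInv.idOn_app.2 ⟨rfl, hγA⟩
    have h4 := h5 γ ⟨_, hJ (vertexIdeal_mem γ.left)⟩ ⟨_, hJ (principalIdeal_mem γ)⟩
      (image_tau_vertexIdeal γ).symm
    rw [← h4, ← mul_assoc, ← mul_assoc, word_mul_of_phi_app hJ hB ζ h3]
  have h3 : ζ.word V * P Y = P Y := by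
    rw [← projJoin_eq_of_L6 hB h6
      (hF.toFinset.toList.map fun γ => ⟨_, hJ (principalIdeal_mem γ)⟩) Y]
    · refine mul_projJoin_eq_self fun p hp => ?_
      simp only [List.mem_map, Finset.mem_toList, Set.Finite.mem_toFinset] at hp
      obtain ⟨_, ⟨γ, hγ, rfl⟩, rfl⟩ := hp
      exact h2 γ hγ
    · rw [hY, hFA]
      simp
  rw [← h1, h3]

theorem exists_equiv_CLiUnion_CLiSUnion (hC : FinitelyAligned C) :
    ∃ ρs : CLiUnion C ≃⋆ₐ[ℂ] CLiSUnion C,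
      (∀ α : Mor C, ρs (genV _ α) = genV _ α) ∧
      (∀ Y : constructibleUnions C, ρs (genP _ Y) = genP _ Y) := by
  have hS := gen_holds_CLiSUnion (C := C)
  have hL := gen_holds_CLiUnion (C := C)
  let f : CLiUnion C →⋆ₙₐ[ℂ] CLiSUnion C := UnivCStar.lift (f := UnivCStar.gen _)
    ⟨hS.1, L4_of_relLiSUnion hS.1 hS.2.1 hS.2.2, L5_of_relLiSUnion hS.1 hS.2.1 hS.2.2, hS.2.1⟩
  let k : CLiSUnion C →⋆ₙₐ[ℂ] CLiUnion C := UnivCStar.lift (f := UnivCStar.gen _)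
    ⟨hL.1, hL.2.2.2, L7_of_finitelyAligned hC hL.1 hL.2.1 hL.2.2.1 hL.2.2.2⟩
  have hf : ∀ x, f (UnivCStar.gen _ x) = UnivCStar.gen _ x := fun x => UnivCStar.lift_gen _ _
  have hk : ∀ x, k (UnivCStar.gen _ x) = UnivCStar.gen _ x := fun x => UnivCStar.lift_gen _ _
  exact ⟨starEquivOfInverse f k
    (UnivCStar.hom_ext fun x => (congrArg k (hf x)).trans (hk x))
    (UnivCStar.hom_ext fun x => (congrArg f (hk x)).trans (hf x)),
    fun α => hf _, fun Y => hf _⟩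

end FinitelyAligned

/-! ## A `2`-graph in which two squares are glued along two paths -/

/-- The vertices of a `2`-graph with two edges from `src` to each of `mid₁` and `mid₂`, and one
edge from each of `mid₁` and `mid₂` to each of `top₁` and `top₂`. -/
inductive DoubleSquare : Type
  | src | mid₁ | mid₂ | top₁ | top₂
  deriving DecidableEq

namespace DoubleSquare

instance : Fintype DoubleSquare := ⟨{src, mid₁, mid₂, top₁, top₂}, fun a => by cases a <;> simp⟩

/-- The coordinates of the degree of any path from `src` to a vertex. -/
def height : DoubleSquare → Fin 2 → ℕ
  | src => ![0, 0]
  | mid₁ => ![0, 1]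
  | mid₂ => ![1, 0]
  | top₁ => ![1, 1]
  | top₂ => ![1, 1]

/-- There is a path from `a` to `b`. -/
def Reaches (a b : DoubleSquare) : Prop := a = b ∨ height a 0 + height a 1 < height b 0 + height b 1

instance : DecidableRel Reaches := fun a b => by unfold Reaches; infer_instance

/-- A label is allowed between `a` and `b`: the label `true` is reserved to the second of two
parallel paths. -/
def Allowed (a b : DoubleSquare) (l : Bool) : Prop := Reaches a b ∧ (l = true → a = src ∧ b ≠ src)

instance (a b : DoubleSquare) (l : Bool) : Decidable (Allowed a b l) := by
  unfold Allowed; infer_instance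

theorem allowed_id : ∀ a, Allowed a a false := by decide

theorem allowed_comp : ∀ {a b c : DoubleSquare} {l m : Bool}, Allowed a b l → Allowed b c m →
    Allowed a c (l || m) := by decide

/-- In a composite at most one factor carries `true`, since it must leave `src` and end elsewhere.
The disjunction thus just passes on the choice between parallel paths, and both squares commute. -/
instance : SmallCategory DoubleSquare where
  Hom a b := {l : Bool // Allowed a b l}
  id a := ⟨false, allowed_id a⟩
  comp f g := ⟨f.1 || g.1, allowed_comp f.2 g.2⟩
  id_comp _ := Subtype.ext (Bool.false_or _)
  comp_id _ := Subtype.ext (Bool.or_false _)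
  assoc _ _ _ := Subtype.ext (Bool.or_assoc _ _ _)

/-- The path from `a` to `b` with label `l`. -/
def path {a b : DoubleSquare} (l : Bool) (h : Allowed a b l) : a ⟶ b := ⟨l, h⟩

/-- The label of a path. -/
def label {a b : DoubleSquare} (f : a ⟶ b) : Bool := f.1

theorem allowed {a b : DoubleSquare} (f : a ⟶ b) : Allowed a b (label f) := f.2

theorem hom_ext {a b : DoubleSquare} {f g : a ⟶ b} (h : label f = label g) : f = g := Subtype.ext h

@[simp] theorem label_path {a b : DoubleSquare} (l : Bool) (h : Allowed a b l) :
    label (path l h) = l := rfl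

@[simp] theorem label_comp {a b c : DoubleSquare} (f : a ⟶ b) (g : b ⟶ c) :
    label (f ≫ g) = (label f || label g) := rfl

@[simp] theorem label_id (a : DoubleSquare) : label (𝟙 a) = false := rfl

theorem label_eq_false {a b : DoubleSquare} (f : a ⟶ b) (h : a ≠ src) : label f = false := by
  by_contra hl
  exact h ((allowed f).2 (by simpa using hl)).1

theorem mor_ext {f g : Mor DoubleSquare} (h1 : f.left = g.left) (h2 : f.right = g.right)
    (h3 : label f.hom = label g.hom) : f = g := by
  obtain ⟨a, b, f⟩ := f
  obtain ⟨a', b', g⟩ := g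
  obtain rfl : a = a' := h1
  obtain rfl : b = b' := h2
  rw [hom_ext (f := f) (g := g) h3]

theorem cancel_labels : ∀ {a b c : DoubleSquare} {l m n : Bool}, Allowed b c l → Allowed a b m →
    Allowed a b n → (m || l) = (n || l) → m = n := by decide

instance : LeftCancellative DoubleSquare where
  left_cancel α β γ h :=
    hom_ext (cancel_labels (allowed α) (allowed β) (allowed γ) (congrArg label h))

theorem finite_mor : Finite (Mor DoubleSquare) :=
  Finite.of_injective
    (fun f : Mor DoubleSquare => ((f.left, f.right, label f.hom) : DoubleSquare × DoubleSquare × Bool))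
    fun f g h => by
      simp only [Prod.mk.injEq] at h
      exact mor_ext h.1 h.2.1 h.2.2

/-- There are finitely many morphisms, so an intersection of right ideals is the finite union of the
principal ideals of its own elements. -/
theorem finitelyAligned : FinitelyAligned DoubleSquare := fun α β => by
  have := finite_mor
  refine ⟨principalIdeal α ∩ principalIdeal β, Set.toFinite _, Set.Subset.antisymm
    (fun γ hγ => Set.mem_biUnion hγ (mem_principalIdeal_self γ)) (Set.iUnion₂_subset ?_)⟩
  rintro γ ⟨⟨δ, h1⟩, ⟨ε, h2⟩⟩
  refine Set.subset_inter ?_ ?_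
  · rw [← image_tau_principalIdeal (α := α) h1]
    rintro η ⟨θ, -, h⟩
    exact ⟨θ, h⟩
  · rw [← image_tau_principalIdeal (α := β) h2]
    rintro η ⟨θ, -, h⟩
    exact ⟨θ, h⟩

/-! ### Degrees and unique factorization. -/

theorem height_le : ∀ {a b : DoubleSquare}, Reaches a b → ∀ i, height a i ≤ height b i := by decide

theorem exists_between : ∀ {a c : DoubleSquare}, Reaches a c → ∀ m₀ m₁ : Fin 2,
    height a 0 + m₀ ≤ height c 0 → height a 1 + m₁ ≤ height c 1 →
    ∃ b, Reaches a b ∧ Reaches b c ∧ height b 0 = height a 0 + m₀ ∧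
      height b 1 = height a 1 + m₁ := by decide

theorem between_unique : ∀ {b b' c : DoubleSquare}, Reaches b c → Reaches b' c →
    height b 0 = height b' 0 → height b 1 = height b' 1 → b = b' := by decide

theorem exists_labels : ∀ {a b c : DoubleSquare} {l : Bool}, Allowed a c l → Reaches a b →
    Reaches b c → ∃ m n, Allowed a b m ∧ Allowed b c n ∧ (m || n) = l := by decide

theorem labels_unique : ∀ {a b c : DoubleSquare} {m n m' n' : Bool}, Allowed a b m → Allowed b c n →
    Allowed a b m' → Allowed b c n' → (m || n) = (m' || n') → m = m' ∧ n = n' := by decide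

theorem height_lt_two : ∀ a i, height a i < 2 := by decide

/-- Under a given end vertex, a vertex is determined by its height, so the degrees fix the middle
vertex of a factorization. The label must go to the factor that leaves `src` for another vertex. -/
theorem isKGraph : IsKGraph DoubleSquare 2 := by
  have := finite_mor
  -- Truncated subtraction loses nothing, as heights do not decrease along a path.
  refine ⟨inferInstance, fun f => height f.right - height f.left, fun x => tsub_self _, ?_, ?_⟩
  · intro x y z α β
    funext i
    have h1 := height_le (allowed α).1 i
    have h2 := height_le (allowed β).1 i
    simp only [Pi.add_apply, Pi.sub_apply]
    omega
  · intro x z γ m n h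
    have hγ := height_le (allowed γ).1
    have h0 := congrFun h 0
    have h1 := congrFun h 1
    simp only [Pi.add_apply, Pi.sub_apply] at h0 h1
    have hγ0 := hγ 0
    have hγ1 := hγ 1
    have hx0 := height_lt_two x 0
    have hx1 := height_lt_two x 1
    -- The factor of degree n starts at z, so the middle vertex lies n above z. Heights are below 2,
    -- so n fits in `Fin 2` and `exists_between` is a finite check.
    obtain ⟨b, hb1, hb2, hb3, hb4⟩ := exists_between (allowed γ).1 ⟨n 0, by omega⟩ ⟨n 1, by omega⟩
      (by dsimp only; omega) (by dsimp only; omega)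
    dsimp only at hb3 hb4
    obtain ⟨l, l', hl1, hl2, hl3⟩ := exists_labels (allowed γ) hb1 hb2
    refine ⟨⟨b, path l' hl2, path l hl1⟩, ⟨hom_ext hl3, ?_, ?_⟩, ?_⟩
    · funext i
      fin_cases i
      · simp only [Pi.sub_apply, Fin.zero_eta]; omega
      · simp only [Pi.sub_apply, Fin.mk_one]; omega
    · funext i
      fin_cases i
      · simp only [Pi.sub_apply, Fin.zero_eta]; omega
      · simp only [Pi.sub_apply, Fin.mk_one]; omega
    · rintro ⟨b', α, β⟩ ⟨h2, -, h3⟩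
      have hβ := height_le (allowed β).1
      have h4 := congrFun h3 0
      have h5 := congrFun h3 1
      simp only [Pi.sub_apply] at h4 h5
      have hβ0 := hβ 0
      have hβ1 := hβ 1
      obtain rfl := between_unique (allowed α).1 hb2 (by omega) (by omega)
      have h6 := labels_unique (allowed β) (allowed α) hl1 hl2 ((congrArg label h2).trans hl3.symm)
      rw [hom_ext (f := α) (g := path l' hl2) h6.2, hom_ext (f := β) (g := path l hl1) h6.1]

/-! ### Representations on matrices indexed by the vertices -/

/-- The set of the two paths from `src` to `o`. -/
def fromSrc (o : DoubleSquare) : Set (Mor DoubleSquare) := {γ | γ.left = src ∧ γ.right = o}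

theorem allowed_src : ∀ (o : DoubleSquare) (l : Bool), o ≠ src → Allowed src o l := by decide

theorem reaches_src {a : DoubleSquare} : Reaches a src → a = src := by revert a; decide

theorem mor_mem_fromSrc (o : DoubleSquare) (l : Bool) (ho : o ≠ src) :
    mor (path l (allowed_src o l ho)) ∈ fromSrc o := ⟨rfl, rfl⟩

theorem eq_of_fromSrc_subset {o a : DoubleSquare} (ho : o ≠ src)
    (h : fromSrc o ⊆ vertexIdeal a) : o = a :=
  h (mor_mem_fromSrc o false ho)

/-- A morphism not leaving `src` has label `false`, so composing with it preserves the label that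
tells the two paths apart. -/
theorem tau_image_fromSrc {y x : DoubleSquare} (α : y ⟶ x) (hy : y ≠ src) :
    (tau (mor α)).image (fromSrc y) = fromSrc x := by
  ext γ
  constructor
  · rintro ⟨β, hβ, h⟩
    obtain ⟨z, δ, rfl, rfl⟩ := tau_app_iff.1 h
    exact ⟨hβ.1, rfl⟩
  · rintro ⟨h1, h2⟩
    refine ⟨mor (path (label γ.hom) (allowed_src y _ hy)), ⟨rfl, rfl⟩, ?_⟩
    rw [tau_app_mor]
    congr 1
    refine mor_ext h1.symm h2.symm ?_
    simp [label_eq_false α hy]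

theorem principalIdeal_of_left_eq_src {γ : Mor DoubleSquare} (h : γ.left = src) :
    principalIdeal γ = {γ} := by
  obtain ⟨y, x, γ⟩ := γ
  obtain rfl : y = src := h
  refine Set.Subset.antisymm ?_ (Set.singleton_subset_iff.2 (mem_principalIdeal_self _))
  rintro δ ⟨β, hβ⟩
  obtain ⟨z, η, rfl, rfl⟩ := tau_app_iff.1 hβ
  obtain rfl := reaches_src (allowed η).1
  have : η = 𝟙 _ := hom_ext (by
    by_contra hl
    exact ((allowed η).2 (by simpa using hl)).2 rfl)
  rw [this, Category.id_comp]
  rfl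

theorem not_fromSrc_subset_singleton {o : DoubleSquare} (ho : o ≠ src) (γ : Mor DoubleSquare) :
    ¬ fromSrc o ⊆ {γ} := fun h => by
  have h1 := h (mor_mem_fromSrc o false ho)
  have h2 := h (mor_mem_fromSrc o true ho)
  have h3 := congrArg (fun δ : Mor DoubleSquare => label δ.hom)
    ((Set.mem_singleton_iff.1 h1).trans (Set.mem_singleton_iff.1 h2).symm)
  exact Bool.false_ne_true h3

/-- This is what the doubled edges are for: a singleton αC cannot contain two parallel paths, so
sending the morphisms out of `src` to 0 will not contradict (L5). -/
theorem left_ne_src_of_fromSrc_subset {o : DoubleSquare} (ho : o ≠ src) {α : Mor DoubleSquare}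
    (h : fromSrc o ⊆ principalIdeal α) : α.left ≠ src := fun hα =>
  not_fromSrc_subset_singleton ho α (by rwa [principalIdeal_of_left_eq_src hα] at h)

open scoped ComplexOrder

/-- Matrices over the vertices. -/
abbrev Mat : Type := CStarMatrix DoubleSquare DoubleSquare ℂ

/-- A multiple of a matrix unit. -/
def unit (i j : DoubleSquare) (c : ℂ) : Mat := fun a b => if a = i ∧ b = j then c else 0

theorem unit_mul_unit (i j k : DoubleSquare) (c d : ℂ) :
    unit i j c * unit j k d = unit i k (c * d) := by
  ext a b
  rw [CStarMatrix.mul_apply]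
  rw [Finset.sum_eq_single j]
  · by_cases ha : a = i <;> by_cases hb : b = k <;> simp [unit, ha, hb]
  · intro o _ ho
    simp [unit, ho]
  · simp

theorem unit_mul_unit_of_ne {j j' : DoubleSquare} (i k : DoubleSquare) (c d : ℂ) (h : j ≠ j') :
    unit i j c * unit j' k d = 0 := by
  ext a b
  rw [CStarMatrix.mul_apply]
  refine Finset.sum_eq_zero fun o _ => ?_
  by_cases ho : o = j
  · subst ho; simp [unit, h]
  · simp [unit, ho]

theorem unit_zero (i j : DoubleSquare) : unit i j 0 = 0 := by
  ext a b
  simp [unit]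

theorem star_unit (i j : DoubleSquare) (c : ℂ) : star (unit i j c) = unit j i (star c) := by
  ext a b
  rw [CStarMatrix.star_apply]
  by_cases ha : a = j <;> by_cases hb : b = i <;> simp [unit, ha, hb]

open Classical in
/-- The projection of a set of morphisms. -/
noncomputable def proj (Y : Set (Mor DoubleSquare)) : Mat :=
  fun a b => if a = b ∧ a ≠ src ∧ fromSrc a ⊆ Y then 1 else 0

open Classical in
-- A subset of aC can contain the paths from `src` to a vertex only if that vertex is a, so at most
-- one diagonal entry survives.
theorem proj_eq_unit {Y : Set (Mor DoubleSquare)} {a : DoubleSquare} (h : Y ⊆ vertexIdeal a) :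
    proj Y = unit a a (if a ≠ src ∧ fromSrc a ⊆ Y then 1 else 0) := by
  ext b c
  by_cases hb : b = a
  · subst hb
    by_cases hc : c = b
    · subst hc
      simp [proj, unit]
    · simp [proj, unit, hc, Ne.symm hc]
  · have : ¬ (b ≠ src ∧ fromSrc b ⊆ Y) := fun h' => hb (eq_of_fromSrc_subset h'.1 (h'.2.trans h))
    simp [proj, unit, hb, this]

/-- Being contained in Y ∩ Z means being contained in both, so (L4) holds for arbitrary sets. -/
theorem proj_mul_proj (Y Z : Set (Mor DoubleSquare)) : proj Y * proj Z = proj (Y ∩ Z) := by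
  ext a b
  rw [CStarMatrix.mul_apply, Finset.sum_eq_single b]
  · by_cases hab : a = b
    · subst hab
      by_cases ha : a = src <;> by_cases h1 : fromSrc a ⊆ Y <;> by_cases h2 : fromSrc a ⊆ Z <;>
        simp [proj, ha, h1, h2]
    · simp [proj, hab]
  · intro o _ ho
    simp [proj, ho]
  · simp

theorem unit_mul_proj (i j : DoubleSquare) (c : ℂ) (Y : Set (Mor DoubleSquare)) :
    unit i j c * proj Y = unit i j (c * proj Y j j) := by
  ext a b
  rw [CStarMatrix.mul_apply, Finset.sum_eq_single j]
  · by_cases ha : a = i <;> by_cases hb : b = j <;> simp [unit, ha, hb]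
    right
    simp [proj, Ne.symm hb]
  · intro o _ ho
    simp [unit, ho]
  · simp

theorem star_proj (Y : Set (Mor DoubleSquare)) : star (proj Y) = proj Y := by
  ext a b
  rw [CStarMatrix.star_apply]
  by_cases hab : a = b
  · subst hab
    simp only [proj]
    split_ifs <;> simp
  · simp [proj, hab, Ne.symm hab]

/-- The scalar of a morphism: `0` for morphisms out of `src`, `ε` for the morphism from `mid₁` to
`top₂`, and `1` otherwise. -/
noncomputable def twist (ε : ℂ) (α : Mor DoubleSquare) : ℂ :=
  if α.left = src then 0 else if α.left = mid₁ ∧ α.right = top₂ then ε else 1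

theorem twist_comp (ε : ℂ) : ∀ {x y z : DoubleSquare} (α : y ⟶ x) (β : z ⟶ y),
    twist ε (mor (β ≫ α)) = twist ε (mor α) * twist ε (mor β) := by
  intro x y z α β
  by_cases hz : z = src
  · simp [twist, hz]
  -- Away from `src` no two nonidentity morphisms compose, so one factor is an identity, with scalar
  -- 1. Multiplicativity therefore puts no condition on ε.
  have hy : y = z ∨ x = y ∧ y ≠ src := by
    have h1 := (allowed α).1
    have h2 := (allowed β).1
    revert hz h1 h2
    clear α β
    revert x y z
    decide
  rcases hy with rfl | ⟨rfl, hy⟩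
  · have : twist ε (mor β) = 1 := by
      simp only [twist, hz, if_false]
      rw [if_neg]
      rintro ⟨rfl, h⟩
      cases h
    rw [this, mul_one]
    simp [twist]
  · have : twist ε (mor α) = 1 := by
      simp only [twist, hy, if_false]
      rw [if_neg]
      rintro ⟨rfl, h⟩
      cases h
    rw [this, one_mul]
    simp [twist]

/-- The partial isometry of a morphism. -/
noncomputable def isom (ε : ℂ) (α : Mor DoubleSquare) : Mat := unit α.right α.left (twist ε α)

theorem star_twist_mul_twist {ε : ℂ} (hε : star ε * ε = 1) (α : Mor DoubleSquare) :
    star (twist ε α) * twist ε α = if α.left = src then 0 else 1 := by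
  unfold twist
  split_ifs <;> simp_all

theorem twist_mul_star_twist {ε : ℂ} (hε : star ε * ε = 1) (α : Mor DoubleSquare) :
    twist ε α * star (twist ε α) = if α.left = src then 0 else 1 := by
  rw [mul_comm, star_twist_mul_twist hε]

variable {𝒥 : Set (Set (Mor DoubleSquare))}

theorem liBase {ε : ℂ} (hε : star ε * ε = 1) :
    LiBase (isom ε) (fun Y : 𝒥 => proj (Y : Set (Mor DoubleSquare))) where
  partialIsometry α := by
    rw [isom, star_unit, unit_mul_unit, unit_mul_unit, twist_mul_star_twist hε]
    congr 1
    split_ifs with h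
    · simp [twist, h]
    · rw [one_mul]
  projection Y := ⟨by rw [IsIdempotentElem, proj_mul_proj, Set.inter_self], star_proj _⟩
  L1 α Y hY := by
    rw [isom, star_unit, unit_mul_unit, star_twist_mul_twist hε, proj_eq_unit hY.subset]
    congr 1
    have : fromSrc α.left ⊆ Y := by
      rw [hY]
      exact fun γ hγ => hγ.2
    by_cases h : α.left = src <;> simp [h, this]
  L2_comp α β := by
    rw [isom, isom, isom, unit_mul_unit, twist_comp]
  L2_zero α β h := unit_mul_unit_of_ne _ _ _ _ h
  L3 Y hY := by
    ext a b
    have : ¬ (a ≠ src ∧ fromSrc a ⊆ (Y : Set (Mor DoubleSquare))) := fun h => by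
      exact Set.notMem_empty _ (hY.subset (h.2 (mor_mem_fromSrc a false h.1)))
    simp [proj, this]

theorem L4_proj : L4 (fun Y : 𝒥 => proj (Y : Set (Mor DoubleSquare))) := fun Y Z _ hW =>
  (proj_mul_proj Y Z).trans (congrArg proj hW.symm)

/-- If α leaves `src`, both sides are 0. Otherwise τ_α carries the paths from `src` to s(α)
bijectively onto those to r(α), and ε cancels against its conjugate. -/
theorem L5_isom {ε : ℂ} (hε : star ε * ε = 1) :
    L5 (isom ε) (fun Y : 𝒥 => proj (Y : Set (Mor DoubleSquare))) := fun α Y W hW => by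
  have hsub : (W : Set (Mor DoubleSquare)) ⊆ vertexIdeal α.right := by
    rw [hW]
    rintro γ ⟨β, -, h⟩
    exact (tau_app_left h).2
  change isom ε α * proj Y * star (isom ε α) = proj W
  rw [isom, star_unit, unit_mul_proj, unit_mul_unit, proj_eq_unit hsub, mul_right_comm,
    twist_mul_star_twist hε, hW]
  congr 1
  obtain ⟨y, x, α⟩ := α
  by_cases hy : y = src
  · have : ¬ (x ≠ src ∧ fromSrc x ⊆ (tau (mor α)).image Y) := fun h =>
      left_ne_src_of_fromSrc_subset h.1 (h.2.trans (by rintro γ ⟨β, -, h⟩; exact ⟨β, h⟩)) hy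
    rw [if_neg this]
    simp [hy]
  · have hx : x ≠ src := by
      rintro rfl
      exact hy (reaches_src (allowed α).1)
    have h : fromSrc x ⊆ (tau (mor α)).image Y ↔ fromSrc y ⊆ Y := by
      rw [← tau_image_fromSrc α hy]
      constructor
      · intro h β hβ
        obtain ⟨γ, hγ⟩ : β ∈ (tau (mor α)).dom := by
          rw [dom_tau]
          exact hβ.2
        obtain ⟨β', hβ', h'⟩ := h ⟨β, hβ, hγ⟩
        rwa [SymInv.app_inj hγ h']
      · rintro h γ ⟨β, hβ, h'⟩
        exact ⟨β, h hβ, h'⟩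
    simp only [proj, hy, if_false, one_mul]
    by_cases hc : fromSrc y ⊆ (Y : Set (Mor DoubleSquare))
    · rw [if_pos ⟨rfl, hy, hc⟩, if_pos ⟨hx, h.2 hc⟩]
    · rw [if_neg fun h' => hc h'.2.2, if_neg fun h' => hc (h.1 h'.2)]

/-- The matrix `M` describes the action of the partial bijection `φ` on the sets `fromSrc`. -/
def Describes (M : Mat) (φ : SymInv (Mor DoubleSquare)) (w v : DoubleSquare) : Prop :=
  (v ≠ src → fromSrc v ⊆ φ.dom → w ≠ src ∧ φ.image (fromSrc v) = fromSrc w ∧ M = unit w v 1) ∧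
  (¬ (v ≠ src ∧ fromSrc v ⊆ φ.dom) → M = 0)

theorem subset_dom_mul {X : Type*} (φ ψ : SymInv X) (Y : Set X) :
    Y ⊆ (φ * ψ).dom ↔ Y ⊆ ψ.dom ∧ ψ.image Y ⊆ φ.dom := by
  constructor
  · intro h
    refine ⟨fun y hy => ?_, ?_⟩
    · obtain ⟨z, hz⟩ := h hy
      obtain ⟨x, hx, -⟩ := SymInv.mul_app.1 hz
      exact ⟨x, hx⟩
    · rintro x ⟨y, hy, hx⟩
      obtain ⟨z, hz⟩ := h hy
      obtain ⟨x', hx', hz'⟩ := SymInv.mul_app.1 hz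
      rw [hx] at hx'
      obtain rfl := Option.some.inj hx'
      exact ⟨z, hz'⟩
  · rintro ⟨h1, h2⟩ y hy
    obtain ⟨x, hx⟩ := h1 hy
    obtain ⟨z, hz⟩ := h2 ⟨y, hy, hx⟩
    exact ⟨z, SymInv.mul_app.2 ⟨x, hx, hz⟩⟩

/-- The paths to v lie in the domain of φψ exactly when they lie in that of ψ and their images,
being all the paths to y, lie in that of φ. Matrix units multiply accordingly. -/
theorem Describes.mul {M N : Mat} {φ ψ : SymInv (Mor DoubleSquare)} {w y v : DoubleSquare}
    (hM : Describes M φ w y) (hN : Describes N ψ y v) : Describes (M * N) (φ * ψ) w v := by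
  by_cases h : v ≠ src ∧ fromSrc v ⊆ ψ.dom
  · obtain ⟨h1, h2, h3⟩ := hN.1 h.1 h.2
    constructor
    · intro hv hd
      rw [subset_dom_mul, h2] at hd
      obtain ⟨h4, h5, h6⟩ := hM.1 h1 hd.2
      exact ⟨h4, by rw [SymInv.image_mul, h2, h5], by rw [h3, h6, unit_mul_unit, one_mul]⟩
    · intro hd
      rw [hM.2 ?_, zero_mul]
      rintro ⟨-, h4⟩
      exact hd ⟨h.1, (subset_dom_mul _ _ _).2 ⟨h.2, by rwa [h2]⟩⟩
  · constructor
    · intro hv hd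
      exact (h ⟨hv, ((subset_dom_mul _ _ _).1 hd).1⟩).elim
    · intro _
      rw [hN.2 h, mul_zero]

theorem describes_isom {v x : DoubleSquare} (β : v ⟶ x) :
    Describes (isom 1 (mor β)) (tau (mor β)) x v := by
  constructor
  · intro hv _
    refine ⟨?_, tau_image_fromSrc β hv, ?_⟩
    · rintro rfl
      exact hv (reaches_src (allowed β).1)
    · simp [isom, twist, hv]
  · intro h
    have hv : v = src := by
      by_contra hv
      refine h ⟨hv, ?_⟩
      rw [dom_tau]
      exact fun γ hγ => hγ.2
    rw [isom, twist, if_pos hv, unit_zero]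

theorem describes_star_isom {w x : DoubleSquare} (α : w ⟶ x) :
    Describes (star (isom 1 (mor α))) (sigma (mor α)) w x := by
  have hdom : (sigma (mor α)).dom = principalIdeal (mor α) := by
    ext γ
    simp only [SymInv.dom, sigma, SymInv.inv_app]
    rfl
  constructor
  · intro hx hd
    rw [hdom] at hd
    have hw : w ≠ src := left_ne_src_of_fromSrc_subset hx hd
    refine ⟨hw, ?_, ?_⟩
    · rw [← tau_image_fromSrc α hw, sigma_image_tau_image]
      exact fun γ hγ => hγ.2
    · simp [isom, twist, hw, star_unit]
  · intro h
    have hw : w = src := by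
      by_contra hw
      refine h ⟨?_, ?_⟩
      · rintro rfl
        exact hw (reaches_src (allowed α).1)
      · rw [hdom, ← tau_image_fromSrc α hw]
        rintro γ ⟨β, -, h⟩
        exact ⟨β, h⟩
    rw [isom, twist, if_pos hw, unit_zero, star_zero]

theorem describes_word {w v : DoubleSquare} (ζ : ZigzagTuple DoubleSquare w v) :
    Describes (ζ.word (isom 1)) ζ.phi w v := by
  induction ζ with
  | single α β => exact (describes_star_isom α).mul (describes_isom β)
  | cons α β ζ ih => exact ((describes_star_isom α).mul (describes_isom β)).mul ih

/-- For ε = 1 the word of ζ is determined by what φ_ζ does to the sets `fromSrc`: it is a matrix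
unit with coefficient 1, or 0. No sign can accumulate. -/
theorem L7_isom : L7 (isom 1) (fun Y : 𝒥 => proj (Y : Set (Mor DoubleSquare))) := by
  intro w v ζ Y hζ hY
  obtain ⟨h1, h2⟩ := describes_word ζ
  rw [← ζ.A_eq_dom] at h1 h2
  change ζ.word (isom 1) = proj Y
  rw [proj_eq_unit (hY.subset.trans ζ.A_subset), hY]
  by_cases h : v ≠ src ∧ fromSrc v ⊆ ζ.A
  · obtain ⟨h3, h4, h5⟩ := h1 h.1 h.2
    rw [if_pos h, h5]
    congr 1
    -- An identity map keeps the paths to v inside vC; as their image is `fromSrc w`, this forces w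
    -- = v.
    refine eq_of_fromSrc_subset h3 ?_
    rw [← h4, hζ]
    rintro γ ⟨δ, hδ, h6⟩
    obtain ⟨rfl, -⟩ := SymInv.idOn_app.1 h6
    exact hδ.2
  · rw [if_neg h, h2 h, unit_zero]

theorem relLi_holds {ε : ℂ} (hε : star ε * ε = 1) (𝒥 : Set (Set (Mor DoubleSquare))) :
    (relLi 𝒥).Holds (Sum.elim (isom ε) fun Y : 𝒥 => proj (Y : Set (Mor DoubleSquare))) :=
  ⟨liBase hε, L4_proj, L5_isom hε⟩

theorem relLiS_holds (𝒥 : Set (Set (Mor DoubleSquare))) :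
    (relLiS 𝒥).Holds (Sum.elim (isom 1) fun Y : 𝒥 => proj (Y : Set (Mor DoubleSquare))) :=
  ⟨liBase (by simp), L7_isom⟩

/-! ### A constructible ideal that is a union of two smaller ones -/

/-- The edge from `mid₁` to `top₁`. -/
def edge₁₁ : mid₁ ⟶ top₁ := path false (by decide)
/-- The edge from `mid₂` to `top₁`. -/
def edge₂₁ : mid₂ ⟶ top₁ := path false (by decide)
/-- The edge from `mid₁` to `top₂`. -/
def edge₁₂ : mid₁ ⟶ top₂ := path false (by decide)
/-- The edge from `mid₂` to `top₂`. -/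
def edge₂₂ : mid₂ ⟶ top₂ := path false (by decide)

/-- The two paths from `src` to `top₁`. -/
def diag (l : Bool) : src ⟶ top₁ := path l (allowed_src _ l (by decide))

/-- Only paths that start at `src` factor through both middle vertices. -/
theorem fromSrc_top₁ : fromSrc top₁ = principalIdeal (mor edge₁₁) ∩ principalIdeal (mor edge₂₁) := by
  ext γ
  constructor
  · intro hγ
    constructor
    · rw [← tau_image_fromSrc edge₁₁ (by decide)] at hγ
      obtain ⟨β, -, h⟩ := hγ
      exact ⟨β, h⟩
    · rw [← tau_image_fromSrc edge₂₁ (by decide)] at hγ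
      obtain ⟨β, -, h⟩ := hγ
      exact ⟨β, h⟩
  · rintro ⟨⟨β, h⟩, ⟨β', h'⟩⟩
    obtain ⟨a, δ, rfl, rfl⟩ := tau_app_iff.1 h
    obtain ⟨a', δ', rfl, h1⟩ := tau_app_iff.1 h'
    obtain rfl : a = a' := congrArg Quiver.Total.left h1
    refine ⟨?_, rfl⟩
    have h2 := (allowed δ).1
    have h3 := (allowed δ').1
    change a = src
    clear h h' h1 δ δ'
    revert a
    decide

theorem fromSrc_top₁_eq_union :
    fromSrc top₁ = principalIdeal (mor (diag false)) ∪ principalIdeal (mor (diag true)) := by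
  rw [principalIdeal_of_left_eq_src rfl, principalIdeal_of_left_eq_src rfl]
  ext γ
  constructor
  · rintro ⟨h1, h2⟩
    rcases h : label γ.hom with _ | _
    · exact Or.inl (mor_ext h1 h2 h)
    · exact Or.inr (mor_ext h1 h2 h)
  · rintro (h | h) <;> (obtain rfl := Set.mem_singleton_iff.1 h; exact ⟨rfl, rfl⟩)

/-- The two paths from `src` to `top₁`, as a constructible right ideal. -/
def fromSrcIdeal : constructibleIdeals DoubleSquare :=
  ⟨fromSrc top₁, by
    rw [fromSrc_top₁]
    exact inter_mem_constructibleIdeals (principalIdeal_mem _) (principalIdeal_mem _)⟩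

/-- Each of the two paths from `src` to `top₁` generates a constructible right ideal. -/
def diagIdeal (l : Bool) : constructibleIdeals DoubleSquare :=
  ⟨principalIdeal (mor (diag l)), principalIdeal_mem _⟩

/-- The defect `P_{Y ∪ Z} - (P_Y + P_Z - P_Y P_Z)` of a family of projections. -/
def defect {B : Type v} [NonUnitalCStarAlgebra B] (P : constructibleIdeals DoubleSquare → B) : B :=
  P fromSrcIdeal - (P (diagIdeal false) + P (diagIdeal true) - P (diagIdeal false) * P (diagIdeal true))

theorem map_defect {A : Type*} {B : Type*} [NonUnitalCStarAlgebra A] [NonUnitalCStarAlgebra B]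
    (f : A →⋆ₙₐ[ℂ] B) (P : constructibleIdeals DoubleSquare → A) :
    f (defect P) = defect (f ∘ P) := by
  simp [defect]

theorem defect_eq_zero {B : Type v} [NonUnitalCStarAlgebra B]
    {P : constructibleUnions DoubleSquare → B} (h : L6 P) : defect (P ∘ toUnions) = 0 :=
  sub_eq_zero.2 (h (toUnions (diagIdeal false)) (toUnions (diagIdeal true)) (toUnions fromSrcIdeal)
    fromSrc_top₁_eq_union)

/-- Each of the two principal ideals is a singleton, so its matrix is 0, whereas their union has
entry 1 at `top₁`. -/
theorem defect_proj_ne_zero :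
    defect (fun Y : constructibleIdeals DoubleSquare => proj (Y : Set (Mor DoubleSquare))) ≠ 0 := by
  have hne : top₁ ≠ src := by decide
  have hd : ∀ l, proj (diagIdeal l : Set (Mor DoubleSquare)) = 0 := fun l => by
    have h : (diagIdeal l : Set (Mor DoubleSquare)) = {mor (diag l)} :=
      principalIdeal_of_left_eq_src rfl
    ext a b
    have : ¬ (a ≠ src ∧ fromSrc a ⊆ (diagIdeal l : Set (Mor DoubleSquare))) := fun h' =>
      not_fromSrc_subset_singleton h'.1 _ (by rw [← h]; exact h'.2)
    simp [proj, this]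
  intro h
  simp only [defect, hd, mul_zero, add_zero, sub_zero] at h
  have h1 := congrFun (congrFun h top₁) top₁
  simp [proj, fromSrcIdeal, hne] at h1

/-! ### A zigzag around the two squares -/

/-- The zigzag from `mid₂` around the two squares. -/
def loop : ZigzagTuple DoubleSquare mid₂ mid₂ :=
  .cons edge₂₂ edge₁₂ (.single edge₁₁ edge₂₁)

theorem tau_app_label {y x : DoubleSquare} {α : y ⟶ x} (hy : y ≠ src) {β γ : Mor DoubleSquare}
    (h : (tau (mor α)).app β = some γ) : β.left = γ.left ∧ label β.hom = label γ.hom := by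
  obtain ⟨z, δ, rfl, rfl⟩ := tau_app_iff.1 h
  simp [label_eq_false α hy]

/-- Each shift around the loop preserves source and label, and the loop returns to its starting
range; source, range and label determine a morphism. -/
theorem loop_phi : loop.phi = SymInv.idOn loop.A := by
  have key : ∀ {γ δ}, loop.phi.app γ = some δ → γ = δ := by
    intro γ δ h
    obtain ⟨h1, h2⟩ := loop.phi_app_right h
    obtain ⟨ε, h3, h4⟩ := SymInv.mul_app.1 h
    obtain ⟨η, h5, h6⟩ := SymInv.mul_app.1 h3
    obtain ⟨θ, h7, h8⟩ := SymInv.mul_app.1 h4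
    have h5 := tau_app_label (by decide) h5
    have h6 := tau_app_label (by decide) (SymInv.inv_app.1 h6)
    have h7 := tau_app_label (by decide) h7
    have h8 := tau_app_label (by decide) (SymInv.inv_app.1 h8)
    exact mor_ext (by rw [h5.1, ← h6.1, h7.1, h8.1]) (h1.trans h2.symm)
      (by rw [h5.2, ← h6.2, h7.2, h8.2])
  refine SymInv.ext fun γ δ => ?_
  rw [SymInv.idOn_app, ZigzagTuple.A_eq_dom]
  constructor
  · intro h
    exact ⟨key h, δ, h⟩
  · rintro ⟨rfl, δ, h⟩
    rwa [← key h] at h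

/-- The loop passes once through the only edge that carries the sign. -/
theorem word_loop : loop.word (isom (-1)) = unit mid₂ mid₂ (-1) := by
  simp [loop, ZigzagTuple.word, isom, star_unit, unit_mul_unit, twist]

theorem word_loop_ne_proj (Y : Set (Mor DoubleSquare)) : loop.word (isom (-1)) ≠ proj Y := by
  rw [word_loop]
  intro h
  have h1 := congrFun (congrFun h mid₂) mid₂
  simp only [unit, proj] at h1
  simp only [and_self, if_true] at h1
  split_ifs at h1 <;> norm_num at h1

end DoubleSquare

/-! ## The canonical homomorphisms, and the main theorem -/

section CanonicalMaps

variable {C : Type u} [SmallCategory C] [LeftCancellative C]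

theorem LiBase.comp_toUnions {B : Type v} [NonUnitalCStarAlgebra B] {V : Mor C → B}
    {P : constructibleUnions C → B} (h : LiBase V P) : LiBase V (P ∘ toUnions) where
  partialIsometry := h.partialIsometry
  projection _ := h.projection _
  L1 α _ hY := h.L1 α _ hY
  L2_comp := h.L2_comp
  L2_zero := h.L2_zero
  L3 _ hY := h.L3 _ hY

variable (C)

theorem exists_hom_CLi_CLiUnion : ∃ πU : CLi C →⋆ₙₐ[ℂ] CLiUnion C,
    (∀ α : Mor C, πU (genV _ α) = genV _ α) ∧
    (∀ Y : constructibleIdeals C, πU (genP _ Y) = genP _ (toUnions Y)) := by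
  have h := gen_holds_CLiUnion (C := C)
  have hf : (relLi (constructibleIdeals C)).Holds
      (Sum.elim (genV (relLiUnion (constructibleUnions C))) (genP _ ∘ toUnions)) :=
    ⟨h.1.comp_toUnions, fun Y Z W hW => h.2.1 (toUnions Y) (toUnions Z) (toUnions W) hW,
      fun α Y W hW => h.2.2.1 α (toUnions Y) (toUnions W) hW⟩
  exact ⟨UnivCStar.lift hf, fun α => UnivCStar.lift_gen hf _, fun Y => UnivCStar.lift_gen hf _⟩

theorem exists_hom_CLiS_CLiSUnion : ∃ ρU : CLiS C →⋆ₙₐ[ℂ] CLiSUnion C,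
    (∀ α : Mor C, ρU (genV _ α) = genV _ α) ∧
    (∀ Y : constructibleIdeals C, ρU (genP _ Y) = genP _ (toUnions Y)) := by
  have h := gen_holds_CLiSUnion (C := C)
  have hf : (relLiS (constructibleIdeals C)).Holds
      (Sum.elim (genV (relLiSUnion (constructibleUnions C))) (genP _ ∘ toUnions)) :=
    ⟨h.1.comp_toUnions, fun ζ Y h1 h2 => h.2.2 ζ (toUnions Y) h1 h2⟩
  exact ⟨UnivCStar.lift hf, fun α => UnivCStar.lift_gen hf _, fun Y => UnivCStar.lift_gen hf _⟩

theorem exists_hom_CZM_Toeplitz : ∃ q : CZM C →⋆ₙₐ[ℂ] Toeplitz C,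
    ∀ s : ZM C, q (UnivCStar.gen _ s) = UnivCStar.gen _ s := by
  have h := (gen_isFinitelyJoinPreservingRep (C := C)).rep
  exact ⟨UnivCStar.lift (f := fun s : ZM C => (UnivCStar.gen _ s : Toeplitz C)) h,
    fun s => UnivCStar.lift_gen _ s⟩

/-- Its existence rests on (L7) implying (L4) and (L5) for ideals, through the representation of `ZM
C`. -/
theorem exists_hom_CLi_CLiS : ∃ πs : CLi C →⋆ₙₐ[ℂ] CLiS C,
    (∀ α : Mor C, πs (genV _ α) = genV _ α) ∧
    (∀ Y : constructibleIdeals C, πs (genP _ Y) = genP _ Y) := by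
  have h := gen_holds_CLiS (C := C)
  have hf : (relLi (constructibleIdeals C)).Holds
      (fun x => (UnivCStar.gen _ x : CLiS C)) := by
    refine ⟨h.1, fun Y Z W hW => ?_, fun α Y W hW => ?_⟩
    · refine (L4_of_L7 subset_rfl h.1 h.2 Y.2 Z.2).trans (congrArg _ (Subtype.ext hW.symm))
    · refine (L5_of_L7 subset_rfl h.1 h.2 α Y.2).trans (congrArg _ (Subtype.ext hW.symm))
  exact ⟨UnivCStar.lift hf, fun α => UnivCStar.lift_gen hf _, fun Y => UnivCStar.lift_gen hf _⟩

end CanonicalMaps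

/-! ### Failure of injectivity for the 2-graph. -/

namespace DoubleSquare

open scoped ComplexOrder

theorem exists_hom_CLi_mat {ε : ℂ} (hε : star ε * ε = 1) : ∃ f : CLi DoubleSquare →⋆ₙₐ[ℂ] Mat,
    (∀ α, f (genV _ α) = isom ε α) ∧ ∀ Y, f (genP _ Y) = proj (Y : Set (Mor DoubleSquare)) :=
  ⟨UnivCStar.lift (relLi_holds hε _), fun α => UnivCStar.lift_gen (relLi_holds hε _) (Sum.inl α),
    fun Y => UnivCStar.lift_gen (relLi_holds hε _) (Sum.inr Y)⟩

theorem exists_hom_CLiS_mat : ∃ f : CLiS DoubleSquare →⋆ₙₐ[ℂ] Mat,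
    ∀ Y, f (genP _ Y) = proj (Y : Set (Mor DoubleSquare)) :=
  ⟨UnivCStar.lift (relLiS_holds _), fun Y => UnivCStar.lift_gen (relLiS_holds _) (Sum.inr Y)⟩

theorem defect_genP_CLi_ne_zero :
    defect (genP (relLi (constructibleIdeals DoubleSquare))) ≠ 0 := fun h => by
  obtain ⟨f, -, hf⟩ := exists_hom_CLi_mat (ε := 1) (by simp)
  have h1 := map_defect f (genP _)
  rw [h, map_zero, show f ∘ genP _ = _ from funext hf] at h1
  exact defect_proj_ne_zero h1.symm

theorem defect_genP_CLiS_ne_zero :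
    defect (genP (relLiS (constructibleIdeals DoubleSquare))) ≠ 0 := fun h => by
  obtain ⟨f, hf⟩ := exists_hom_CLiS_mat
  have h1 := map_defect f (genP _)
  rw [h, map_zero, show f ∘ genP _ = _ from funext hf] at h1
  exact defect_proj_ne_zero h1.symm

theorem not_injective_of_CLi {f : CLi DoubleSquare →⋆ₙₐ[ℂ] CLiUnion DoubleSquare}
    (hf : ∀ Y, f (genP _ Y) = genP _ (toUnions Y)) : ¬ Function.Injective f := fun hinj => by
  refine defect_genP_CLi_ne_zero (hinj ?_)
  rw [map_defect, map_zero, show f ∘ genP _ = genP _ ∘ toUnions from funext hf]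
  exact defect_eq_zero (gen_L6 (R := relLiUnion _) fun h => h.2.2.2)

theorem not_injective_of_CLiS {f : CLiS DoubleSquare →⋆ₙₐ[ℂ] CLiSUnion DoubleSquare}
    (hf : ∀ Y, f (genP _ Y) = genP _ (toUnions Y)) : ¬ Function.Injective f := fun hinj => by
  refine defect_genP_CLiS_ne_zero (hinj ?_)
  rw [map_defect, map_zero, show f ∘ genP _ = genP _ ∘ toUnions from funext hf]
  exact defect_eq_zero (gen_L6 (R := relLiSUnion _) fun h => h.2.1)

/-- The isomorphisms of (i) and (ii) intertwine `q` with `ρU` on the p_Y, so `q` kills the image of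
the nonzero defect. -/
theorem not_injective_of_CZM {q : CZM DoubleSquare →⋆ₙₐ[ℂ] Toeplitz DoubleSquare}
    (hq : ∀ s, q (UnivCStar.gen _ s) = UnivCStar.gen _ s) : ¬ Function.Injective q := fun hinj => by
  obtain ⟨g, -, hg⟩ := exists_equiv_CLiS_CZM (C := DoubleSquare)
  obtain ⟨μ, -, hμ⟩ := exists_equiv_CLiSUnion_Toeplitz (C := DoubleSquare)
  obtain ⟨ρU, -, hρ⟩ := exists_hom_CLiS_CLiSUnion DoubleSquare
  refine defect_genP_CLiS_ne_zero (EquivLike.injective g (hinj ?_))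
  have h : ∀ Y, q (g (genP _ Y)) = μ (ρU (genP _ Y)) := fun Y => by rw [hg, hq, hρ, hμ]
  have h0 : ρU (defect (genP _)) = 0 := by
    rw [map_defect, show ρU ∘ genP _ = genP _ ∘ toUnions from funext hρ]
    exact defect_eq_zero (gen_L6 (R := relLiSUnion _) fun h => h.2.1)
  have h1 : q (g (defect (genP _))) = μ (ρU (defect (genP _))) := by
    simp only [defect, map_sub, map_add, map_mul, h]
  rw [h1, h0]
  simp only [map_zero]

/-- Injectivity would pull the instance of (L7) for the loop back to the algebra of (L1)–(L5), where
the representation with ε = -1 refutes it. -/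
theorem not_injective_CLi_CLiS {f : CLi DoubleSquare →⋆ₙₐ[ℂ] CLiS DoubleSquare}
    (hV : ∀ α, f (genV _ α) = genV _ α) (hP : ∀ Y, f (genP _ Y) = genP _ Y) :
    ¬ Function.Injective f := fun hinj => by
  have h : loop.word (genV (relLi (constructibleIdeals DoubleSquare))) = genP _ loop.ideal := by
    apply hinj
    rw [map_word, hP, show f ∘ genV _ = genV _ from funext hV]
    exact gen_L7 (R := relLiS _) (fun h => h.2) loop loop.ideal loop_phi rfl
  obtain ⟨k, hkV, hkP⟩ := exists_hom_CLi_mat (ε := -1) (by simp)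
  have h1 := congrArg k h
  rw [map_word, hkP, show k ∘ genV _ = _ from funext hkV] at h1
  exact word_loop_ne_proj _ h1

end DoubleSquare

theorem theorem7p10 :
    (∀ (C : Type u) [SmallCategory C] [LeftCancellative C],
      (∃ g : CLiS C ≃⋆ₐ[ℂ] CZM C,
        (∀ {x y : C} (α : x ⟶ y), g (genV _ (mor α)) = tZM (ZigzagTuple.single (𝟙 y) α)) ∧
        (∀ {w v : C} (ζ : ZigzagTuple C w v),
          g (genP _ ζ.ideal) = tZM (ζ.reverse.append ζ))) ∧
      (∃ μ : CLiSUnion C ≃⋆ₐ[ℂ] Toeplitz C,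
        (∀ {x y : C} (α : x ⟶ y), μ (genV _ (mor α)) = tT (ZigzagTuple.single (𝟙 y) α)) ∧
        (∀ {w v : C} (ζ : ZigzagTuple C w v),
          μ (genP _ (toUnions ζ.ideal)) = tT (ζ.reverse.append ζ))) ∧
      (FinitelyAligned C →
        ∃ ρs : CLiUnion C ≃⋆ₐ[ℂ] CLiSUnion C,
          (∀ α : Mor C, ρs (genV _ α) = genV _ α) ∧
          (∀ Y : constructibleUnions C, ρs (genP _ Y) = genP _ Y))) ∧
    (∃ (C : Type) (_ : SmallCategory C) (_ : LeftCancellative C),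
      FinitelyAligned C ∧ IsKGraph C 2 ∧
      (∃ πU : CLi C →⋆ₙₐ[ℂ] CLiUnion C,
        (∀ α : Mor C, πU (genV _ α) = genV _ α) ∧
        (∀ Y : constructibleIdeals C, πU (genP _ Y) = genP _ (toUnions Y)) ∧
        ¬ Function.Injective πU) ∧
      (∃ ρU : CLiS C →⋆ₙₐ[ℂ] CLiSUnion C,
        (∀ α : Mor C, ρU (genV _ α) = genV _ α) ∧
        (∀ Y : constructibleIdeals C, ρU (genP _ Y) = genP _ (toUnions Y)) ∧
        ¬ Function.Injective ρU) ∧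
      (∃ q : CZM C →⋆ₙₐ[ℂ] Toeplitz C,
        (∀ {w v : C} (ζ : ZigzagTuple C w v), q (tZM ζ) = tT ζ) ∧
        ¬ Function.Injective q)) ∧
    (∃ (C : Type) (_ : SmallCategory C) (_ : LeftCancellative C),
      FinitelyAligned C ∧ IsKGraph C 2 ∧
      (∃ πs : CLi C →⋆ₙₐ[ℂ] CLiS C,
        (∀ α : Mor C, πs (genV _ α) = genV _ α) ∧
        (∀ Y : constructibleIdeals C, πs (genP _ Y) = genP _ Y) ∧
        ¬ Function.Injective πs)) := by
  refine ⟨fun C _ _ => ⟨?_, ?_, exists_equiv_CLiUnion_CLiSUnion⟩, ?_, ?_⟩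
  · obtain ⟨g, hV, hP⟩ := exists_equiv_CLiS_CZM (C := C)
    refine ⟨g, fun α => ?_, fun ζ => ?_⟩
    · rw [hV, tauZM_mor]; rfl
    · rw [hP, idZM_ideal]; rfl
  · obtain ⟨μ, hV, hP⟩ := exists_equiv_CLiSUnion_Toeplitz (C := C)
    refine ⟨μ, fun α => ?_, fun ζ => ?_⟩
    · rw [hV, tauZM_mor]; rfl
    · rw [hP, idZM_ideal]; rfl
  · refine ⟨DoubleSquare, inferInstance, inferInstance, DoubleSquare.finitelyAligned,
      DoubleSquare.isKGraph, ?_, ?_, ?_⟩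
    · obtain ⟨f, hV, hP⟩ := exists_hom_CLi_CLiUnion DoubleSquare
      exact ⟨f, hV, hP, DoubleSquare.not_injective_of_CLi hP⟩
    · obtain ⟨f, hV, hP⟩ := exists_hom_CLiS_CLiSUnion DoubleSquare
      exact ⟨f, hV, hP, DoubleSquare.not_injective_of_CLiS hP⟩
    · obtain ⟨q, hq⟩ := exists_hom_CZM_Toeplitz DoubleSquare
      exact ⟨q, fun ζ => hq _, DoubleSquare.not_injective_of_CZM hq⟩
  · obtain ⟨f, hV, hP⟩ := exists_hom_CLi_CLiS DoubleSquare
    exact ⟨DoubleSquare, inferInstance, inferInstance, DoubleSquare.finitelyAligned,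
      DoubleSquare.isKGraph, f, hV, hP, DoubleSquare.not_injective_CLi_CLiS hV hP⟩
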